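/- An $n\times n$ complex Hadamard matrix is an $n\times n$ complex matrix $H$ whose entries all have modulus one and which satisfies $H^\dagger H=nI_n$. For a positive integer $n$ let $\mathcal S_n\subseteq\{0,1,\dots,n^2\}$ be the set of all integers $m$ such that some $n\times n$ complex Hadamard matrix has exactly $m$ real entries (and hence exactly $n^2-m$ non-real entries). Then: (i) for every positive integer $n$, $\{0,1,\dots,n\}\subseteq\mathcal S_n$; (ii) for every odd positive integer $n$, $\{n+1,n+2,\dots,2n-1\}\subseteq\mathcal S_n$ (an empty condition for $n=1$); (iii) $\mathcal S_3=\{0,1,2,3,4,5,6\}$; (iv) $\mathcal S_4=\{0,1,\dots,10\}\cup\{12,16\}$; (v) $\mathcal S_6=\{0,1,\dots,22\}\cup\{24,25,26,30\}$. -/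

import Mathlib

/-- An `n × n` complex Hadamard matrix: all entries have modulus one and `H† H = n I`. -/
def IsComplexHadamard {n : ℕ} (H : Matrix (Fin n) (Fin n) ℂ) : Prop :=
  H.conjTranspose * H = (n : ℂ) • (1 : Matrix (Fin n) (Fin n) ℂ) ∧ ∀ i j, ‖H i j‖ = 1

/-- The number of real entries of a complex matrix, counted over positions. -/
noncomputable def numRealEntries {n : ℕ} (H : Matrix (Fin n) (Fin n) ℂ) : ℕ :=
  Set.ncard {p : Fin n × Fin n | (H p.1 p.2).im = 0}

/-- The set of all possible numbers of real entries of an `n × n` complex Hadamard matrix. -/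
def realEntryCounts (n : ℕ) : Set ℕ :=
  {m | ∃ H : Matrix (Fin n) (Fin n) ℂ, IsComplexHadamard H ∧ numRealEntries H = m}

open Complex ComplexConjugate


/-! Multiplying rows and columns by unimodular numbers keeps a matrix Hadamard. Hence every row can
be rephased on its own: a generic factor leaves it no real entry, and the conjugate of one of its
entries makes real exactly the entries that are real multiples of that entry. The real entries of
the whole matrix are then a sum of independently chosen row counts (`sum_mem_realEntryCounts`).

All constructions use this freedom. For general `n` the columns of the Fourier matrix get phases
`exp (j I)`; since π is irrational, no ratio of such phases is a root of unity, so accidental real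
ratios are impossible. For odd `n` the value `2 n - 1` comes from the Fourier matrix with its first
column multiplied by the root of unity. Order three uses a cube root of unity on the diagonal, order
four a real Hadamard matrix, order six `C + i I` with a conference matrix `C`, each with suitable
row and column phases.

For the upper bounds, orthogonality of two rows is a vanishing sum of the unimodular numbers `conj
a_k * b_k`, whose real terms are `±1`. Such a sum never has exactly one non-real term
(`nonrealCount_ne_one`), and with four or six terms never exactly three
(`nonrealCount_four_ne_three`, `nonrealCount_six_ne_three`). Together with parity this settles
orders three and four by counting.

In order six the numbers 0 to 5, 7, 8, 9 and 13 of non-real entries must be excluded. Each entry is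
labelled real, imaginary or generic. Two rows restrict each other through the numbers of real and
imaginary products (`Encodes.pairOk`). Two rows whose product has two or no non-real terms split the
real positions by sign, which restricts every third row (`IsComplexHadamard.exists_split`,
`IsComplexHadamard.exists_halves`). Four special configurations are impossible as well
(`false_of_triangle`, `false_of_rectangle`, `false_of_path`, `false_of_four_imaginary`). An
exhaustive search over label patterns, with rows and columns sorted to remove symmetry, finds none
that passes all tests; `IsComplexHadamard.search_eq_false` shows that a genuine matrix would be
found. -/

/-! ### Unimodular numbers, rescaling, and counting row by row -/

theorem unit_conj_mul_self {z : ℂ} (h : ‖z‖ = 1) : conj z * z = 1 := by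
  rw [Complex.conj_mul', h]; norm_num

theorem unit_mul_conj_self {z : ℂ} (h : ‖z‖ = 1) : z * conj z = 1 := by
  rw [mul_comm, unit_conj_mul_self h]

theorem unit_re_im {z : ℂ} (h : ‖z‖ = 1) : z.re * z.re + z.im * z.im = 1 := by
  have := unit_mul_conj_self h
  have h2 := congrArg Complex.re this
  simpa using h2

theorem IsComplexHadamard.scale {n : ℕ} {H : Matrix (Fin n) (Fin n) ℂ} (hH : IsComplexHadamard H)
    {c d : Fin n → ℂ} (hc : ∀ i, ‖c i‖ = 1) (hd : ∀ j, ‖d j‖ = 1) :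
    IsComplexHadamard (Matrix.of fun i j => c i * H i j * d j) := by
  refine ⟨?_, fun i j => by simp [hc, hd, hH.2]⟩
  ext i j
  have h := congrFun (congrFun hH.1 i) j
  simp only [Matrix.mul_apply, Matrix.conjTranspose_apply, Matrix.smul_apply, Matrix.of_apply,
    smul_eq_mul, RCLike.star_def, map_mul] at h ⊢
  have : ∀ k, conj (c k) * conj (H k i) * conj (d i) * (c k * H k j * d j)
      = conj (d i) * d j * (conj (H k i) * H k j) := by
    intro k
    linear_combination (conj (d i) * d j * (conj (H k i) * H k j)) * unit_conj_mul_self (hc k)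
  simp only [this, ← Finset.mul_sum, h]
  by_cases hij : i = j
  · subst hij
    linear_combination (n : ℂ) * (1 : Matrix (Fin n) (Fin n) ℂ) i i * unit_conj_mul_self (hd i)
  · simp [Matrix.one_apply_ne hij]

/-- The number of real entries in a complex vector. -/
noncomputable def realCount {n : ℕ} (v : Fin n → ℂ) : ℕ := Set.ncard {j | (v j).im = 0}

theorem numRealEntries_eq_sum {n : ℕ} (H : Matrix (Fin n) (Fin n) ℂ) :
    numRealEntries H = ∑ i, realCount (H i) := by
  classical
  have h1 : {p : Fin n × Fin n | (H p.1 p.2).im = 0}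
      = ((Finset.univ.sigma fun i => Finset.univ.filter fun j => (H i j).im = 0).map
        (Equiv.sigmaEquivProd (Fin n) (Fin n)).toEmbedding : Finset (Fin n × Fin n)) := by
    ext ⟨i, j⟩; simp
  unfold numRealEntries realCount
  rw [h1, Set.ncard_coe_finset, Finset.card_map, Finset.card_sigma]
  refine Finset.sum_congr rfl fun i _ => ?_
  rw [← Set.ncard_coe_finset]; congr 1; ext; simp

/-- `k` is the number of real entries of some unimodular multiple of `v`. -/
def AchievesCount {n : ℕ} (v : Fin n → ℂ) (k : ℕ) : Prop :=
  ∃ c : ℂ, ‖c‖ = 1 ∧ realCount (fun j => c * v j) = k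

theorem sum_mem_realEntryCounts {n : ℕ} {H : Matrix (Fin n) (Fin n) ℂ} (hH : IsComplexHadamard H)
    (m : Fin n → ℕ) (hm : ∀ i, AchievesCount (H i) (m i)) : ∑ i, m i ∈ realEntryCounts n := by
  choose c hc hm using hm
  refine ⟨_, hH.scale (d := fun _ => 1) hc (by simp), ?_⟩
  rw [numRealEntries_eq_sum]
  refine Finset.sum_congr rfl fun i _ => ?_
  rw [← hm i]; congr 1; ext j; simp [Matrix.of_apply]

theorem im_eq_zero_of_mul {c z : ℂ} (hc : ‖c‖ = 1) (hz : ‖z‖ = 1) (h : (c * z).im = 0) :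
    c = conj z ∨ c = -conj z := by
  have hcz : ‖c * z‖ = 1 := by simp [hc, hz]
  have h1 := unit_re_im hcz
  rw [h] at h1
  have h2 : (c * z).re = 1 ∨ (c * z).re = -1 := by
    apply mul_self_eq_one_iff.mp; linarith
  have h3 : c = (c * z) * conj z := by
    rw [mul_assoc, unit_mul_conj_self hz, mul_one]
  rcases h2 with h2 | h2
  · left
    have : c * z = 1 := Complex.ext (by simpa using h2) (by simpa using h)
    rw [h3, this, one_mul]
  · right
    have : c * z = -1 := Complex.ext (by simpa using h2) (by simpa using h)
    rw [h3, this]; ring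

theorem infinite_unit_circle : (Metric.sphere (0 : ℂ) 1).Infinite := by
  refine IsPreconnected.infinite_of_nontrivial (isPreconnected_sphere ?_ _ _) ⟨1, by simp, -1, by simp, ?_⟩
  · rw [Complex.rank_real_complex]; norm_num
  · norm_num

/-- Only the finitely many factors `±conj (v j)` make some entry real, and the circle is infinite.
-/
theorem achievesCount_zero {n : ℕ} {v : Fin n → ℂ} (hv : ∀ j, ‖v j‖ = 1) : AchievesCount v 0 := by
  have hfin : (Set.range (fun j => conj (v j)) ∪ Set.range (fun j => -conj (v j))).Finite :=
    (Set.finite_range _).union (Set.finite_range _)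
  obtain ⟨c, hc, hc'⟩ := (infinite_unit_circle.sdiff hfin).nonempty
  have hc1 : ‖c‖ = 1 := by simpa using hc
  refine ⟨c, hc1, ?_⟩
  unfold realCount
  rw [Set.ncard_eq_zero]
  ext j
  simp only [Set.mem_ofPred_eq, Set.mem_empty_iff_false, iff_false]
  intro h
  rcases im_eq_zero_of_mul hc1 (hv j) h with h | h
  · exact hc' (Or.inl ⟨j, h.symm⟩)
  · exact hc' (Or.inr ⟨j, h.symm⟩)

theorem achievesCount_one {n : ℕ} {v : Fin n → ℂ} (hv : ∀ j, ‖v j‖ = 1) (j : Fin n)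
    (h : ∀ k, k ≠ j → (conj (v j) * v k).im ≠ 0) : AchievesCount v 1 := by
  refine ⟨conj (v j), by simp [hv], ?_⟩
  unfold realCount
  rw [Set.ncard_eq_one]
  refine ⟨j, ?_⟩
  ext k
  simp only [Set.mem_ofPred_eq, Set.mem_singleton_iff]
  refine ⟨fun hk => by_contra fun hne => h k hne hk, ?_⟩
  rintro rfl
  rw [unit_conj_mul_self (hv k)]; simp


/-! ### Fourier matrices: the general statements (i) and (ii) -/

/-- The Fourier matrix built on the root of unity `w`. -/
def fourierMatrix (n : ℕ) (w : ℂ) : Matrix (Fin n) (Fin n) ℂ :=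
  Matrix.of fun i j => w ^ (i.val * j.val)

theorem conj_pow_mul_pow {w : ℂ} (hw : ‖w‖ = 1) (a b : ℕ) :
    conj (w ^ a) * w ^ b * w ^ a = w ^ b := by
  have h : ‖w ^ a‖ = 1 := by simp [hw]
  linear_combination w ^ b * unit_conj_mul_self h

theorem isComplexHadamard_fourierMatrix {n : ℕ} {w : ℂ} (hw : IsPrimitiveRoot w n) (hn : n ≠ 0) :
    IsComplexHadamard (fourierMatrix n w) := by
  have hw1 : ‖w‖ = 1 := hw.norm'_eq_one hn
  refine ⟨?_, fun i j => by simp [fourierMatrix, hw1]⟩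
  ext i j
  simp only [Matrix.mul_apply, Matrix.conjTranspose_apply, Matrix.smul_apply, fourierMatrix,
    Matrix.of_apply, smul_eq_mul, RCLike.star_def]
  by_cases hij : i = j
  · subst hij
    have : ∀ k : Fin n, conj (w ^ (k.val * i.val)) * w ^ (k.val * i.val) = 1 := fun k =>
      unit_conj_mul_self (by simp [hw1])
    rw [Finset.sum_congr rfl fun k _ => this k]
    simp
  · rw [Matrix.one_apply_ne hij, mul_zero]
    set z := conj (w ^ i.val) * w ^ j.val with hz
    have hk : ∀ k : Fin n, conj (w ^ (k.val * i.val)) * w ^ (k.val * j.val) = z ^ k.val := by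
      intro k
      rw [hz, mul_pow, ← map_pow, ← pow_mul, ← pow_mul, mul_comm i.val, mul_comm j.val]
    simp only [hk]
    rw [Fin.sum_univ_eq_sum_range (fun k => z ^ k) n]
    have hzn : z ^ n = 1 := by
      rw [hz, mul_pow, ← map_pow, ← pow_mul, ← pow_mul, mul_comm, pow_mul, mul_comm i.val, pow_mul,
        ← pow_mul, mul_comm j.val, pow_mul, hw.pow_eq_one]; simp
    have hz1 : z ≠ 1 := by
      intro h
      have h2 := conj_pow_mul_pow hw1 i.val j.val
      rw [← hz, h, one_mul] at h2
      exact hij (Fin.ext (hw.pow_inj i.isLt j.isLt h2))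
    have h := geom_sum_mul z n
    rw [hzn, sub_self] at h
    exact (mul_eq_zero.mp h).resolve_right (sub_ne_zero.mpr hz1)

theorem sq_eq_one_of_im {z : ℂ} (hz : ‖z‖ = 1) (h : z.im = 0) : z ^ 2 = 1 := by
  have h1 := unit_re_im hz
  rw [h] at h1
  apply Complex.ext
  · simp [pow_two, h]; linarith
  · simp [pow_two, h]

/-- Otherwise `N m` would be a non-zero integer multiple of `2 π`, and π would be rational. -/
theorem exp_int_pow_ne_one {m : ℤ} (hm : m ≠ 0) {N : ℕ} (hN : N ≠ 0) :
    (Complex.exp ((m : ℂ) * I)) ^ N ≠ 1 := by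
  intro h
  rw [← Complex.exp_nat_mul, Complex.exp_eq_one_iff] at h
  obtain ⟨k, hk⟩ := h
  have h1 : ((N : ℂ) * m) = k * (2 * Real.pi) := by
    have : ((N : ℂ) * m) * I = (k * (2 * Real.pi)) * I := by linear_combination hk
    exact mul_right_cancel₀ I_ne_zero this
  have h2 : ((N : ℝ) * m) = k * (2 * Real.pi) := by exact_mod_cast h1
  have hk0 : k ≠ 0 := by
    rintro rfl
    simp at h2
    omega
  apply irrational_pi
  refine ⟨(N * m : ℚ) / (2 * k), ?_⟩
  have : (k : ℝ) ≠ 0 := by exact_mod_cast hk0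
  push_cast
  field_simp
  linarith

theorem im_ne_zero_of_root_mul_exp {u : ℂ} {N : ℕ} (hN : N ≠ 0) (hu : u ^ N = 1) {m : ℤ}
    (hm : m ≠ 0) : (u * Complex.exp ((m : ℂ) * I)).im ≠ 0 := by
  intro h
  have hu1 : ‖u‖ = 1 := Complex.norm_eq_one_of_pow_eq_one hu hN
  have he : ‖Complex.exp ((m : ℂ) * I)‖ = 1 := by
    have := Complex.norm_exp_ofReal_mul_I (m : ℝ)
    simpa using this
  have h2 := sq_eq_one_of_im (by simp [hu1, he]) h
  have h3 : (u * Complex.exp ((m : ℂ) * I)) ^ (2 * N) = 1 := by rw [pow_mul, h2, one_pow]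
  rw [mul_pow, mul_comm 2 N, pow_mul, hu, one_pow, one_mul] at h3
  exact exp_int_pow_ne_one hm (by omega) h3

/-- Column phases: trivial in the first `k` columns, generic in the others. -/
noncomputable def genericPhase (k : ℕ) (j : ℕ) : ℂ :=
  if j < k then 1 else Complex.exp ((j : ℂ) * I)

theorem norm_exp_nat_mul_I (j : ℕ) : ‖Complex.exp ((j : ℂ) * I)‖ = 1 := by
  simpa using Complex.norm_exp_ofReal_mul_I (j : ℝ)

theorem norm_genericPhase (k j : ℕ) : ‖genericPhase k j‖ = 1 := by
  unfold genericPhase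
  split_ifs
  · simp
  · exact norm_exp_nat_mul_I j

theorem conj_exp_nat_mul_I (j : ℕ) :
    conj (Complex.exp ((j : ℂ) * I)) = Complex.exp (((-j : ℤ) : ℂ) * I) := by
  rw [← Complex.exp_conj]; simp

/-- The quotient of the two phases is `exp (m I)` with `m = -i` or `m = j - i`; in the first case `i
> 0` because `j < k ≤ i`. -/
theorem im_conj_genericPhase_ne_zero {k i j : ℕ} (hi : k ≤ i) (hij : j ≠ i) {u : ℂ}
    {N : ℕ} (hN : N ≠ 0) (hu : u ^ N = 1) :
    (u * (conj (genericPhase k i) * genericPhase k j)).im ≠ 0 := by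
  unfold genericPhase
  rw [if_neg (by omega), conj_exp_nat_mul_I]
  split_ifs with h
  · rw [mul_one]
    exact im_ne_zero_of_root_mul_exp hN hu (by omega)
  · rw [← Complex.exp_add, ← add_mul]
    have := im_ne_zero_of_root_mul_exp hN hu (m := -i + j) (by omega)
    push_cast at this ⊢
    exact this

theorem realCount_genericPhase (n k : ℕ) :
    realCount (fun j : Fin n => genericPhase (k + 1) j) = min n (k + 1) := by
  have : {j : Fin n | (genericPhase (k + 1) j).im = 0}
      = (Finset.univ.filter fun j : Fin n => j.val < k + 1 : Finset (Fin n)) := by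
    ext j
    simp only [Set.mem_ofPred_eq, Finset.coe_filter, Finset.mem_univ, true_and]
    constructor
    · intro h
      by_contra hlt
      -- Comparison with column `0`, whose phase is 1; this is why the number of trivial columns is
      -- written `k + 1`.
      have h2 := im_conj_genericPhase_ne_zero (k := k + 1) (i := j) (j := 0) (u := 1) (N := 1)
        (by omega) (by omega) one_ne_zero (one_pow _)
      apply h2
      rw [one_mul]
      simp [genericPhase, hlt] at h ⊢
      exact h
    · intro h; simp [genericPhase, h]
  unfold realCount
  rw [this, Set.ncard_coe_finset, Fin.card_filter_val_lt]

theorem conj_root_mul_pow {n : ℕ} {w : ℂ} (hw : w ^ n = 1) (a b : ℕ) :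
    (conj (w ^ a) * w ^ b) ^ n = 1 := by
  rw [mul_pow, ← map_pow, ← pow_mul, ← pow_mul, mul_comm a, mul_comm b, pow_mul, pow_mul, hw]
  simp

/-- The Fourier matrix with generic phases in all columns but the first `k`. -/
noncomputable def genericFourier (n : ℕ) (w : ℂ) (k : ℕ) : Matrix (Fin n) (Fin n) ℂ :=
  Matrix.of fun i j => 1 * fourierMatrix n w i j * genericPhase k j

theorem isComplexHadamard_genericFourier {n : ℕ} {w : ℂ} (hw : IsPrimitiveRoot w n) (hn : n ≠ 0)
    (k : ℕ) : IsComplexHadamard (genericFourier n w k) :=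
  (isComplexHadamard_fourierMatrix hw hn).scale (c := fun _ => 1) (by simp)
    (fun j => norm_genericPhase k j)

/-- Normalising by the last column isolates it: its phase is generic unless `n = 1`, when there is
no other column. -/
theorem achievesCount_one_genericFourier {n : ℕ} {w : ℂ} (hw : IsPrimitiveRoot w n) (hn : n ≠ 0)
    {k : ℕ} (hk : k + 1 < n ∨ k = 0) (i : Fin n) : AchievesCount (genericFourier n w (k + 1) i) 1 := by
  have hH := isComplexHadamard_genericFourier hw hn (k + 1)
  refine achievesCount_one (hH.2 i) ⟨n - 1, by omega⟩ fun l hl => ?_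
  by_cases h1 : n = 1
  · subst h1
    exact absurd (Subsingleton.elim _ _) hl
  have h := im_conj_genericPhase_ne_zero (k := k + 1) (i := n - 1) (j := l.val) (N := n)
    (u := conj (w ^ (i.val * (n - 1))) * w ^ (i.val * l.val)) (by omega)
    (fun h => hl (Fin.ext h)) hn (conj_root_mul_pow hw.pow_eq_one _ _)
  convert h using 2
  simp only [genericFourier, fourierMatrix, Matrix.of_apply, map_mul, map_one]
  ring

theorem mem_realEntryCounts_of_le {n m : ℕ} (hn : 0 < n) (hm : m ≤ n) : m ∈ realEntryCounts n := by
  have hw := Complex.isPrimitiveRoot_exp n hn.ne'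
  set w := Complex.exp (2 * Real.pi * I / n)
  have hH := isComplexHadamard_genericFourier hw hn.ne' (0 + 1)
  have h := sum_mem_realEntryCounts hH (fun i => if i.val < m then 1 else 0) fun i => by
    split_ifs
    · exact achievesCount_one_genericFourier hw hn.ne' (Or.inr rfl) i
    · exact achievesCount_zero (hH.2 i)
  rwa [Finset.sum_boole, Fin.card_filter_val_lt, Nat.cast_id, min_eq_right hm] at h

/-- Row `0` of the Fourier matrix is constant, so it contributes its `k + 1` trivial columns; every
other row contributes 1. -/
theorem add_mem_realEntryCounts {n k : ℕ} (hk : k + 1 < n) : n + k ∈ realEntryCounts n := by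
  have hn : n ≠ 0 := by omega
  have hw := Complex.isPrimitiveRoot_exp n hn
  set w := Complex.exp (2 * Real.pi * I / n)
  have hH := isComplexHadamard_genericFourier hw hn (k + 1)
  have h := sum_mem_realEntryCounts hH (fun i => if i = ⟨0, by omega⟩ then k + 1 else 1) fun i => by
    split_ifs with h
    · refine ⟨1, by simp, ?_⟩
      refine Eq.trans ?_ ((realCount_genericPhase n k).trans (min_eq_right hk.le))
      congr 1
      ext j
      simp [h, genericFourier, fourierMatrix]
    · exact achievesCount_one_genericFourier hw hn (Or.inl hk) i
  have h2 : ∀ i : Fin n, (if i = ⟨0, by omega⟩ then k + 1 else 1)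
      = (if i = ⟨0, by omega⟩ then k else 0) + 1 := fun i => by split_ifs <;> rfl
  simp only [h2, Finset.sum_add_distrib, Finset.sum_ite_eq', Finset.mem_univ, if_true,
    Finset.sum_const, Finset.card_univ, Fintype.card_fin, smul_eq_mul, mul_one] at h
  rwa [add_comm] at h

theorem IsPrimitiveRoot.pow_eq_pow_iff {n : ℕ} {w : ℂ} (hw : IsPrimitiveRoot w n) (hn : 0 < n) {a b : ℕ} :
    w ^ a = w ^ b ↔ a ≡ b [MOD n] := by
  rw [← pow_mod_orderOf w a, ← pow_mod_orderOf w b, ← hw.eq_orderOf]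
  exact ⟨fun h => hw.pow_inj (Nat.mod_lt _ hn) (Nat.mod_lt _ hn) h, fun h => by rw [h]⟩

/-- For odd `n` the number `-1` is not an `n`-th root of unity, so a real quotient of two such roots
is 1. -/
theorem im_root_mul_ne_zero {n : ℕ} (hodd : Odd n) {w : ℂ} (hw : IsPrimitiveRoot w n) {a b : ℕ}
    (h : ¬ a ≡ b [MOD n]) : (conj (w ^ a) * w ^ b).im ≠ 0 := by
  intro him
  have hn : n ≠ 0 := by rintro rfl; simp at hodd
  have hw1 : ‖w‖ = 1 := hw.norm'_eq_one hn
  have h2 := sq_eq_one_of_im (by simp [hw1]) him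
  have hr := conj_root_mul_pow hw.pow_eq_one a b
  obtain ⟨t, rfl⟩ := hodd
  have h1 : conj (w ^ a) * w ^ b = 1 := by
    rw [pow_succ, pow_mul, h2, one_pow, one_mul] at hr
    exact hr
  have h3 := conj_pow_mul_pow hw1 a b
  rw [h1, one_mul] at h3
  exact h ((hw.pow_eq_pow_iff (by omega)).mp h3)

/-- The column exponents that give `2 n - 1` real entries. -/
def shiftedExponent (i j : ℕ) : ℕ := if j = 0 then 1 else i * j

/-- Row `0` has one exponent 1 and `n - 1` exponents 0. Row `1` has exponent 1 twice. Each remaining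
row has an exponent that occurs only once. The total is `(n - 1) + 2 + (n - 2)`. -/
theorem two_mul_sub_one_mem {n : ℕ} (hodd : Odd n) (hn : 3 ≤ n) : 2 * n - 1 ∈ realEntryCounts n := by
  have hn0 : n ≠ 0 := by omega
  have hw := Complex.isPrimitiveRoot_exp n hn0
  set w := Complex.exp (2 * Real.pi * I / n)
  have hw1 : ‖w‖ = 1 := hw.norm'_eq_one hn0
  have hH := (isComplexHadamard_fourierMatrix hw hn0).scale (c := fun _ => 1)
    (d := fun j => if j.val = 0 then w else 1) (by simp) (fun j => by split_ifs <;> simp [hw1])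
  set H := Matrix.of fun i j => 1 * fourierMatrix n w i j * (if j.val = 0 then w else 1)
  have hval : ∀ i j : Fin n, H i j = w ^ shiftedExponent i j := by
    intro i j
    simp only [H, Matrix.of_apply, fourierMatrix, shiftedExponent]
    split_ifs with h <;> simp [h]
  have hcount : ∀ i l : Fin n, realCount (fun j => conj (H i l) * H i j)
      = (Finset.univ.filter fun j : Fin n => shiftedExponent i l ≡ shiftedExponent i j [MOD n]).card := by
    intro i l
    unfold realCount
    rw [← Set.ncard_coe_finset]
    congr 1
    ext j
    simp only [Set.mem_ofPred_eq, Finset.coe_filter, Finset.mem_univ, true_and, hval]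
    constructor
    · intro h
      by_contra h2
      exact im_root_mul_ne_zero hodd hw h2 h
    · intro h
      rw [(hw.pow_eq_pow_iff (by omega)).mpr h, unit_conj_mul_self (by simp [hw1])]
      simp
  have hone : ∀ i l : Fin n, (∀ j : Fin n, shiftedExponent i l ≡ shiftedExponent i j [MOD n] → j = l) →
      AchievesCount (H i) 1 := by
    intro i l h
    refine ⟨conj (H i l), by simp [hH.2], ?_⟩
    rw [hcount, Finset.card_eq_one]
    refine ⟨l, Finset.ext fun j => ?_⟩
    simp only [Finset.mem_filter, Finset.mem_univ, true_and, Finset.mem_singleton]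
    exact ⟨h j, by rintro rfl; rfl⟩
  have small : ∀ a b : ℕ, a < n → b < n → (a ≡ b [MOD n] ↔ a = b) := by
    intro a b ha hb
    unfold Nat.ModEq
    rw [Nat.mod_eq_of_lt ha, Nat.mod_eq_of_lt hb]
  have lt0 : 0 < n := by omega
  have lt1 : 1 < n := by omega
  have h := sum_mem_realEntryCounts hH
    (fun i => (if i = ⟨0, lt0⟩ then n - 2 else 0) + (if i = ⟨1, lt1⟩ then 1 else 0) + 1)
    fun i => by
      by_cases h0 : i.val = 0
      · obtain rfl : i = ⟨0, lt0⟩ := Fin.ext h0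
        refine ⟨conj (H ⟨0, lt0⟩ ⟨1, lt1⟩), by simp [hH.2], ?_⟩
        rw [hcount]
        have : (Finset.univ.filter fun j : Fin n => shiftedExponent 0 1 ≡ shiftedExponent 0 j [MOD n])
            = Finset.univ.erase ⟨0, lt0⟩ := by
          ext j
          simp only [Finset.mem_filter, Finset.mem_univ, true_and, Finset.mem_erase, ne_eq, and_true,
            Fin.ext_iff]
          unfold shiftedExponent
          by_cases hj : j.val = 0
          · simp [hj, small 0 1 (by omega) (by omega)]
          · simp [hj]; rfl
        simp only at this ⊢
        rw [this, Finset.card_erase_of_mem (Finset.mem_univ _)]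
        simp
        omega
      · by_cases h1 : i.val = 1
        · obtain rfl : i = ⟨1, lt1⟩ := Fin.ext h1
          refine ⟨conj (H ⟨1, lt1⟩ ⟨1, lt1⟩), by simp [hH.2], ?_⟩
          rw [hcount]
          have : (Finset.univ.filter fun j : Fin n =>
              shiftedExponent 1 1 ≡ shiftedExponent 1 j [MOD n])
              = {⟨0, lt0⟩, ⟨1, lt1⟩} := by
            ext j
            simp only [Finset.mem_filter, Finset.mem_univ, true_and, Finset.mem_insert,
              Finset.mem_singleton, Fin.ext_iff]
            unfold shiftedExponent
            by_cases hj : j.val = 0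
            · simp [hj]; rfl
            · simp [hj, small 1 j (by omega) j.isLt]; omega
          simp only at this ⊢
          rw [this, Finset.card_pair (by simp)]
          simp
        · have e : (if i = (⟨0, lt0⟩ : Fin n) then n - 2 else 0)
              + (if i = (⟨1, lt1⟩ : Fin n) then 1 else 0) + 1 = 1 := by
            simp [Fin.ext_iff, h0, h1]
          rw [e]
          -- If the exponent 1 of column `0` recurs at `j`, then `i` is invertible modulo `n`, so
          -- the exponents `i * l` are pairwise incongruent and the value 2, at column `2 j`, is
          -- unique. Otherwise column `0` itself is unique.
          by_cases hu : ∃ j : Fin n, j.val ≠ 0 ∧ i.val * j.val ≡ 1 [MOD n]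
          · obtain ⟨j, hj0, hj⟩ := hu
            have hcop : ∀ a b : ℕ, i.val * a ≡ i.val * b [MOD n] → a ≡ b [MOD n] := by
              intro a b hab
              calc a = 1 * a := (one_mul a).symm
                _ ≡ (i * j) * a [MOD n] := (hj.symm).mul_right a
                _ = j * (i * a) := by ring
                _ ≡ j * (i * b) [MOD n] := hab.mul_left _
                _ = (i * j) * b := by ring
                _ ≡ 1 * b [MOD n] := hj.mul_right b
                _ = b := one_mul b
            have hil : i.val * ((2 * j.val) % n) ≡ 2 [MOD n] := by
              calc i.val * ((2 * j.val) % n) ≡ i.val * (2 * j.val) [MOD n] :=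
                    (Nat.mod_modEq _ _).mul_left _
                _ = 2 * (i * j) := by ring
                _ ≡ 2 * 1 [MOD n] := hj.mul_left _
            have hl0 : (2 * j.val) % n ≠ 0 := by
              intro h0
              rw [h0, mul_zero, small 0 2 (by omega) (by omega)] at hil
              omega
            refine hone i ⟨(2 * j.val) % n, Nat.mod_lt _ (by omega)⟩ fun k hk => ?_
            unfold shiftedExponent at hk
            simp only [hl0, if_false] at hk
            by_cases hk0 : k.val = 0
            · simp only [hk0, if_true] at hk
              have := hk.symm.trans hil
              rw [small 1 2 (by omega) (by omega)] at this
              omega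
            · simp only [hk0, if_false] at hk
              have := hcop _ _ hk
              rw [small _ _ (Nat.mod_lt _ (by omega)) k.isLt] at this
              exact Fin.ext this.symm
          · refine hone i ⟨0, lt0⟩ fun k hk => ?_
            unfold shiftedExponent at hk
            by_contra hne
            have hk0 : k.val ≠ 0 := fun h => hne (Fin.ext h)
            simp only [if_true, hk0, if_false] at hk
            exact hu ⟨k, hk0, hk.symm⟩
  simp only [Finset.sum_add_distrib, Finset.sum_ite_eq', Finset.mem_univ, if_true,
    Finset.sum_const, Finset.card_univ, Fintype.card_fin, smul_eq_mul, mul_one] at h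
  have e : n - 2 + 1 + n = 2 * n - 1 := by omega
  rwa [e] at h

theorem Icc_subset_realEntryCounts {n : ℕ} (hn : 0 < n) : Set.Icc 0 n ⊆ realEntryCounts n :=
  fun _ hm => mem_realEntryCounts_of_le hn hm.2

theorem Icc_subset_realEntryCounts_of_odd {n : ℕ} (hodd : Odd n) :
    Set.Icc (n + 1) (2 * n - 1) ⊆ realEntryCounts n := by
  rintro m ⟨h1, h2⟩
  rcases Nat.lt_or_ge m (2 * n - 1) with h | h
  -- Values below `2 n - 1` are `n + k` with `k + 1 < n`; only the top value needs `n` odd.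
  · obtain ⟨k, rfl⟩ := Nat.exists_eq_add_of_le (show n ≤ m by omega)
    exact add_mem_realEntryCounts (by omega)
  · obtain rfl : m = 2 * n - 1 := by omega
    obtain ⟨t, rfl⟩ := hodd
    exact two_mul_sub_one_mem ⟨t, rfl⟩ (by omega)


/-! ### Matrices with entries in `{±1, ±i}`: constructions for orders three, four and six -/

/-- The complex matrix with real part `A` and imaginary part `B`. -/
noncomputable def gaussMatrix {n : ℕ} (A B : Fin n → Fin n → ℤ) : Matrix (Fin n) (Fin n) ℂ :=
  Matrix.of fun i j => (A i j : ℂ) + (B i j : ℂ) * I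

/-- The integral form of the Hadamard condition for `gaussMatrix A B`. -/
structure IsGaussHadamard {n : ℕ} (A B : Fin n → Fin n → ℤ) : Prop where
  re : ∀ i j, ∑ k, (A k i * A k j + B k i * B k j) = if i = j then (n : ℤ) else 0
  im : ∀ i j, ∑ k, (A k i * B k j - B k i * A k j) = 0
  unit : ∀ i j, A i j = 0 ∧ B i j * B i j = 1 ∨ A i j * A i j = 1 ∧ B i j = 0

theorem IsGaussHadamard.norm {n : ℕ} {A B : Fin n → Fin n → ℤ} (h : IsGaussHadamard A B)
    (i j : Fin n) : ‖gaussMatrix A B i j‖ = 1 := by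
  simp only [gaussMatrix, Matrix.of_apply]
  rcases h.unit i j with ⟨h1, h2⟩ | ⟨h1, h2⟩
  · rw [mul_self_eq_one_iff] at h2
    rcases h2 with h2 | h2 <;> simp [h1, h2]
  · rw [mul_self_eq_one_iff] at h1
    rcases h1 with h1 | h1 <;> simp [h1, h2]

theorem IsGaussHadamard.pow_four {n : ℕ} {A B : Fin n → Fin n → ℤ} (h : IsGaussHadamard A B)
    (i j : Fin n) : gaussMatrix A B i j ^ 4 = 1 := by
  simp only [gaussMatrix, Matrix.of_apply]
  rcases h.unit i j with ⟨h1, h2⟩ | ⟨h1, h2⟩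
  · rw [mul_self_eq_one_iff] at h2
    rcases h2 with h2 | h2 <;> simp [h1, h2, Even.neg_pow (by decide : Even 4)]
  · rw [mul_self_eq_one_iff] at h1
    rcases h1 with h1 | h1 <;> simp [h1, h2, Even.neg_pow (by decide : Even 4)]

theorem IsGaussHadamard.isComplexHadamard {n : ℕ} {A B : Fin n → Fin n → ℤ}
    (h : IsGaussHadamard A B) : IsComplexHadamard (gaussMatrix A B) := by
  refine ⟨?_, h.norm⟩
  ext i j
  simp only [Matrix.mul_apply, Matrix.conjTranspose_apply, Matrix.smul_apply, gaussMatrix,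
    Matrix.of_apply, smul_eq_mul, RCLike.star_def, map_add, map_mul, Complex.conj_I,
    map_intCast]
  have : ∀ k, ((A k i : ℂ) + (B k i : ℂ) * -I) * ((A k j : ℂ) + (B k j : ℂ) * I)
      = ((A k i * A k j + B k i * B k j : ℤ) : ℂ) + ((A k i * B k j - B k i * A k j : ℤ) : ℂ) * I := by
    intro k
    push_cast
    linear_combination (-(B k i * B k j : ℂ)) * I_sq
  simp only [this, Finset.sum_add_distrib, ← Finset.sum_mul, ← Int.cast_sum, h.im, h.re,
    Matrix.one_apply]
  split_ifs <;> simp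

theorem im_gaussMatrix {n : ℕ} (A B : Fin n → Fin n → ℤ) (i j : Fin n) :
    (gaussMatrix A B i j).im = B i j := by
  simp [gaussMatrix]

theorem re_gaussMatrix {n : ℕ} (A B : Fin n → Fin n → ℤ) (i j : Fin n) :
    (gaussMatrix A B i j).re = A i j := by
  simp [gaussMatrix]

theorem realCount_eq_card {n : ℕ} {v : Fin n → ℂ} {p : Fin n → Prop} [DecidablePred p]
    (h : ∀ j, (v j).im = 0 ↔ p j) : realCount v = (Finset.univ.filter p).card := by
  unfold realCount
  rw [← Set.ncard_coe_finset]
  congr 1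
  ext j
  simp [h]

theorem achievesCount_gauss_real {n : ℕ} (A B : Fin n → Fin n → ℤ) (i : Fin n) :
    AchievesCount (gaussMatrix A B i) (Finset.univ.filter fun j => B i j = 0).card :=
  ⟨1, by simp, realCount_eq_card fun j => by simp [im_gaussMatrix]⟩

theorem achievesCount_gauss_imag {n : ℕ} (A B : Fin n → Fin n → ℤ) (i : Fin n) :
    AchievesCount (gaussMatrix A B i) (Finset.univ.filter fun j => A i j = 0).card :=
  ⟨I, by simp, realCount_eq_card fun j => by simp [re_gaussMatrix]⟩

/-- A Gaussian Hadamard matrix with a generic phase in its first column. -/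
noncomputable def phasedGauss {n : ℕ} (A B : Fin n → Fin n → ℤ) : Matrix (Fin n) (Fin n) ℂ :=
  Matrix.of fun i j => 1 * gaussMatrix A B i j *
    (if j.val = 0 then Complex.exp (((1 : ℤ) : ℂ) * I) else 1)

theorem norm_exp_int_mul_I (m : ℤ) : ‖Complex.exp ((m : ℂ) * I)‖ = 1 := by
  simpa using Complex.norm_exp_ofReal_mul_I (m : ℝ)

theorem IsGaussHadamard.isComplexHadamard_phased {n : ℕ} {A B : Fin n → Fin n → ℤ}
    (h : IsGaussHadamard A B) : IsComplexHadamard (phasedGauss A B) :=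
  h.isComplexHadamard.scale (c := fun _ => 1) (by simp) (fun j => by
    split_ifs
    · exact norm_exp_int_mul_I 1
    · simp)

theorem IsGaussHadamard.achievesCount_phased {n : ℕ} {A B : Fin n → Fin n → ℤ}
    (h : IsGaussHadamard A B) (i : Fin n) :
    AchievesCount (phasedGauss A B i) (Finset.univ.filter fun j => j.val ≠ 0 ∧ B i j = 0).card := by
  refine ⟨1, by simp, realCount_eq_card fun j => ?_⟩
  simp only [phasedGauss, Matrix.of_apply, one_mul]
  split_ifs with hj
  · simpa [hj] using im_ne_zero_of_root_mul_exp four_ne_zero (h.pow_four i j) one_ne_zero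
  · simp [hj, im_gaussMatrix]

/-- The quotient of any other entry by the first one is a fourth root of unity times `exp (-I)`,
hence not real. -/
theorem IsGaussHadamard.achievesCount_phased_one {n : ℕ} {A B : Fin n → Fin n → ℤ}
    (h : IsGaussHadamard A B) (i : Fin n) : AchievesCount (phasedGauss A B i) 1 := by
  refine achievesCount_one (h.isComplexHadamard_phased.2 i) ⟨0, i.pos⟩ fun k hk => ?_
  have hk0 : k.val ≠ 0 := fun h0 => hk (Fin.ext h0)
  have hc : conj (Complex.exp (((1 : ℤ) : ℂ) * I)) = Complex.exp (((-1 : ℤ) : ℂ) * I) := by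
    rw [← Complex.exp_conj]; simp
  simp only [phasedGauss, Matrix.of_apply, one_mul, if_true, hk0, if_false, mul_one, map_mul, hc]
  rw [mul_right_comm]
  refine im_ne_zero_of_root_mul_exp four_ne_zero ?_ (by norm_num)
  rw [mul_pow, ← map_pow, h.pow_four, h.pow_four]; simp

theorem mul_add_mem_realEntryCounts {n p a b : ℕ} {H : Matrix (Fin n) (Fin n) ℂ}
    (hH : IsComplexHadamard H) (hp : ∀ i, AchievesCount (H i) (p + 1))
    (h1 : ∀ i, AchievesCount (H i) 1) (hab : a + b ≤ n) :
    (p + 1) * a + b ∈ realEntryCounts n := by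
  have h := sum_mem_realEntryCounts hH
    (fun i => (if i.val < a then p else 0) + (if i.val < a + b then 1 else 0)) fun i => by
      split_ifs with h h'
      · exact hp i
      · omega
      · exact h1 i
      · exact achievesCount_zero (hH.2 i)
  have e : ∀ i : Fin n, (if i.val < a then p else 0) = p * (if i.val < a then 1 else 0) := fun i => by
    split_ifs <;> simp
  simp only [e, Finset.sum_add_distrib, ← Finset.mul_sum, Finset.sum_boole, Fin.card_filter_val_lt,
    Nat.cast_id, min_eq_right hab, min_eq_right (show a ≤ n by omega)] at h
  convert h using 1
  ring

/-- A real Hadamard matrix of order four. -/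
def realHadamardFour : Fin 4 → Fin 4 → ℤ :=
  ![![1, 1, 1, 1], ![1, -1, 1, -1], ![1, 1, -1, -1], ![1, -1, -1, 1]]

theorem isGaussHadamard_four : IsGaussHadamard realHadamardFour (fun _ _ => 0) :=
  ⟨by decide, by decide, by decide⟩

/-- The real matrix itself gives 16. With a generic first column every row can have 3, 1 or 0 real
entries, and `3 a + b` with `a + b ≤ 4` covers the other values. -/
theorem mem_realEntryCounts_four {m : ℕ} (h : m ≤ 10 ∨ m = 12 ∨ m = 16) :
    m ∈ realEntryCounts 4 := by
  by_cases h16 : m = 16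
  · subst h16
    exact sum_mem_realEntryCounts isGaussHadamard_four.isComplexHadamard (fun _ => 4)
      (fun i => achievesCount_gauss_real _ _ i)
  · have key : ∀ m < 13, m ≠ 11 → ∃ a < 5, ∃ b < 5, a + b ≤ 4 ∧ (2 + 1) * a + b = m := by decide
    obtain ⟨a, -, b, -, hab, rfl⟩ := key m (by omega) (by omega)
    refine mul_add_mem_realEntryCounts isGaussHadamard_four.isComplexHadamard_phased
      (fun i => ?_) isGaussHadamard_four.achievesCount_phased_one hab
    convert isGaussHadamard_four.achievesCount_phased i using 1
    revert i; decide

/-- The real part of `C + i I`, for `C` the conference matrix of order six. -/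
def conferenceSix : Fin 6 → Fin 6 → ℤ :=
  ![![0, 1, 1, 1, 1, 1], ![1, 0, 1, -1, -1, 1], ![1, 1, 0, 1, -1, -1],
    ![1, -1, 1, 0, 1, -1], ![1, -1, -1, 1, 0, 1], ![1, 1, -1, -1, 1, 0]]

/-- The imaginary part of `C + i I`. -/
def diagonalSix : Fin 6 → Fin 6 → ℤ := fun i j => if i = j then 1 else 0

/-- The real part of `C + i I` after multiplication of row `0` and column `1` by `i`. -/
def switchedSixRe : Fin 6 → Fin 6 → ℤ :=
  ![![-1, -1, 0, 0, 0, 0], ![1, -1, 1, -1, -1, 1], ![1, 0, 0, 1, -1, -1],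
    ![1, 0, 1, 0, 1, -1], ![1, 0, -1, 1, 0, 1], ![1, 0, -1, -1, 1, 0]]

/-- The imaginary part of `C + i I` after multiplication of row `0` and column `1` by `i`. -/
def switchedSixIm : Fin 6 → Fin 6 → ℤ :=
  ![![0, 0, 1, 1, 1, 1], ![0, 0, 0, 0, 0, 0], ![0, 1, 1, 0, 0, 0],
    ![0, -1, 0, 1, 0, 0], ![0, -1, 0, 0, 1, 0], ![0, 1, 0, 0, 0, 1]]

theorem isGaussHadamard_six : IsGaussHadamard conferenceSix diagonalSix :=
  ⟨by decide, by decide, by decide⟩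

theorem isGaussHadamard_switchedSix : IsGaussHadamard switchedSixRe switchedSixIm :=
  ⟨by decide, by decide, by decide⟩

/-- Rows of `C + i I` have 5 real entries, or 1 after multiplication by `i`, or 0 after a generic
factor; `5 a + b` with `a + b ≤ 6` misses only 19 and 24 among the claimed values. A generic first
column leaves 5 real entries in row `0` and 4 in the others, whence `19 = 5 + 4 + 4 + 4 + 1 + 1`.
The switched matrix has `2 + 6 + 4 * 4 = 24`. -/
theorem mem_realEntryCounts_six {m : ℕ} (h : m ≤ 22 ∨ m = 24 ∨ m = 25 ∨ m = 26 ∨ m = 30) :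
    m ∈ realEntryCounts 6 := by
  by_cases h19 : m = 19
  · subst h19
    have hH := isGaussHadamard_six.isComplexHadamard_phased
    refine sum_mem_realEntryCounts hH ![5, 4, 4, 4, 1, 1] fun i => ?_
    have hc : ∀ i : Fin 6, ![5, 4, 4, 4, 1, 1] i = 1 ∨ ![5, 4, 4, 4, 1, 1] i
        = (Finset.univ.filter fun j : Fin 6 => j.val ≠ 0 ∧ diagonalSix i j = 0).card := by decide
    rcases hc i with h | h
    · rw [h]; exact isGaussHadamard_six.achievesCount_phased_one i
    · rw [h]; exact isGaussHadamard_six.achievesCount_phased i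
  by_cases h24 : m = 24
  · subst h24
    exact sum_mem_realEntryCounts isGaussHadamard_switchedSix.isComplexHadamard
      _ (fun i => achievesCount_gauss_real _ _ i)
  · have key : ∀ m < 31, (m ≤ 22 ∨ m = 25 ∨ m = 26 ∨ m = 30) → m ≠ 19 →
        ∃ a < 7, ∃ b < 7, a + b ≤ 6 ∧ (4 + 1) * a + b = m := by decide
    obtain ⟨a, -, b, -, hab, rfl⟩ := key m (by omega) (by omega) h19
    refine mul_add_mem_realEntryCounts isGaussHadamard_six.isComplexHadamard
      (fun i => ?_) (fun i => ?_) hab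
    · convert achievesCount_gauss_real conferenceSix diagonalSix i using 1
      revert i; decide
    · convert achievesCount_gauss_imag conferenceSix diagonalSix i using 1
      revert i; decide

/-- With a primitive cube root of unity `w` on the diagonal and 1 elsewhere, distinct columns have
inner product `conj w + w + 1 = 0`. -/
theorem six_mem_realEntryCounts_three : 6 ∈ realEntryCounts 3 := by
  have hw := Complex.isPrimitiveRoot_exp 3 three_ne_zero
  set w := Complex.exp (2 * Real.pi * I / (3 : ℕ))
  have hw1 : ‖w‖ = 1 := hw.norm'_eq_one three_ne_zero
  have hodd : Odd 3 := ⟨1, rfl⟩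
  have hwi : w.im ≠ 0 := by
    simpa using im_root_mul_ne_zero hodd hw (a := 0) (b := 1) (by decide)
  have hsum : w ^ 2 + w + 1 = 0 := by
    have h := hw.geom_sum_eq_zero (by norm_num)
    simp only [Finset.sum_range_succ, Finset.sum_range_zero] at h
    linear_combination h
  have h2 := unit_conj_mul_self hw1
  have hw3 : w ^ 3 = 1 := hw.pow_eq_one
  have hc : conj w = w ^ 2 := by linear_combination conj w * (-hw3) + w ^ 2 * h2
  refine ⟨Matrix.of fun i j => if i = j then w else 1, ⟨?_, fun i j => ?_⟩, ?_⟩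
  · ext i j
    simp only [Matrix.mul_apply, Matrix.conjTranspose_apply, Matrix.smul_apply, Matrix.of_apply,
      RCLike.star_def, Fin.sum_univ_three]
    fin_cases i <;> fin_cases j <;> simp [hc] <;>
      first | linear_combination hsum | linear_combination hw3
  · simp only [Matrix.of_apply]; split_ifs <;> simp [hw1]
  · rw [numRealEntries_eq_sum]
    have : ∀ i : Fin 3, realCount ((Matrix.of fun i j : Fin 3 => if i = j then w else 1) i)
        = (Finset.univ.filter fun j => i ≠ j).card := fun i => realCount_eq_card fun j => by
      simp only [Matrix.of_apply]
      split_ifs with h <;> simp [h, hwi]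
    simp only [this]
    decide

theorem mem_realEntryCounts_three {m : ℕ} (h : m ≤ 6) : m ∈ realEntryCounts 3 := by
  rcases Nat.lt_or_ge 3 m with h3 | h3
  · rcases Nat.lt_or_ge 5 m with h5 | h5
    · obtain rfl : m = 6 := by omega
      exact six_mem_realEntryCounts_three
    · exact Icc_subset_realEntryCounts_of_odd ⟨1, rfl⟩ ⟨h3, h5⟩
  · exact mem_realEntryCounts_of_le (by norm_num) h3


/-! ### Non-real entries and the upper bounds for orders three and four -/

theorem IsComplexHadamard.column_orth {n : ℕ} {H : Matrix (Fin n) (Fin n) ℂ}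
    (hH : IsComplexHadamard H) {i j : Fin n} (hij : i ≠ j) : ∑ k, conj (H k i) * H k j = 0 := by
  have h := congrFun (congrFun hH.1 i) j
  simpa [Matrix.mul_apply, Matrix.one_apply_ne hij] using h

theorem IsComplexHadamard.transpose {n : ℕ} {H : Matrix (Fin n) (Fin n) ℂ}
    (hH : IsComplexHadamard H) : IsComplexHadamard H.transpose := by
  refine ⟨?_, fun i j => hH.2 j i⟩
  rcases Nat.eq_zero_or_pos n with rfl | hn
  · ext i; exact i.elim0
  have hn' : (n : ℂ) ≠ 0 := by exact_mod_cast hn.ne'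
  have h1 : ((n : ℂ)⁻¹ • H.conjTranspose) * H = 1 := by
    rw [Matrix.smul_mul, hH.1, smul_smul, inv_mul_cancel₀ hn', one_smul]
  have h2 := mul_eq_one_comm.mp h1
  rw [Matrix.mul_smul] at h2
  have h3 : H * H.conjTranspose = (n : ℂ) • (1 : Matrix (Fin n) (Fin n) ℂ) := by
    rw [← h2, smul_smul, mul_inv_cancel₀ hn', one_smul]
  have h4 := congrArg Matrix.transpose h3
  rw [Matrix.transpose_mul, Matrix.transpose_smul, Matrix.transpose_one] at h4
  exact h4

theorem IsComplexHadamard.row_orth {n : ℕ} {H : Matrix (Fin n) (Fin n) ℂ}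
    (hH : IsComplexHadamard H) {i j : Fin n} (hij : i ≠ j) : ∑ k, conj (H i k) * H j k = 0 :=
  hH.transpose.column_orth hij

theorem IsComplexHadamard.submatrix {n : ℕ} {H : Matrix (Fin n) (Fin n) ℂ}
    (hH : IsComplexHadamard H) (s t : Equiv.Perm (Fin n)) : IsComplexHadamard (H.submatrix s t) := by
  refine ⟨?_, fun i j => hH.2 _ _⟩
  rw [Matrix.conjTranspose_submatrix, Matrix.submatrix_mul_equiv, hH.1]
  ext i j
  simp [Matrix.one_apply]

/-- The positions of the non-real entries of a vector. -/
noncomputable def nonrealSet {n : ℕ} (v : Fin n → ℂ) : Finset (Fin n) :=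
  Finset.univ.filter fun j => (v j).im ≠ 0

theorem mem_nonrealSet {n : ℕ} {v : Fin n → ℂ} {j : Fin n} : j ∈ nonrealSet v ↔ (v j).im ≠ 0 := by
  simp [nonrealSet]

/-- The number of non-real entries in a complex vector. -/
noncomputable def nonrealCount {n : ℕ} (v : Fin n → ℂ) : ℕ := (nonrealSet v).card

theorem card_nonrealSet {n : ℕ} (v : Fin n → ℂ) : (nonrealSet v).card = nonrealCount v := rfl

theorem mem_nonrealSet_transpose {n : ℕ} {H : Matrix (Fin n) (Fin n) ℂ} {i j : Fin n} :
    i ∈ nonrealSet (H.transpose j) ↔ j ∈ nonrealSet (H i) := by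
  simp [mem_nonrealSet]

theorem realCount_add_nonrealCount {n : ℕ} (v : Fin n → ℂ) :
    realCount v + nonrealCount v = n := by
  classical
  have h : realCount v = (Finset.univ.filter fun j => (v j).im = 0).card :=
    realCount_eq_card fun j => Iff.rfl
  rw [h, nonrealCount, nonrealSet, Finset.card_filter_add_card_filter_not, Finset.card_univ, Fintype.card_fin]

theorem numRealEntries_add_sum_nonrealCount {n : ℕ} (H : Matrix (Fin n) (Fin n) ℂ) :
    numRealEntries H + ∑ i, nonrealCount (H i) = n * n := by
  rw [numRealEntries_eq_sum, ← Finset.sum_add_distrib]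
  simp [realCount_add_nonrealCount]

theorem sum_nonrealCount_transpose {n : ℕ} (H : Matrix (Fin n) (Fin n) ℂ) :
    ∑ i, nonrealCount (H.transpose i) = ∑ i, nonrealCount (H i) := by
  have h : ∀ v : Fin n → ℂ, nonrealCount v = ∑ j, if (v j).im ≠ 0 then 1 else 0 := fun v => by
    rw [nonrealCount, nonrealSet, Finset.card_filter]
  simp only [h, Matrix.transpose_apply]
  exact Finset.sum_comm

theorem real_unit {z : ℂ} (hz : ‖z‖ = 1) (h : z.im = 0) : z = 1 ∨ z = -1 :=
  mul_self_eq_one_iff.mp (by rw [← pow_two]; exact sq_eq_one_of_im hz h)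

theorem nonrealCount_ne_one {n : ℕ} {v : Fin n → ℂ} (h0 : ∑ k, v k = 0) : nonrealCount v ≠ 1 := by
  classical
  intro h
  obtain ⟨a, ha⟩ := Finset.card_eq_one.mp h
  have him := congrArg Complex.im h0
  rw [Complex.im_sum, ← Finset.sum_filter_ne_zero] at him
  change ∑ x ∈ nonrealSet v, _ = _ at him
  rw [ha] at him
  have : a ∈ nonrealSet v := by rw [ha]; simp
  exact mem_nonrealSet.mp this (by simpa using him)

/-- Conjugating the relation gives the second symmetric function of `a, b, c` in terms of the third;
then `-e` is a root of the cubic with roots `a, b, c`. Geometrically, the sides of a closed rhombus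
are opposite in pairs. -/
theorem one_real_of_sum {a b c e : ℂ} (ha : ‖a‖ = 1) (hb : ‖b‖ = 1) (hc : ‖c‖ = 1)
    (he : e = 1 ∨ e = -1) (h : a + b + c + e = 0) : a.im = 0 ∨ b.im = 0 ∨ c.im = 0 := by
  have hce : conj e = e := by rcases he with rfl | rfl <;> simp
  have hee : e * e = 1 := by rcases he with rfl | rfl <;> simp
  have hei : e.im = 0 := by rcases he with rfl | rfl <;> simp
  have h' : conj a + conj b + conj c + e = 0 := by
    have := congrArg conj h
    simpa [hce] using this
  have ha' := unit_mul_conj_self ha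
  have hb' := unit_mul_conj_self hb
  have hc' := unit_mul_conj_self hc
  have key : (a + e) * ((b + e) * (c + e)) = 0 := by
    linear_combination h * (e * e) + e * (a * b * c) * h' - e * b * c * ha' - e * a * c * hb'
      - e * a * b * hc' - a * b * c * hee
  have fin : ∀ {z : ℂ}, z + e = 0 → z.im = 0 := by
    intro z hz
    have := congrArg Complex.im hz
    simpa [hei] using this
  rcases mul_eq_zero.mp key with h1 | h1
  · exact Or.inl (fin h1)
  · rcases mul_eq_zero.mp h1 with h1 | h1
    · exact Or.inr (Or.inl (fin h1))
    · exact Or.inr (Or.inr (fin h1))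

theorem norm_conj_mul {a b : ℂ} (ha : ‖a‖ = 1) (hb : ‖b‖ = 1) : ‖conj a * b‖ = 1 := by
  simp [ha, hb]

theorem im_conj_mul_eq_zero {a b : ℂ} (ha : a.im = 0) (hb : b.im = 0) : (conj a * b).im = 0 := by
  simp [ha, hb]

/-- Three signs cannot sum to zero, and one non-real term is impossible, so at least two products of
any two rows are non-real. Adding this over the three pairs of rows counts every row twice. -/
theorem three_le_of_three {H : Matrix (Fin 3) (Fin 3) ℂ} (hH : IsComplexHadamard H) :
    3 ≤ ∑ i, nonrealCount (H i) := by
  have key : ∀ a b, a ≠ b → 2 ≤ nonrealCount (H a) + nonrealCount (H b) := by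
    intro a b hab
    have h0 := hH.row_orth hab
    set v := fun k => conj (H a k) * H b k with hv
    have hvn : ∀ k, ‖v k‖ = 1 := fun k => norm_conj_mul (hH.2 _ _) (hH.2 _ _)
    have h1 := nonrealCount_ne_one h0
    have h2 : nonrealCount v ≠ 0 := by
      intro h
      have hr : ∀ k, (v k).im = 0 := by
        intro k
        by_contra hk
        have := Finset.card_eq_zero.mp h
        exact (Finset.eq_empty_iff_forall_notMem.mp this k) (mem_nonrealSet.mpr hk)
      rw [Fin.sum_univ_three] at h0
      rcases real_unit (hvn 0) (hr 0) with e0 | e0 <;> rcases real_unit (hvn 1) (hr 1) with e1 | e1 <;>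
        rcases real_unit (hvn 2) (hr 2) with e2 | e2 <;>
        (simp only [hv] at e0 e1 e2; rw [e0, e1, e2] at h0; norm_num at h0)
    have h3 : nonrealCount v ≤ nonrealCount (H a) + nonrealCount (H b) := by
      unfold nonrealCount
      refine le_trans (Finset.card_le_card fun k hk => ?_) (Finset.card_union_le _ _)
      rw [Finset.mem_union, mem_nonrealSet, mem_nonrealSet]
      rw [mem_nonrealSet] at hk
      by_contra hc
      push Not at hc
      exact hk (im_conj_mul_eq_zero hc.1 hc.2)
    change nonrealCount v ≠ 1 at h1
    omega
  rw [Fin.sum_univ_three]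
  have h01 := key 0 1 (by decide)
  have h02 := key 0 2 (by decide)
  have h12 := key 1 2 (by decide)
  omega

theorem realEntryCounts_three : realEntryCounts 3 = Set.Icc 0 6 := by
  ext m
  constructor
  · rintro ⟨H, hH, rfl⟩
    have h1 := numRealEntries_add_sum_nonrealCount H
    have h2 := three_le_of_three hH
    exact ⟨Nat.zero_le _, by omega⟩
  · intro h
    exact mem_realEntryCounts_three h.2

theorem im_conj_mul_ne_zero_left {a b : ℂ} (hb : ‖b‖ = 1) (ha : a.im ≠ 0) (hb0 : b.im = 0) :
    (conj a * b).im ≠ 0 := by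
  rcases real_unit hb hb0 with rfl | rfl <;> simpa using ha

theorem im_conj_mul_ne_zero_right {a b : ℂ} (ha : ‖a‖ = 1) (ha0 : a.im = 0) (hb : b.im ≠ 0) :
    (conj a * b).im ≠ 0 := by
  rcases real_unit ha ha0 with rfl | rfl <;> simpa using hb

theorem nonrealSet_conj_mul_of_disjoint {n : ℕ} {a b : Fin n → ℂ} (ha : ∀ k, ‖a k‖ = 1)
    (hb : ∀ k, ‖b k‖ = 1) (hd : Disjoint (nonrealSet a) (nonrealSet b)) :
    nonrealSet (fun k => conj (a k) * b k) = nonrealSet a ∪ nonrealSet b := by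
  ext k
  rw [Finset.mem_union, mem_nonrealSet, mem_nonrealSet, mem_nonrealSet]
  have hk : (a k).im ≠ 0 → (b k).im = 0 := fun h => by
    have := Finset.disjoint_left.mp hd (mem_nonrealSet.mpr h)
    rwa [mem_nonrealSet, not_not] at this
  constructor
  · intro h
    by_contra hc
    push Not at hc
    exact h (im_conj_mul_eq_zero hc.1 hc.2)
  · rintro (h | h)
    · exact im_conj_mul_ne_zero_left (hb k) h (hk h)
    · by_cases h2 : (a k).im = 0
      · exact im_conj_mul_ne_zero_right (ha k) h2 h
      · exact absurd (hk h2) h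

theorem nonrealCount_four_ne_three {v : Fin 4 → ℂ} (hv : ∀ k, ‖v k‖ = 1) (h0 : ∑ k, v k = 0) :
    nonrealCount v ≠ 3 := by
  intro h
  have hc : (nonrealSet v)ᶜ.card = 1 := by
    rw [Finset.card_compl, card_nonrealSet, h]; rfl
  obtain ⟨d, hd⟩ := Finset.card_eq_one.mp hc
  obtain ⟨a, b, c, hab, hac, hbc, hs⟩ := Finset.card_eq_three.mp h
  change nonrealSet v = _ at hs
  have hsum := Finset.sum_add_sum_compl (nonrealSet v) v
  rw [h0, hd, hs, Finset.sum_singleton, Finset.sum_insert (by simp [hab, hac]),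
    Finset.sum_pair hbc, ← add_assoc] at hsum
  have hdr : (v d).im = 0 := by
    have : d ∈ (nonrealSet v)ᶜ := by rw [hd]; simp
    simpa [mem_nonrealSet] using this
  have hm : ∀ x, x = a ∨ x = b ∨ x = c → (v x).im ≠ 0 := by
    intro x hx
    rw [← mem_nonrealSet, hs]; simpa using hx
  rcases one_real_of_sum (hv a) (hv b) (hv c) (real_unit (hv d) hdr) hsum with h | h | h
  · exact hm a (by simp) h
  · exact hm b (by simp) h
  · exact hm c (by simp) h

section Four

variable {H : Matrix (Fin 4) (Fin 4) ℂ}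

/-- Without overlap no two non-real entries can cancel in a product, so the non-real products are
exactly the positions of both rows together. -/
theorem IsComplexHadamard.disjoint_four (hH : IsComplexHadamard H) {i j : Fin 4} (hij : i ≠ j)
    (hd : Disjoint (nonrealSet (H i)) (nonrealSet (H j))) :
    nonrealCount (H i) + nonrealCount (H j) ≠ 1 ∧ nonrealCount (H i) + nonrealCount (H j) ≠ 3 := by
  have h1 := nonrealCount_ne_one (hH.row_orth hij)
  have h3 := nonrealCount_four_ne_three (v := fun k => conj (H i k) * H j k)
    (fun k => norm_conj_mul (hH.2 _ _) (hH.2 _ _)) (hH.row_orth hij)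
  rw [← card_nonrealSet, nonrealSet_conj_mul_of_disjoint (hH.2 i) (hH.2 j) hd,
    Finset.card_union_of_disjoint hd, card_nonrealSet, card_nonrealSet] at h1 h3
  exact ⟨h1, h3⟩

theorem nonrealCount_le {n : ℕ} (v : Fin n → ℂ) : nonrealCount v ≤ n := by
  simpa [card_nonrealSet] using Finset.card_le_univ (nonrealSet v)

theorem IsComplexHadamard.even_of_real_row_four (hH : IsComplexHadamard H) {i : Fin 4}
    (hi : nonrealCount (H i) = 0) (j : Fin 4) : Even (nonrealCount (H j)) := by
  by_cases hij : i = j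
  · subst hij; rw [hi]; exact Even.zero
  have hd : Disjoint (nonrealSet (H i)) (nonrealSet (H j)) := by
    rw [show nonrealSet (H i) = ∅ from Finset.card_eq_zero.mp hi]; exact Finset.disjoint_empty_left _
  have h := hH.disjoint_four hij hd
  have hle := nonrealCount_le (H j)
  rw [hi, zero_add] at h
  obtain ⟨h1, h3⟩ := h
  interval_cases nonrealCount (H j) <;> first | exact absurd rfl h1 | exact absurd rfl h3 | decide

theorem IsComplexHadamard.pos_of_odd_four (hH : IsComplexHadamard H)
    (hodd : Odd (∑ i, nonrealCount (H i))) (i : Fin 4) : 0 < nonrealCount (H i) := by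
  by_contra h
  have h0 : nonrealCount (H i) = 0 := by omega
  exact Nat.not_even_iff_odd.mpr hodd
    (Finset.even_sum _ fun j _ => hH.even_of_real_row_four h0 j)

theorem exists_nonrealCount_eq_zero (h : ∑ i, nonrealCount (H i) < 4) :
    ∃ i, nonrealCount (H i) = 0 := by
  by_contra hc
  push Not at hc
  have : ∑ _i : Fin 4, 1 ≤ ∑ i, nonrealCount (H i) :=
    Finset.sum_le_sum fun i _ => Nat.one_le_iff_ne_zero.mpr (hc i)
  simp at this
  omega

/-- By parity no row or column is real, so the row counts are 2, 1, 1, 1. A column that is real in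
the row `a` with two non-real entries has its non-real entry in a row `b` with only that one; `a`
and `b` are then disjoint with three non-real products. -/
theorem IsComplexHadamard.sum_nonrealCount_four_ne_five (hH : IsComplexHadamard H) :
    ∑ i, nonrealCount (H i) ≠ 5 := by
  intro h5
  have hodd : Odd (∑ i, nonrealCount (H i)) := by rw [h5]; decide
  have hodd' : Odd (∑ i, nonrealCount (H.transpose i)) := by
    rw [sum_nonrealCount_transpose]; exact hodd
  have hrow := hH.pos_of_odd_four hodd
  have hcol := hH.transpose.pos_of_odd_four hodd'
  have hex : ∃ a, nonrealCount (H a) = 2 ∧ ∀ b, b ≠ a → nonrealCount (H b) = 1 := by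
    rw [Fin.sum_univ_four] at h5
    have h0 := hrow 0
    have h1 := hrow 1
    have h2 := hrow 2
    have h3 := hrow 3
    have hc : nonrealCount (H 0) = 2 ∨ nonrealCount (H 1) = 2 ∨ nonrealCount (H 2) = 2 ∨
        nonrealCount (H 3) = 2 := by omega
    rcases hc with hc | hc | hc | hc
    · exact ⟨0, hc, fun b hb => match b, hb with
        | 0, hb => absurd rfl hb
        | 1, _ => by omega
        | 2, _ => by omega
        | 3, _ => by omega⟩
    · exact ⟨1, hc, fun b hb => match b, hb with
        | 0, _ => by omega
        | 1, hb => absurd rfl hb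
        | 2, _ => by omega
        | 3, _ => by omega⟩
    · exact ⟨2, hc, fun b hb => match b, hb with
        | 0, _ => by omega
        | 1, _ => by omega
        | 2, hb => absurd rfl hb
        | 3, _ => by omega⟩
    · exact ⟨3, hc, fun b hb => match b, hb with
        | 0, _ => by omega
        | 1, _ => by omega
        | 2, _ => by omega
        | 3, hb => absurd rfl hb⟩
  obtain ⟨a, ha, hb⟩ := hex
  obtain ⟨j, hj⟩ : ∃ j, j ∉ nonrealSet (H a) := by
    by_contra hc
    push Not at hc
    have := Finset.card_eq_iff_eq_univ (nonrealSet (H a)) |>.mpr (Finset.eq_univ_iff_forall.mpr hc)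
    rw [card_nonrealSet, ha] at this
    simp at this
  obtain ⟨b, hbj⟩ := Finset.card_pos.mp (hcol j)
  have hbj' : j ∈ nonrealSet (H b) := mem_nonrealSet_transpose.mp hbj
  have hba : b ≠ a := by rintro rfl; exact hj hbj'
  obtain ⟨k, hk⟩ := Finset.card_eq_one.mp (hb b hba)
  change nonrealSet (H b) = _ at hk
  rw [hk, Finset.mem_singleton] at hbj'
  subst hbj'
  have hd : Disjoint (nonrealSet (H a)) (nonrealSet (H b)) := by
    rw [hk]; exact Finset.disjoint_singleton_right.mpr hj
  have := (hH.disjoint_four hba.symm hd).2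
  rw [ha, hb b hba] at this
  exact this rfl

/-- There are a real row and a real column, so all row and column counts are even. A non-real entry
then has another one in its column, and the rows of both have at least two each, which is four in
total. -/
theorem IsComplexHadamard.sum_nonrealCount_four_ne_two (hH : IsComplexHadamard H) :
    ∑ i, nonrealCount (H i) ≠ 2 := by
  intro h2
  obtain ⟨a, ha⟩ := exists_nonrealCount_eq_zero (H := H) (by omega)
  obtain ⟨c, hc⟩ := exists_nonrealCount_eq_zero (H := H.transpose)
    (by rw [sum_nonrealCount_transpose]; omega)
  have hrow := hH.even_of_real_row_four ha
  have hcol := hH.transpose.even_of_real_row_four hc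
  obtain ⟨i, -, hi⟩ := Finset.exists_ne_zero_of_sum_ne_zero (by rw [h2]; decide)
  obtain ⟨j, hj⟩ := Finset.card_pos.mp (Nat.pos_of_ne_zero hi)
  have hj' : i ∈ nonrealSet (H.transpose j) := mem_nonrealSet_transpose.mpr hj
  have hpos : 0 < nonrealCount (H.transpose j) := Finset.card_pos.mpr ⟨i, hj'⟩
  have hone : 1 < (nonrealSet (H.transpose j)).card := by
    rw [card_nonrealSet]
    obtain ⟨t, ht⟩ := hcol j
    omega
  obtain ⟨i', hi', hne⟩ := Finset.exists_mem_ne hone i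
  have hpos' : 0 < nonrealCount (H i') := Finset.card_pos.mpr
    ⟨j, mem_nonrealSet_transpose.mp hi'⟩
  have hle : nonrealCount (H i') + nonrealCount (H i) ≤ ∑ i, nonrealCount (H i) := by
    rw [← Finset.sum_pair hne (f := fun i => nonrealCount (H i))]
    exact Finset.sum_le_sum_of_subset (Finset.subset_univ _)
  obtain ⟨t, ht⟩ := hrow i
  obtain ⟨t', ht'⟩ := hrow i'
  omega

end Four

theorem realEntryCounts_four : realEntryCounts 4 = Set.Icc 0 10 ∪ {12, 16} := by
  ext m
  constructor
  · rintro ⟨H, hH, rfl⟩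
    have h1 := numRealEntries_add_sum_nonrealCount H
    have h5 := hH.sum_nonrealCount_four_ne_five
    have h2 := hH.sum_nonrealCount_four_ne_two
    have h13 : ∑ i, nonrealCount (H i) ≠ 1 ∧ ∑ i, nonrealCount (H i) ≠ 3 := by
      constructor <;> intro h <;>
      · obtain ⟨i, hi⟩ := exists_nonrealCount_eq_zero (H := H) (by omega)
        have := hH.pos_of_odd_four (by rw [h]; decide) i
        omega
    simp only [Set.mem_union, Set.mem_Icc, Set.mem_insert_iff, Set.mem_singleton_iff]
    omega
  · intro h
    simp only [Set.mem_union, Set.mem_Icc, Set.mem_insert_iff, Set.mem_singleton_iff] at h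
    exact mem_realEntryCounts_four (by omega)


/-! ### Vanishing sums of unimodular numbers -/

theorem exists_int_sum_of_real {ι : Type*} (s : Finset ι) {v : ι → ℂ} (hv : ∀ k, ‖v k‖ = 1)
    (hr : ∀ k ∈ s, (v k).im = 0) :
    ∃ m : ℤ, ∑ k ∈ s, v k = m ∧ (2 : ℤ) ∣ m - s.card ∧ |m| ≤ s.card := by
  classical
  induction s using Finset.induction_on with
  | empty => exact ⟨0, by simp⟩
  | insert a s ha ih =>
    obtain ⟨m, h1, h2, h3⟩ := ih fun k hk => hr k (Finset.mem_insert_of_mem hk)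
    rw [Finset.sum_insert ha, Finset.card_insert_of_notMem ha, h1]
    rw [abs_le] at h3
    rcases real_unit (hv a) (hr a (Finset.mem_insert_self a s)) with h | h
    · refine ⟨m + 1, by rw [h]; push_cast; ring, by push_cast; omega, ?_⟩
      rw [abs_le]; push_cast; omega
    · refine ⟨m - 1, by rw [h]; push_cast; ring, by push_cast; omega, ?_⟩
      rw [abs_le]; push_cast; omega

theorem sum_nonrealSet_add {n : ℕ} {v : Fin n → ℂ} (hv : ∀ k, ‖v k‖ = 1) (h0 : ∑ k, v k = 0) :
    ∃ m : ℤ, ∑ k ∈ nonrealSet v, v k + m = 0 ∧ (2 : ℤ) ∣ m - (n - nonrealCount v : ℤ) ∧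
      |m| ≤ (n : ℤ) - nonrealCount v := by
  classical
  obtain ⟨m, h1, h2, h3⟩ := exists_int_sum_of_real (nonrealSet v)ᶜ hv fun k hk => by
    rw [Finset.mem_compl, mem_nonrealSet, not_not] at hk; exact hk
  have hc : (((nonrealSet v)ᶜ.card : ℕ) : ℤ) = n - nonrealCount v := by
    have := Finset.card_add_card_compl (nonrealSet v)
    rw [Fintype.card_fin, card_nonrealSet] at this
    omega
  rw [hc] at h2 h3
  refine ⟨m, ?_, h2, h3⟩
  rw [← h1, Finset.sum_add_sum_compl, h0]

theorem abs_re_lt_one {z : ℂ} (hz : ‖z‖ = 1) (h : z.im ≠ 0) : -1 < z.re ∧ z.re < 1 := by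
  have h1 := unit_re_im hz
  have h2 : 0 < z.im * z.im := mul_self_pos.mpr h
  constructor <;> nlinarith

/-- The three real terms sum to `±1` or `±3`. The first case is `one_real_of_sum`; in the second the
non-real terms would need real parts of modulus 1. -/
theorem nonrealCount_six_ne_three {v : Fin 6 → ℂ} (hv : ∀ k, ‖v k‖ = 1) (h0 : ∑ k, v k = 0) :
    nonrealCount v ≠ 3 := by
  intro h
  obtain ⟨m, h1, h2, h3⟩ := sum_nonrealSet_add hv h0
  obtain ⟨p, q, r, hpq, hpr, hqr, hs⟩ := Finset.card_eq_three.mp h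
  have hp : (v p).im ≠ 0 := mem_nonrealSet.mp (by simp [hs])
  have hq : (v q).im ≠ 0 := mem_nonrealSet.mp (by simp [hs])
  have hr : (v r).im ≠ 0 := mem_nonrealSet.mp (by simp [hs])
  rw [h] at h2 h3
  rw [hs, Finset.sum_insert (by simp [hpq, hpr]), Finset.sum_insert (by simp [hqr]),
    Finset.sum_singleton, ← add_assoc] at h1
  have hm : (m = 1 ∨ m = -1) ∨ (m = 3 ∨ m = -3) := by
    rw [abs_le] at h3; push_cast at h2 h3; omega
  rcases hm with hm | hm
  · have := one_real_of_sum (hv p) (hv q) (hv r) (e := (m : ℂ))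
      (by rcases hm with rfl | rfl <;> simp) h1
    tauto
  · have hre := congrArg Complex.re h1
    have hp' := abs_re_lt_one (hv p) hp
    have hq' := abs_re_lt_one (hv q) hq
    have hr' := abs_re_lt_one (hv r) hr
    rcases hm with rfl | rfl <;> norm_num at hre <;> linarith

theorem eq_neg_of_nonrealSet {n : ℕ} (hn : Even n) {v : Fin n → ℂ} (hv : ∀ k, ‖v k‖ = 1)
    (h0 : ∑ k, v k = 0) {p q : Fin n} (hpq : p ≠ q) (hs : nonrealSet v = {p, q}) : v p = -v q := by
  obtain ⟨m, h1, h2, -⟩ := sum_nonrealSet_add hv h0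
  have hc : nonrealCount v = 2 := by rw [nonrealCount, hs, Finset.card_pair hpq]
  have hp : (v p).im ≠ 0 := mem_nonrealSet.mp (by simp [hs])
  rw [hc] at h2
  rw [hs, Finset.sum_pair hpq] at h1
  have him := congrArg Complex.im h1
  have hre := congrArg Complex.re h1
  simp at him hre
  have hp1 := unit_re_im (hv p)
  have hq1 := unit_re_im (hv q)
  have hp' := abs_re_lt_one (hv p) hp
  have hsq : (v p).re * (v p).re = (v q).re * (v q).re := by
    have : (v p).im = -(v q).im := by linarith
    rw [this] at hp1; linarith
  have hre' : (v p).re = -(v q).re := by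
    -- If the real parts agree, they are `-m / 2` with modulus below 1, and the even integer `m`
    -- must be 0.
    rcases mul_self_eq_mul_self_iff.mp hsq with h | h
    · have hm : m = 0 := by
        have h3 : (m : ℝ) < 2 := by linarith
        have h4 : (-2 : ℝ) < m := by linarith
        have h5 : m < 2 := by exact_mod_cast h3
        have h6 : -2 < m := by exact_mod_cast h4
        obtain ⟨k, hk⟩ := hn
        omega
      rw [hm] at hre; simp at hre; linarith
    · exact h
  apply Complex.ext <;> simp <;> linarith

theorem eq_neg_or_real {n : ℕ} (hn : Even n) {v : Fin n → ℂ} (hv : ∀ k, ‖v k‖ = 1)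
    (h0 : ∑ k, v k = 0) {p q : Fin n} (hpq : p ≠ q) (hs : ∀ k, k ≠ p → k ≠ q → (v k).im = 0) :
    v p = -v q ∨ ∀ k, (v k).im = 0 := by
  classical
  have hsub : nonrealSet v ⊆ {p, q} := by
    intro k hk
    by_contra h
    simp only [Finset.mem_insert, Finset.mem_singleton, not_or] at h
    exact mem_nonrealSet.mp hk (hs k h.1 h.2)
  rcases Nat.eq_zero_or_pos (nonrealCount v) with h | h
  · right
    intro k
    by_contra hk
    exact (Finset.eq_empty_iff_forall_notMem.mp (Finset.card_eq_zero.mp h) k) (mem_nonrealSet.mpr hk)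
  · left
    have h2 := nonrealCount_ne_one h0
    have h3 := Finset.card_le_card hsub
    rw [Finset.card_pair hpq, card_nonrealSet] at h3
    exact eq_neg_of_nonrealSet hn hv h0 hpq
      (Finset.eq_of_subset_of_card_le hsub (by rw [Finset.card_pair hpq, card_nonrealSet]; omega))

theorem exists_sign_split {ι : Type*} [DecidableEq ι] (s : Finset ι) {v : ι → ℂ} {m : ℕ}
    (hv : ∀ k, ‖v k‖ = 1) (hr : ∀ k ∈ s, (v k).im = 0) (h0 : ∑ k ∈ s, v k = 0) (hs : s.card = 2 * m) :
    ∃ t ⊆ s, t.card = m ∧ (s \ t).card = m ∧ (∀ k ∈ t, v k = 1) ∧ ∀ k ∈ s \ t, v k = -1 := by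
  classical
  have hs1 : ∀ k ∈ s \ s.filter (fun k => v k = 1), v k = -1 := by
    intro k hk
    simp only [Finset.mem_sdiff, Finset.mem_filter, not_and] at hk
    exact (real_unit (hv k) (hr k hk.1)).resolve_left (hk.2 hk.1)
  have hs2 : ∀ k ∈ s.filter (fun k => v k = 1), v k = 1 := fun k hk => (Finset.mem_filter.mp hk).2
  have hsub : s.filter (fun k => v k = 1) ⊆ s := Finset.filter_subset _ _
  have hc := Finset.card_sdiff_add_card_eq_card hsub
  rw [← Finset.sum_sdiff hsub, Finset.sum_congr rfl hs1, Finset.sum_congr rfl hs2] at h0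
  simp only [Finset.sum_const, nsmul_eq_mul, mul_one, mul_neg] at h0
  have h1 : (s.filter (fun k => v k = 1)).card = (s \ s.filter (fun k => v k = 1)).card := by
    have : ((s.filter (fun k => v k = 1)).card : ℂ) = (s \ s.filter (fun k => v k = 1)).card := by
      linear_combination h0
    exact_mod_cast this
  exact ⟨_, hsub, by omega, by omega, hs2, hs1⟩

/-- Parallelogram law twice: with `P = w₃ + w₄` and `Q = w₅ + w₆`, the hypotheses give `|w₁ + w₂| =
|P + Q|` and `|w₁ - w₂| = |P - Q|`, so `|P|² + |Q|² = 2`. -/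
theorem split_re {w₁ w₂ w₃ w₄ w₅ w₆ z : ℂ} (h₁ : ‖w₁‖ = 1) (h₂ : ‖w₂‖ = 1) (h₃ : ‖w₃‖ = 1)
    (h₄ : ‖w₄‖ = 1) (h₅ : ‖w₅‖ = 1) (h₆ : ‖w₆‖ = 1) (hz : ‖z‖ = 1)
    (hs : w₁ + w₂ + (w₃ + w₄) + (w₅ + w₆) = 0)
    (ht : conj z * (w₁ - w₂) + (w₃ + w₄) - (w₅ + w₆) = 0) :
    (conj w₃ * w₄).re + (conj w₅ * w₆).re = -1 := by
  have hz' := unit_mul_conj_self hz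
  have e1 : w₁ + w₂ = -(w₃ + w₄ + (w₅ + w₆)) := by linear_combination hs
  have e2 : w₁ - w₂ = -(z * (w₃ + w₄ - (w₅ + w₆))) := by
    linear_combination z * ht - (w₁ - w₂) * hz'
  have n1 := congrArg Complex.normSq e1
  have n2 := congrArg Complex.normSq e2
  rw [Complex.normSq_neg] at n1 n2
  rw [Complex.normSq_mul, Complex.normSq_eq_norm_sq z, hz] at n2
  have u1 := unit_re_im h₁
  have u2 := unit_re_im h₂
  have u3 := unit_re_im h₃
  have u4 := unit_re_im h₄
  have u5 := unit_re_im h₅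
  have u6 := unit_re_im h₆
  simp only [Complex.normSq_apply, Complex.add_re, Complex.add_im, Complex.sub_re, Complex.sub_im]
    at n1 n2
  simp only [Complex.mul_re, Complex.conj_re, Complex.conj_im]
  linear_combination -(1 / 4) * n1 - (1 / 4) * n2 + (1 / 2) * u1 + (1 / 2) * u2 - (1 / 2) * u3
    - (1 / 2) * u4 - (1 / 2) * u5 - (1 / 2) * u6

/-- A real ratio of `w₃, w₄` must be `-1`, as `1` would leave `-2` for the other real part. So `P =
0` and `|Q|² = 2`. Since `(w₁ + w₂) * conj (w₁ - w₂)` is imaginary for equal moduli and equals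
`-conj z * |Q|²`, also `z` is imaginary. -/
theorem split_of_real {w₁ w₂ w₃ w₄ w₅ w₆ z : ℂ} (h₁ : ‖w₁‖ = 1) (h₂ : ‖w₂‖ = 1) (h₃ : ‖w₃‖ = 1)
    (h₄ : ‖w₄‖ = 1) (h₅ : ‖w₅‖ = 1) (h₆ : ‖w₆‖ = 1) (hz : ‖z‖ = 1)
    (hs : w₁ + w₂ + (w₃ + w₄) + (w₅ + w₆) = 0)
    (ht : conj z * (w₁ - w₂) + (w₃ + w₄) - (w₅ + w₆) = 0) (hr : (conj w₃ * w₄).im = 0) :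
    (conj w₅ * w₆).re = 0 ∧ z.re = 0 := by
  have hsum := split_re h₁ h₂ h₃ h₄ h₅ h₆ hz hs ht
  have hz' := unit_mul_conj_self hz
  have hm : conj w₃ * w₄ = -1 := by
    refine (real_unit (norm_conj_mul h₃ h₄) hr).resolve_left fun h => ?_
    rw [h] at hsum
    have h5 := unit_re_im (norm_conj_mul h₅ h₆)
    simp only [Complex.one_re] at hsum
    nlinarith [mul_self_nonneg (conj w₅ * w₆).im]
  have h56 : (conj w₅ * w₆).re = 0 := by
    rw [hm] at hsum; simp only [Complex.neg_re, Complex.one_re] at hsum; linarith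
  refine ⟨h56, ?_⟩
  have hP : w₃ + w₄ = 0 := by linear_combination w₃ * hm - w₄ * unit_mul_conj_self h₃
  have e1 : w₁ + w₂ = -(w₅ + w₆) := by linear_combination hs - hP
  have e2 : w₁ - w₂ = z * (w₅ + w₆) := by
    linear_combination z * ht - (w₁ - w₂) * hz' - z * hP
  have key : (conj z * ((w₅ + w₆) * conj (w₅ + w₆))).re = 0 := by
    have : conj z * ((w₅ + w₆) * conj (w₅ + w₆)) = -((w₁ + w₂) * conj (w₁ - w₂)) := by
      rw [e1, e2, map_mul]; ring
    rw [this]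
    have u1 := unit_re_im h₁
    have u2 := unit_re_im h₂
    simp only [Complex.neg_re, Complex.mul_re, Complex.conj_re, Complex.conj_im, Complex.add_re,
      Complex.add_im, Complex.sub_re, Complex.sub_im]
    linear_combination -u1 + u2
  rw [Complex.mul_conj, Complex.re_mul_ofReal] at key
  have u5 := unit_re_im h₅
  have u6 := unit_re_im h₆
  have hN : Complex.normSq (w₅ + w₆) = 2 := by
    simp only [Complex.mul_re, Complex.conj_re, Complex.conj_im] at h56
    simp only [Complex.normSq_apply, Complex.add_re, Complex.add_im]
    linear_combination u5 + u6 + 2 * h56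
  rw [hN] at key
  simpa using key

/-- Such numbers form an equilateral triangle, and the ratio of two of them has real part `-1/2`. -/
theorem im_ne_zero_of_add_add {a b c : ℂ} (ha : ‖a‖ = 1) (hb : ‖b‖ = 1) (hc : ‖c‖ = 1)
    (h : a + b + c = 0) : (conj a * b).im ≠ 0 := by
  have e : a + b = -c := by linear_combination h
  have n := congrArg Complex.normSq e
  rw [Complex.normSq_neg, Complex.normSq_eq_norm_sq c, hc] at n
  have u1 := unit_re_im ha
  have u2 := unit_re_im hb
  intro h0
  have hab : (conj a * b).re = -(1 / 2) := by
    simp only [Complex.normSq_apply, Complex.add_re, Complex.add_im] at n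
    simp only [Complex.mul_re, Complex.conj_re, Complex.conj_im]
    linear_combination (1 / 2) * n - (1 / 2) * u1 - (1 / 2) * u2
  rcases real_unit (norm_conj_mul ha hb) h0 with h | h <;> rw [h] at hab <;> norm_num at hab


/-! ### Order six: what two rows impose on a third -/

/-- The entrywise product of the conjugate of a vector with another vector. -/
noncomputable def conjMul {n : ℕ} (a b : Fin n → ℂ) : Fin n → ℂ := fun k => conj (a k) * b k

theorem norm_conjMul {n : ℕ} {a b : Fin n → ℂ} (ha : ∀ k, ‖a k‖ = 1) (hb : ∀ k, ‖b k‖ = 1) (k : Fin n) :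
    ‖conjMul a b k‖ = 1 := norm_conj_mul (ha k) (hb k)

theorem sum_conj_conjMul {n : ℕ} {a b c : Fin n → ℂ} (ha : ∀ k, ‖a k‖ = 1) :
    ∑ k, conj (conjMul a b k) * conjMul a c k = ∑ k, conjMul b c k := by
  refine Finset.sum_congr rfl fun k _ => ?_
  simp only [conjMul, map_mul, Complex.conj_conj]
  linear_combination (conj (b k) * c k) * unit_mul_conj_self (ha k)

theorem IsComplexHadamard.sum_conjMul {n : ℕ} {H : Matrix (Fin n) (Fin n) ℂ} (hH : IsComplexHadamard H)
    {a b : Fin n} (hab : a ≠ b) : ∑ k, conjMul (H a) (H b) k = 0 := hH.row_orth hab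

theorem IsComplexHadamard.norm_conjMul {n : ℕ} {H : Matrix (Fin n) (Fin n) ℂ} (hH : IsComplexHadamard H)
    (a b : Fin n) (k : Fin n) : ‖conjMul (H a) (H b) k‖ = 1 := norm_conj_mul (hH.2 a k) (hH.2 b k)

/-- Within the pair `t` some ratio of entries of `w` is real. -/
def RealRatio {n : ℕ} (w : Fin n → ℂ) (t : Finset (Fin n)) : Prop :=
  ∃ i ∈ t, ∃ j ∈ t, i ≠ j ∧ (conj (w i) * w j).im = 0

theorem split_of_sums {v w : Fin 6 → ℂ} {t u s : Finset (Fin 6)} {p q : Fin 6} (hpq : p ≠ q)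
    (hs : s = {p, q}) (ht : t.card = 2) (hu : u.card = 2) (htu : Disjoint t u) (hsu : sᶜ = t ∪ u)
    (hw : ∀ k, ‖w k‖ = 1) (hvp : ‖v p‖ = 1) (hvq : v q = -v p) {e : ℂ} (he : e = 1 ∨ e = -1)
    (hvt : ∀ k ∈ t, v k = e) (hvu : ∀ k ∈ u, v k = -e)
    (h0 : ∑ k, w k = 0) (h1 : ∑ k, conj (v k) * w k = 0) (hr : RealRatio w t) :
    (∀ i ∈ u, ∀ j ∈ u, i ≠ j → (conj (w i) * w j).re = 0) ∧ (v p).re = 0 := by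
  classical
  obtain ⟨i, hi, j, hj, hij, hr⟩ := hr
  have hti : t = {i, j} := (Finset.eq_of_subset_of_card_le
    (by intro x hx; rw [Finset.mem_insert, Finset.mem_singleton] at hx; rcases hx with rfl | rfl <;> assumption)
    (by rw [ht, Finset.card_pair hij])).symm
  have hcj : conj e = e := by rcases he with rfl | rfl <;> simp
  have hee : e * e = 1 := by rcases he with rfl | rfl <;> simp
  obtain ⟨k, l, hkl, hul⟩ := Finset.card_eq_two.mp hu
  have dec : ∀ f : Fin 6 → ℂ, ∑ k, f k = f p + f q + (f i + f j) + (f k + f l) := by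
    intro f
    rw [← Finset.sum_add_sum_compl s, hsu, Finset.sum_union htu, hs, hti, hul, Finset.sum_pair hpq,
      Finset.sum_pair hij, Finset.sum_pair hkl]
    ring
  rw [dec] at h0 h1
  have vi := hvt i hi
  have vj := hvt j hj
  have vk := hvu k (by simp [hul])
  have vl := hvu l (by simp [hul])
  rw [vi, vj, vk, vl, hvq] at h1
  simp only [map_neg, hcj] at h1
  -- The sign `e` is absorbed into `z = v p * e`, so that both assignments of the two halves are
  -- covered at once.
  have h2 : conj (v p * e) * (w p - w q) + (w i + w j) - (w k + w l) = 0 := by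
    rw [map_mul, hcj]
    linear_combination e * h1 - (w i + w j - w k - w l) * hee
  have hve : ‖v p * e‖ = 1 := by rcases he with rfl | rfl <;> simpa using hvp
  obtain ⟨h3, h4⟩ := split_of_real (hw p) (hw q) (hw i) (hw j) (hw k) (hw l) hve h0 h2 hr
  constructor
  · intro x hx y hy hxy
    have h3' : (conj (w l) * w k).re = 0 := by
      simp only [Complex.mul_re, Complex.conj_re, Complex.conj_im] at h3 ⊢
      linarith
    rw [hul, Finset.mem_insert, Finset.mem_singleton] at hx hy
    rcases hx with rfl | rfl <;> rcases hy with rfl | rfl <;> first | exact absurd rfl hxy | assumption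
  · rcases he with rfl | rfl <;> simpa using h4

/-- The two non-real products are opposite, so the other four consist of two ones and two minus
ones. A third row, divided by row `a`, is orthogonal both to the constant vector and to the product
vector, which is the situation of `split_of_real`. -/
theorem IsComplexHadamard.exists_split {H : Matrix (Fin 6) (Fin 6) ℂ} (hH : IsComplexHadamard H)
    {a b : Fin 6} (hab : a ≠ b) (h2 : nonrealCount (conjMul (H a) (H b)) = 2) :
    ∃ t u : Finset (Fin 6), t.card = 2 ∧ u.card = 2 ∧ Disjoint t u ∧
      (nonrealSet (conjMul (H a) (H b)))ᶜ = t ∪ u ∧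
      (∀ k ∈ t, conjMul (H a) (H b) k = 1) ∧ (∀ k ∈ u, conjMul (H a) (H b) k = -1) ∧
      ∀ c, c ≠ a → c ≠ b →
        (RealRatio (conjMul (H a) (H c)) t → (∀ i ∈ u, ∀ j ∈ u, i ≠ j →
          (conj (conjMul (H a) (H c) i) * conjMul (H a) (H c) j).re = 0) ∧
          ∀ p ∈ nonrealSet (conjMul (H a) (H b)), (conjMul (H a) (H b) p).re = 0) ∧
        (RealRatio (conjMul (H a) (H c)) u → (∀ i ∈ t, ∀ j ∈ t, i ≠ j →
          (conj (conjMul (H a) (H c) i) * conjMul (H a) (H c) j).re = 0) ∧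
          ∀ p ∈ nonrealSet (conjMul (H a) (H b)), (conjMul (H a) (H b) p).re = 0) := by
  classical
  obtain ⟨p, q, hpq, hs⟩ := Finset.card_eq_two.mp h2
  set v := conjMul (H a) (H b) with hv
  have hvn : ∀ k, ‖v k‖ = 1 := hH.norm_conjMul a b
  have h0 : ∑ k, v k = 0 := hH.sum_conjMul hab
  have hvpq := eq_neg_of_nonrealSet (by decide) hvn h0 hpq hs
  have hc0 : ∑ k ∈ (nonrealSet v)ᶜ, v k = 0 := by
    have := Finset.sum_add_sum_compl (nonrealSet v) v
    rw [h0, hs, Finset.sum_pair hpq, hvpq, neg_add_cancel, zero_add, ← hs] at this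
    exact this
  obtain ⟨t, hsub, ht, hu, hvt, hvu⟩ := exists_sign_split (m := 2) _ hvn
    (fun k hk => by rw [Finset.mem_compl, mem_nonrealSet, not_not] at hk; exact hk) hc0
    (by rw [Finset.card_compl, card_nonrealSet, h2]; rfl)
  refine ⟨t, (nonrealSet v)ᶜ \ t, ht, hu, Finset.disjoint_sdiff,
    (Finset.union_sdiff_of_subset hsub).symm, hvt, hvu, fun c hca hcb => ?_⟩
  have hw0 : ∑ k, conjMul (H a) (H c) k = 0 := hH.sum_conjMul hca.symm
  have hw1 : ∑ k, conj (v k) * conjMul (H a) (H c) k = 0 := by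
    rw [hv, sum_conj_conjMul (hH.2 a), hH.sum_conjMul hcb.symm]
  have all : (v p).re = 0 → ∀ k ∈ nonrealSet v, (v k).re = 0 := by
    intro h k hk
    rw [hs, Finset.mem_insert, Finset.mem_singleton] at hk
    rw [hvpq] at h
    rcases hk with rfl | rfl
    · rw [hvpq, h]
    · simpa using h
  have hvq : v q = -v p := by rw [hvpq, neg_neg]
  constructor <;> intro hr
  · have := split_of_sums hpq hs ht hu Finset.disjoint_sdiff (Finset.union_sdiff_of_subset hsub).symm
      (hH.norm_conjMul a c) (hvn p) hvq (Or.inl rfl) hvt hvu hw0 hw1 hr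
    exact ⟨this.1, all this.2⟩
  · have := split_of_sums hpq hs hu ht Finset.disjoint_sdiff.symm
      (by rw [Finset.union_comm]; exact (Finset.union_sdiff_of_subset hsub).symm)
      (hH.norm_conjMul a c) (hvn p) hvq (Or.inr rfl) hvu (by simpa using hvt) hw0 hw1 hr
    exact ⟨this.1, all this.2⟩

/-- Adding and subtracting the two orthogonality relations shows that the third row, divided by row
`a`, sums to zero over each half; three unimodular numbers with zero sum have no real ratio. -/
theorem IsComplexHadamard.exists_halves {H : Matrix (Fin 6) (Fin 6) ℂ} (hH : IsComplexHadamard H)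
    {a b : Fin 6} (hab : a ≠ b) (h2 : ∀ k, (conjMul (H a) (H b) k).im = 0) :
    ∃ t : Finset (Fin 6), t.card = 3 ∧ tᶜ.card = 3 ∧ ∀ c, c ≠ a → c ≠ b →
      ¬ RealRatio (conjMul (H a) (H c)) t ∧ ¬ RealRatio (conjMul (H a) (H c)) tᶜ := by
  classical
  obtain ⟨t, -, ht, hu, hvt, hvu⟩ := exists_sign_split (m := 3) Finset.univ (hH.norm_conjMul a b)
    (fun k _ => h2 k) (hH.sum_conjMul hab) (by simp)
  rw [← Finset.compl_eq_univ_sdiff] at hu hvu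
  refine ⟨t, ht, hu, fun c hca hcb => ?_⟩
  have hw0 : ∑ k, conjMul (H a) (H c) k = 0 := hH.sum_conjMul hca.symm
  have hw1 : ∑ k, conj (conjMul (H a) (H b) k) * conjMul (H a) (H c) k = 0 := by
    rw [sum_conj_conjMul (hH.2 a), hH.sum_conjMul hcb.symm]
  have e1 : ∑ k ∈ t, conj (conjMul (H a) (H b) k) * conjMul (H a) (H c) k
      = ∑ k ∈ t, conjMul (H a) (H c) k :=
    Finset.sum_congr rfl fun k hk => by rw [hvt k hk]; simp
  have e2 : ∑ k ∈ tᶜ, conj (conjMul (H a) (H b) k) * conjMul (H a) (H c) k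
      = -∑ k ∈ tᶜ, conjMul (H a) (H c) k := by
    rw [← Finset.sum_neg_distrib]
    exact Finset.sum_congr rfl fun k hk => by rw [hvu k hk]; simp
  rw [← Finset.sum_add_sum_compl t] at hw0 hw1
  rw [e1, e2] at hw1
  have f1 : ∑ k ∈ t, conjMul (H a) (H c) k = 0 := by linear_combination (1 / 2) * hw0 + (1 / 2) * hw1
  have f2 : ∑ k ∈ tᶜ, conjMul (H a) (H c) k = 0 := by linear_combination (1 / 2) * hw0 - (1 / 2) * hw1
  have key : ∀ s : Finset (Fin 6), s.card = 3 → ∑ k ∈ s, conjMul (H a) (H c) k = 0 →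
      ¬ RealRatio (conjMul (H a) (H c)) s := by
    rintro s hs f ⟨i, hi, j, hj, hij, hr⟩
    obtain ⟨k, hk⟩ : ∃ k, (s.erase i).erase j = {k} := by
      rw [← Finset.card_eq_one, Finset.card_erase_of_mem (Finset.mem_erase.mpr ⟨hij.symm, hj⟩),
        Finset.card_erase_of_mem hi, hs]
    rw [← Finset.add_sum_erase s _ hi, ← Finset.add_sum_erase _ _ (Finset.mem_erase.mpr ⟨hij.symm, hj⟩),
      hk, Finset.sum_singleton, ← add_assoc] at f
    exact im_ne_zero_of_add_add (hH.norm_conjMul a c i) (hH.norm_conjMul a c j) (hH.norm_conjMul a c k) f hr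
  exact ⟨key t ht f1, key _ hu f2⟩


/-! ### Impossible configurations in order six -/

theorem im_eq_zero_of_sign {z : ℂ} (h : z = 1 ∨ z = -1) : z.im = 0 := by
  rcases h with rfl | rfl <;> simp

theorem eq_or_neg_of_im_conj_mul {a b : ℂ} (ha : ‖a‖ = 1) (hb : ‖b‖ = 1) (h : (conj a * b).im = 0) :
    b = a ∨ b = -a := by
  have ha' := unit_mul_conj_self ha
  rcases real_unit (norm_conj_mul ha hb) h with h | h
  · left; linear_combination a * h - b * ha'
  · right; linear_combination a * h - b * ha'

theorem eq_or_neg_of_im_mul {a b : ℂ} (ha : ‖a‖ = 1) (hb : ‖b‖ = 1) (h : (a * b).im = 0) :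
    b = conj a ∨ b = -conj a :=
  eq_or_neg_of_im_conj_mul (by simpa using ha) hb (by simpa using h)

theorem nonrealSet_eq_pair {v : Fin 6 → ℂ} (hv : ∀ k, ‖v k‖ = 1) (h0 : ∑ k, v k = 0)
    (h3 : nonrealCount v ≤ 3) {p q : Fin 6} (hpq : p ≠ q) (hp : (v p).im ≠ 0) (hq : (v q).im ≠ 0) :
    nonrealSet v = {p, q} := by
  have h := nonrealCount_six_ne_three hv h0
  refine (Finset.eq_of_subset_of_card_le ?_ ?_).symm
  · intro k hk
    rw [Finset.mem_insert, Finset.mem_singleton] at hk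
    rcases hk with rfl | rfl <;> exact mem_nonrealSet.mpr ‹_›
  · rw [Finset.card_pair hpq, card_nonrealSet]; omega

namespace IsComplexHadamard

variable {H : Matrix (Fin 6) (Fin 6) ℂ}

/-- Since three non-real products cannot occur, `p` and `q` are the only ones and their products are
opposite. The real factors being signs, this says that `H b q` is `±conj (H a p)`. -/
theorem im_mul_eq_zero (hH : IsComplexHadamard H) {a b p q : Fin 6} (hab : a ≠ b) (hpq : p ≠ q)
    (h3 : nonrealCount (conjMul (H a) (H b)) ≤ 3) (hap : (H a p).im ≠ 0) (hbp : (H b p).im = 0)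
    (haq : (H a q).im = 0) (hbq : (H b q).im ≠ 0) : (H a p * H b q).im = 0 := by
  have hp : (conjMul (H a) (H b) p).im ≠ 0 := im_conj_mul_ne_zero_left (hH.2 b p) hap hbp
  have hq : (conjMul (H a) (H b) q).im ≠ 0 := im_conj_mul_ne_zero_right (hH.2 a q) haq hbq
  have h := eq_neg_of_nonrealSet (by decide) (hH.norm_conjMul a b) (hH.sum_conjMul hab) hpq
    (nonrealSet_eq_pair (hH.norm_conjMul a b) (hH.sum_conjMul hab) h3 hpq hp hq)
  simp only [conjMul] at h
  have ua := unit_mul_conj_self (hH.2 a p)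
  apply im_eq_zero_of_sign
  rcases real_unit (hH.2 b p) hbp with hb | hb <;> rcases real_unit (hH.2 a q) haq with ha | ha <;>
    rw [hb, ha] at h <;> simp only [map_one, map_neg] at h
  · right; linear_combination (H a p) * h - ua
  · left; linear_combination -(H a p) * h + ua
  · left; linear_combination (H a p) * h + ua
  · right; linear_combination -(H a p) * h - ua

theorem im_conjMul_eq_zero (hH : IsComplexHadamard H) {a b p q m : Fin 6} (hab : a ≠ b) (hpq : p ≠ q)
    (h3 : nonrealCount (conjMul (H a) (H b)) ≤ 3) (hp : (conjMul (H a) (H b) p).im ≠ 0)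
    (hq : (conjMul (H a) (H b) q).im ≠ 0) (hmp : m ≠ p) (hmq : m ≠ q) :
    (conjMul (H a) (H b) m).im = 0 := by
  by_contra hm
  have := nonrealSet_eq_pair (hH.norm_conjMul a b) (hH.sum_conjMul hab) h3 hpq hp hq
  have h : m ∈ nonrealSet (conjMul (H a) (H b)) := mem_nonrealSet.mpr hm
  rw [this] at h
  simp [hmp, hmq] at h

/-- Going round the triangle, each entry is up to sign the conjugate of the previous one; an odd
cycle makes the square of `H a p` real. -/
theorem false_of_triangle (hH : IsComplexHadamard H) {a b c p q s : Fin 6} (him : (H a p).im ≠ 0)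
    (hre : (H a p).re ≠ 0) (h1 : (H a p * H b q).im = 0) (h2 : (H b q * H c s).im = 0)
    (h3 : (H c s * H a p).im = 0) : False := by
  have e1 := eq_or_neg_of_im_mul (hH.2 a p) (hH.2 b q) h1
  have e2 := eq_or_neg_of_im_mul (hH.2 b q) (hH.2 c s) h2
  have h : (H a p * H a p).im = 0 := by
    rcases e1 with e1 | e1 <;> rcases e2 with e2 | e2 <;> rw [e2, e1] at h3 <;> simp at h3 ⊢ <;>
      linarith
  rw [Complex.mul_im] at h
  have : (H a p).re * (H a p).im = 0 := by linarith
  rcases mul_eq_zero.mp this with h | h <;> contradiction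

/-- The row relation makes the cross ratio of the rectangle real. Read in the columns `p, q`, it
says that the products in rows `a` and `b` agree up to sign, hence are both real or both not; with
row `i` this makes one or three non-real terms. -/
theorem false_of_rectangle (hH : IsComplexHadamard H) {a b p q i : Fin 6} (hab : a ≠ b) (hpq : p ≠ q)
    (hr : ∀ k, k ≠ p → k ≠ q → (conjMul (H a) (H b) k).im = 0) (hia : i ≠ a) (hib : i ≠ b)
    (hi : (conjMul (H.transpose p) (H.transpose q) i).im ≠ 0)
    (hc : ∀ k, k ≠ i → k ≠ a → k ≠ b → (conjMul (H.transpose p) (H.transpose q) k).im = 0) : False := by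
  classical
  set w := conjMul (H.transpose p) (H.transpose q) with hw
  have hwn : ∀ k, ‖w k‖ = 1 := hH.transpose.norm_conjMul p q
  have hw0 : ∑ k, w k = 0 := hH.transpose.sum_conjMul hpq
  have h1 : (conj (conjMul (H a) (H b) p) * conjMul (H a) (H b) q).im = 0 := by
    rcases eq_neg_or_real (by decide) (hH.norm_conjMul a b) (hH.sum_conjMul hab) hpq hr with h | h
    · have := unit_conj_mul_self (hH.norm_conjMul a b q)
      rw [h, map_neg, neg_mul, this]; simp
    · exact im_conj_mul_eq_zero (h p) (h q)
  have h2 : (conj (w a) * w b).im = 0 := by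
    have e : conj (w a) * w b = conj (conjMul (H a) (H b) p) * conjMul (H a) (H b) q := by
      simp only [hw, conjMul, Matrix.transpose_apply, map_mul, Complex.conj_conj]; ring
    rw [e, h1]
  have h3 := eq_or_neg_of_im_conj_mul (hwn a) (hwn b) h2
  have hiff : (w b).im = 0 ↔ (w a).im = 0 := by rcases h3 with h | h <;> simp [h]
  have hsub : ∀ s : Finset (Fin 6), (∀ k, k ∈ s ↔ (w k).im ≠ 0) → nonrealSet w = s := by
    intro s hs; ext k; rw [mem_nonrealSet, hs]
  by_cases ha : (w a).im = 0
  · have : nonrealSet w = {i} := by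
      apply hsub
      intro k
      rw [Finset.mem_singleton]
      constructor
      · rintro rfl; exact hi
      · intro hk
        by_contra hki
        by_cases hka : k = a
        · subst hka; exact hk ha
        · by_cases hkb : k = b
          · subst hkb; exact hk (hiff.mpr ha)
          · exact hk (hc k hki hka hkb)
    exact nonrealCount_ne_one hw0 (by rw [nonrealCount, this, Finset.card_singleton])
  · have : nonrealSet w = {i, a, b} := by
      apply hsub
      intro k
      simp only [Finset.mem_insert, Finset.mem_singleton]
      constructor
      · rintro (rfl | rfl | rfl)
        · exact hi
        · exact ha
        · exact fun h => ha (hiff.mp h)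
      · intro hk
        by_contra hki
        push Not at hki
        exact hk (hc k hki.1 hki.2.1 hki.2.2)
    exact nonrealCount_six_ne_three hwn hw0 (by rw [nonrealCount, this]; simp [hia, hib, hab])

end IsComplexHadamard

/-- Two real positions `p`, `q` of three rows lie in different halves of the sign split of two of the rows. -/
theorem IsComplexHadamard.opposite_of_split {H : Matrix (Fin 6) (Fin 6) ℂ} (hH : IsComplexHadamard H)
    {a b c p q x : Fin 6} (hab : a ≠ b) (hca : c ≠ a) (hcb : c ≠ b) (hpq : p ≠ q)
    (h2 : nonrealCount (conjMul (H a) (H b)) = 2) (hx : (conjMul (H a) (H b) x).im ≠ 0)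
    (hx' : (conjMul (H a) (H b) x).re ≠ 0) (hap : (H a p).im = 0) (haq : (H a q).im = 0)
    (hbp : (H b p).im = 0) (hbq : (H b q).im = 0) (hcp : (H c p).im = 0) (hcq : (H c q).im = 0) :
    conjMul (H a) (H b) p = - conjMul (H a) (H b) q := by
  classical
  obtain ⟨t, u, -, -, -, htu, h1, hm1, hs⟩ := hH.exists_split hab h2
  obtain ⟨st, su⟩ := hs c hca hcb
  -- If `p` and `q` lay in the same part, row `c` would have a real ratio there, and the non-real
  -- product at `x` would be imaginary.
  have hrr : ∀ y : Finset (Fin 6), p ∈ y → q ∈ y → RealRatio (conjMul (H a) (H c)) y := fun y hp hq =>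
    ⟨p, hp, q, hq, hpq, im_conj_mul_eq_zero (im_conj_mul_eq_zero hap hcp) (im_conj_mul_eq_zero haq hcq)⟩
  have mem : ∀ k, (H a k).im = 0 → (H b k).im = 0 → k ∈ t ∨ k ∈ u := fun k hak hbk => by
    rw [← Finset.mem_union, ← htu, Finset.mem_compl, mem_nonrealSet, not_not]
    exact im_conj_mul_eq_zero hak hbk
  have hxm := mem_nonrealSet.mpr hx
  rcases mem p hap hbp with hp | hp <;> rcases mem q haq hbq with hq | hq
  · exact absurd ((st (hrr t hp hq)).2 x hxm) hx'
  · rw [h1 p hp, hm1 q hq, neg_neg]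
  · rw [h1 q hq, hm1 p hp]
  · exact absurd ((su (hrr u hp hq)).2 x hxm) hx'

theorem re_conj_mul_of_real_right {a b : ℂ} (hb : ‖b‖ = 1) (ha : a.re ≠ 0) (hb0 : b.im = 0) :
    (conj a * b).re ≠ 0 := by
  rcases real_unit hb hb0 with rfl | rfl <;> simpa using ha

/-- All non-real entries of the three rows are, up to sign and conjugation, the same number `X`. Up
to sign the products of `b` and `g` are `X` at `s, t, t', w`, while at `p` and `q` they are the same
sign, since both `b` and `g` change sign against `a` between `p` and `q`. -/
theorem IsComplexHadamard.false_of_path {H : Matrix (Fin 6) (Fin 6) ℂ} (hH : IsComplexHadamard H)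
    {a b g s t t' w p q : Fin 6} (hab : a ≠ b) (hag : a ≠ g) (hbg : b ≠ g)
    (hsum : ∀ f : Fin 6 → ℂ, ∑ k, f k = f s + f t + f t' + f w + f p + f q)
    (hstt : s ≠ t') (htt : t ≠ t') (hsw : s ≠ w) (hpq : p ≠ q)
    (ha : nonrealSet (H a) = {s, t'}) (hb : nonrealSet (H b) = {s, t}) (hg : nonrealSet (H g) = {t', w})
    (hst : s ≠ t) (htw : t ≠ w) (htw' : t' ≠ w) (hps : p ≠ s) (hpt : p ≠ t) (hpt' : p ≠ t') (hpw : p ≠ w)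
    (hqs : q ≠ s) (hqt : q ≠ t) (hqt' : q ≠ t') (hqw : q ≠ w)
    (has : (H a s).re ≠ 0) (hat : (H a t').re ≠ 0) (hgw : (conj (H g t') * H g w).im = 0)
    (h3 : nonrealCount (conjMul (H a) (H b)) ≤ 3) (h3' : nonrealCount (conjMul (H a) (H g)) ≤ 3) : False := by
  have hA : ∀ k, (H a k).im ≠ 0 ↔ k = s ∨ k = t' := fun k => by rw [← mem_nonrealSet, ha]; simp
  have hB : ∀ k, (H b k).im ≠ 0 ↔ k = s ∨ k = t := fun k => by rw [← mem_nonrealSet, hb]; simp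
  have hG : ∀ k, (H g k).im ≠ 0 ↔ k = t' ∨ k = w := fun k => by rw [← mem_nonrealSet, hg]; simp
  have hA0 : ∀ k, k ≠ s → k ≠ t' → (H a k).im = 0 := fun k h1 h2 => by
    by_contra h; rcases (hA k).mp h with h | h <;> contradiction
  have hB0 : ∀ k, k ≠ s → k ≠ t → (H b k).im = 0 := fun k h1 h2 => by
    by_contra h; rcases (hB k).mp h with h | h <;> contradiction
  have hG0 : ∀ k, k ≠ t' → k ≠ w → (H g k).im = 0 := fun k h1 h2 => by
    by_contra h; rcases (hG k).mp h with h | h <;> contradiction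
  have bt' : (H b t').im = 0 := hB0 t' hstt.symm htt.symm
  have at0 : (H a t).im = 0 := hA0 t hst.symm htt
  have gs : (H g s).im = 0 := hG0 s hstt hsw
  have aw : (H a w).im = 0 := hA0 w hsw.symm htw'.symm
  have v1 : (conjMul (H a) (H b) t').im ≠ 0 :=
    im_conj_mul_ne_zero_left (hH.2 b t') ((hA t').mpr (Or.inr rfl)) bt'
  have v2 : (conjMul (H a) (H b) t).im ≠ 0 :=
    im_conj_mul_ne_zero_right (hH.2 a t) at0 ((hB t).mpr (Or.inr rfl))
  have w1 : (conjMul (H a) (H g) s).im ≠ 0 :=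
    im_conj_mul_ne_zero_left (hH.2 g s) ((hA s).mpr (Or.inl rfl)) gs
  have w2 : (conjMul (H a) (H g) w).im ≠ 0 :=
    im_conj_mul_ne_zero_right (hH.2 a w) aw ((hG w).mpr (Or.inr rfl))
  have nv := nonrealSet_eq_pair (hH.norm_conjMul a b) (hH.sum_conjMul hab) h3 htt.symm v1 v2
  have nw := nonrealSet_eq_pair (hH.norm_conjMul a g) (hH.sum_conjMul hag) h3' hsw w1 w2
  have ap := hA0 p hps hpt'
  have aq := hA0 q hqs hqt'
  have bp := hB0 p hps hpt
  have bq := hB0 q hqs hqt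
  have gp := hG0 p hpt' hpw
  have gq := hG0 q hqt' hqw
  have o1 := hH.opposite_of_split (x := t') hab hag.symm hbg.symm hpq
    (by rw [nonrealCount, nv, Finset.card_pair htt.symm]) v1
    (re_conj_mul_of_real_right (hH.2 b t') hat bt') ap aq bp bq gp gq
  have o2 := hH.opposite_of_split (x := s) hag hab.symm hbg hpq
    (by rw [nonrealCount, nw, Finset.card_pair hsw]) w1
    (re_conj_mul_of_real_right (hH.2 g s) has gs) ap aq gp gq bp bq
  have r1 := eq_or_neg_of_im_conj_mul (hH.2 a s) (hH.2 b s)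
    (hH.im_conjMul_eq_zero hab htt.symm h3 v1 v2 hstt hst)
  have r2 := eq_or_neg_of_im_mul (hH.2 a t') (hH.2 b t)
    (hH.im_mul_eq_zero hab htt.symm h3 ((hA t').mpr (Or.inr rfl)) bt' at0 ((hB t).mpr (Or.inr rfl)))
  have r3 := eq_or_neg_of_im_conj_mul (hH.2 a t') (hH.2 g t')
    (hH.im_conjMul_eq_zero hag hsw h3' w1 w2 hstt.symm htw')
  have r4 := eq_or_neg_of_im_mul (hH.2 a s) (hH.2 g w)
    (hH.im_mul_eq_zero hag hsw h3' ((hA s).mpr (Or.inl rfl)) gs aw ((hG w).mpr (Or.inr rfl)))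
  have r5 := eq_or_neg_of_im_conj_mul (hH.2 g t') (hH.2 g w) hgw
  have h0 : ∑ k, conjMul (H b) (H g) k = 0 := hH.sum_conjMul hbg
  rw [hsum] at h0
  set X := H a t' with hX
  have im0 : X.im ≠ 0 := (hA t').mpr (Or.inr rfl)
  have rw' : H g w = X ∨ H g w = -X := by
    rcases r5 with h | h <;> rcases r3 with h' | h' <;> rw [h, h'] <;> simp
  have rs : conj (H a s) = X ∨ conj (H a s) = -X := by
    rcases r4 with h | h <;> rcases rw' with h' | h'
    · left; rw [← h, h']
    · right; rw [← h, h']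
    · right; rw [← h', h, neg_neg]
    · left; linear_combination h - h'
  have real := fun i k (h : (H i k).im = 0) => real_unit (hH.2 i k) h
  have cs : conjMul (H b) (H g) s = X ∨ conjMul (H b) (H g) s = -X := by
    simp only [conjMul]
    rcases r1 with h | h <;> rcases real g s gs with h' | h' <;> rcases rs with h'' | h'' <;>
      rw [h, h'] <;> simp [h'']
  have ct : conjMul (H b) (H g) t = X ∨ conjMul (H b) (H g) t = -X := by
    simp only [conjMul]
    rcases r2 with h | h <;> rcases real g t (hG0 t htt htw) with h' | h' <;> rw [h, h'] <;> simp
  have ct' : conjMul (H b) (H g) t' = X ∨ conjMul (H b) (H g) t' = -X := by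
    simp only [conjMul]
    rcases real b t' bt' with h | h <;> rcases r3 with h' | h' <;> rw [h, h'] <;> simp
  have cw : conjMul (H b) (H g) w = X ∨ conjMul (H b) (H g) w = -X := by
    simp only [conjMul]
    rcases real b w (hB0 w hsw.symm htw.symm) with h | h <;> rcases rw' with h' | h' <;> rw [h, h'] <;> simp
  have cpq : conjMul (H b) (H g) p = conjMul (H b) (H g) q := by
    simp only [conjMul] at o1 o2 ⊢
    rcases real a p ap with h | h <;> rcases real a q aq with h' | h' <;>
      rw [h, h'] at o1 o2 <;> simp at o1 o2 <;> first | simp [o1, o2] | simp [← o1, ← o2]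
  have cq : conjMul (H b) (H g) q = 1 ∨ conjMul (H b) (H g) q = -1 :=
    real_unit (hH.norm_conjMul b g q) (im_conj_mul_eq_zero bq gq)
  -- The sum has become an even multiple of `X` plus `±2`. As `X` is not real that multiple
  -- vanishes, and `±2` remains.
  rw [cpq] at h0
  have hi := congrArg Complex.im h0
  have hr := congrArg Complex.re h0
  rcases cs with e1 | e1 <;> rcases ct with e2 | e2 <;> rcases ct' with e3 | e3 <;>
    rcases cw with e4 | e4 <;> rcases cq with e5 | e5 <;> rw [e1, e2, e3, e4, e5] at hi hr <;>
    norm_num at hi hr <;>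
    exact im0 (by linarith)

theorem exists_int_sign {z : ℂ} (hz : ‖z‖ = 1) (p : Prop) [Decidable p] (h0 : p → z.re = 0)
    (h1 : ¬ p → z.im = 0) : ∃ m : ℤ, m * m = 1 ∧ z = (if p then I else 1) * m := by
  by_cases hp : p
  · have h := unit_re_im hz
    rw [h0 hp, mul_zero, zero_add] at h
    rcases mul_self_eq_one_iff.mp h with h | h
    · exact ⟨1, rfl, by simp only [if_pos hp]; apply Complex.ext <;> simp [h0 hp, h]⟩
    · exact ⟨-1, rfl, by simp only [if_pos hp]; apply Complex.ext <;> simp [h0 hp, h]⟩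
  · rcases real_unit hz (h1 hp) with h | h
    · exact ⟨1, rfl, by simp [hp, h]⟩
    · exact ⟨-1, rfl, by simp [hp, h]⟩

theorem int_sign {m : ℤ} (h : m * m = 1) : m = 1 ∨ m = -1 := mul_self_eq_one_iff.mp h

/-- There are no four vectors with one imaginary entry each, at positions `0, 1, 2, 3`, together with a vector
imaginary exactly at `0, 1, 4`, all pairwise orthogonal and otherwise real. -/
theorem false_of_four_imaginary {e : Fin 6 → ℂ} {r : Fin 4 → Fin 6 → ℂ} (he : ∀ k, ‖e k‖ = 1)
    (hr : ∀ j k, ‖r j k‖ = 1) (he0 : ∀ k, k = 0 ∨ k = 1 ∨ k = 4 → (e k).re = 0)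
    (he1 : ∀ k, ¬ (k = 0 ∨ k = 1 ∨ k = 4) → (e k).im = 0)
    (hr0 : ∀ j k, k = Fin.castLE (by decide) j → (r j k).re = 0)
    (hr1 : ∀ j k, ¬ k = Fin.castLE (by decide) j → (r j k).im = 0)
    (hre : ∀ j, ∑ k, conj (r j k) * e k = 0) (hrr : ∀ i j, i ≠ j → ∑ k, conj (r i k) * r j k = 0) :
    False := by
  have h1 := fun k => exists_int_sign (he k) _ (he0 k) (he1 k)
  choose s hs hes using h1
  have h2 := fun j k => exists_int_sign (hr j k) _ (hr0 j k) (hr1 j k)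
  choose y hy hry using h2
  have E0 := hre 0
  have E1 := hre 1
  have E2 := hre 2
  have E3 := hre 3
  have D01 := hrr 0 1 (by decide)
  have D02 := hrr 0 2 (by decide)
  have D03 := hrr 0 3 (by decide)
  have D12 := hrr 1 2 (by decide)
  have D13 := hrr 1 3 (by decide)
  have D23 := hrr 2 3 (by decide)
  simp only [hes, hry, Fin.sum_univ_six] at E0 E1 E2 E3 D01 D02 D03 D12 D13 D23
  norm_num [Fin.ext_iff, Complex.ext_iff] at E0 E1 E2 E3 D01 D02 D03 D12 D13 D23
  norm_cast at E0 E1 E2 E3 D01 D02 D03 D12 D13 D23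
  have sq : ∀ j k l, y j k * s l * (y j k * s l) = 1 := fun j k l => by
    linear_combination s l * s l * hy j k + hs l
  -- Products of signs in which the choice of representatives for the rows and for `e` cancels, so
  -- that `X j j = 1`.
  set X : Fin 4 → Fin 6 → ℤ := fun j k => y j k * s k * (y j (Fin.castLE (by decide) j) * s (Fin.castLE (by decide) j)) with hX
  have hXX : ∀ j k, X j k * X j k = 1 := fun j k => by
    linear_combination (sq j (Fin.castLE (by decide) j) (Fin.castLE (by decide) j)) * (y j k * s k * (y j k * s k)) + sq j k k
  have u01 : X 0 1 = y 0 1 * s 1 * (y 0 0 * s 0) := rfl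
  have u02 : X 0 2 = y 0 2 * s 2 * (y 0 0 * s 0) := rfl
  have u03 : X 0 3 = y 0 3 * s 3 * (y 0 0 * s 0) := rfl
  have u04 : X 0 4 = y 0 4 * s 4 * (y 0 0 * s 0) := rfl
  have u05 : X 0 5 = y 0 5 * s 5 * (y 0 0 * s 0) := rfl
  have u10 : X 1 0 = y 1 0 * s 0 * (y 1 1 * s 1) := rfl
  have u12 : X 1 2 = y 1 2 * s 2 * (y 1 1 * s 1) := rfl
  have u13 : X 1 3 = y 1 3 * s 3 * (y 1 1 * s 1) := rfl
  have u14 : X 1 4 = y 1 4 * s 4 * (y 1 1 * s 1) := rfl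
  have u15 : X 1 5 = y 1 5 * s 5 * (y 1 1 * s 1) := rfl
  have u20 : X 2 0 = y 2 0 * s 0 * (y 2 2 * s 2) := rfl
  have u21 : X 2 1 = y 2 1 * s 1 * (y 2 2 * s 2) := rfl
  have u23 : X 2 3 = y 2 3 * s 3 * (y 2 2 * s 2) := rfl
  have u24 : X 2 4 = y 2 4 * s 4 * (y 2 2 * s 2) := rfl
  have u25 : X 2 5 = y 2 5 * s 5 * (y 2 2 * s 2) := rfl
  have u30 : X 3 0 = y 3 0 * s 0 * (y 3 3 * s 3) := rfl
  have u31 : X 3 1 = y 3 1 * s 1 * (y 3 3 * s 3) := rfl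
  have u32 : X 3 2 = y 3 2 * s 2 * (y 3 3 * s 3) := rfl
  have u34 : X 3 4 = y 3 4 * s 4 * (y 3 3 * s 3) := rfl
  have u35 : X 3 5 = y 3 5 * s 5 * (y 3 3 * s 3) := rfl
  -- Real and imaginary parts of the orthogonality with `e` express columns 4 and 5 through columns
  -- 0 to 3.
  have v05 : X 0 5 = -1 - X 0 2 - X 0 3 := by
    rw [u05, u02, u03]; linear_combination (y 0 0 * s 0) * E0.1 - sq 0 0 0
  have v04 : X 0 4 = -X 0 1 := by
    rw [u04, u01]; linear_combination (y 0 0 * s 0) * E0.2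
  have v15 : X 1 5 = -1 - X 1 2 - X 1 3 := by
    rw [u15, u12, u13]; linear_combination (y 1 1 * s 1) * E1.1 - sq 1 1 1
  have v14 : X 1 4 = -X 1 0 := by
    rw [u14, u10]; linear_combination (y 1 1 * s 1) * E1.2
  have v25 : X 2 5 = -X 2 3 := by
    rw [u25, u23]; linear_combination (y 2 2 * s 2) * E2.1
  have v24 : X 2 4 = 1 - X 2 0 - X 2 1 := by
    rw [u24, u20, u21]; linear_combination (y 2 2 * s 2) * E2.2 + sq 2 2 2
  have v35 : X 3 5 = -X 3 2 := by
    rw [u35, u32]; linear_combination (y 3 3 * s 3) * E3.1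
  have v34 : X 3 4 = 1 - X 3 0 - X 3 1 := by
    rw [u34, u30, u31]; linear_combination (y 3 3 * s 3) * E3.2 + sq 3 3 3
  -- The imaginary parts of the orthogonality of two of the four rows make the array symmetric; the
  -- real parts give the quadratic equations below.
  have w01 : X 1 0 = X 0 1 := by
    rw [u10, u01]
    linear_combination s 0 * s 1 * (-(y 0 0 * y 1 1) * D01.2 - y 1 0 * y 1 1 * hy 0 0 + y 0 0 * y 0 1 * hy 1 1)
  have w02 : X 2 0 = X 0 2 := by
    rw [u20, u02]
    linear_combination s 0 * s 2 * (-(y 0 0 * y 2 2) * D02.2 - y 2 0 * y 2 2 * hy 0 0 + y 0 0 * y 0 2 * hy 2 2)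
  have w03 : X 3 0 = X 0 3 := by
    rw [u30, u03]
    linear_combination s 0 * s 3 * (-(y 0 0 * y 3 3) * D03.2 - y 3 0 * y 3 3 * hy 0 0 + y 0 0 * y 0 3 * hy 3 3)
  have w12 : X 2 1 = X 1 2 := by
    rw [u21, u12]
    linear_combination s 1 * s 2 * (-(y 1 1 * y 2 2) * D12.2 - y 2 1 * y 2 2 * hy 1 1 + y 1 1 * y 1 2 * hy 2 2)
  have w13 : X 3 1 = X 1 3 := by
    rw [u31, u13]
    linear_combination s 1 * s 3 * (-(y 1 1 * y 3 3) * D13.2 - y 3 1 * y 3 3 * hy 1 1 + y 1 1 * y 1 3 * hy 3 3)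
  have w23 : X 3 2 = X 2 3 := by
    rw [u32, u23]
    linear_combination s 2 * s 3 * (-(y 2 2 * y 3 3) * D23.2 - y 3 2 * y 3 3 * hy 2 2 + y 2 2 * y 2 3 * hy 3 3)
  have q01 : X 0 2 * X 1 2 + X 0 3 * X 1 3 + X 0 4 * X 1 4 + X 0 5 * X 1 5 = 0 := by
    rw [u02, u12, u03, u13, u04, u14, u05, u15]
    linear_combination (y 0 0 * s 0) * (y 1 1 * s 1) * (D01.1 + y 0 2 * y 1 2 * hs 2 + y 0 3 * y 1 3 * hs 3 + y 0 4 * y 1 4 * hs 4 + y 0 5 * y 1 5 * hs 5)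
  have q02 : X 0 1 * X 2 1 + X 0 3 * X 2 3 + X 0 4 * X 2 4 + X 0 5 * X 2 5 = 0 := by
    rw [u01, u21, u03, u23, u04, u24, u05, u25]
    linear_combination (y 0 0 * s 0) * (y 2 2 * s 2) * (D02.1 + y 0 1 * y 2 1 * hs 1 + y 0 3 * y 2 3 * hs 3 + y 0 4 * y 2 4 * hs 4 + y 0 5 * y 2 5 * hs 5)
  have q03 : X 0 1 * X 3 1 + X 0 2 * X 3 2 + X 0 4 * X 3 4 + X 0 5 * X 3 5 = 0 := by
    rw [u01, u31, u02, u32, u04, u34, u05, u35]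
    linear_combination (y 0 0 * s 0) * (y 3 3 * s 3) * (D03.1 + y 0 1 * y 3 1 * hs 1 + y 0 2 * y 3 2 * hs 2 + y 0 4 * y 3 4 * hs 4 + y 0 5 * y 3 5 * hs 5)
  have q12 : X 1 0 * X 2 0 + X 1 3 * X 2 3 + X 1 4 * X 2 4 + X 1 5 * X 2 5 = 0 := by
    rw [u10, u20, u13, u23, u14, u24, u15, u25]
    linear_combination (y 1 1 * s 1) * (y 2 2 * s 2) * (D12.1 + y 1 0 * y 2 0 * hs 0 + y 1 3 * y 2 3 * hs 3 + y 1 4 * y 2 4 * hs 4 + y 1 5 * y 2 5 * hs 5)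
  have q13 : X 1 0 * X 3 0 + X 1 2 * X 3 2 + X 1 4 * X 3 4 + X 1 5 * X 3 5 = 0 := by
    rw [u10, u30, u12, u32, u14, u34, u15, u35]
    linear_combination (y 1 1 * s 1) * (y 3 3 * s 3) * (D13.1 + y 1 0 * y 3 0 * hs 0 + y 1 2 * y 3 2 * hs 2 + y 1 4 * y 3 4 * hs 4 + y 1 5 * y 3 5 * hs 5)
  have q23 : X 2 0 * X 3 0 + X 2 1 * X 3 1 + X 2 4 * X 3 4 + X 2 5 * X 3 5 = 0 := by
    rw [u20, u30, u21, u31, u24, u34, u25, u35]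
    linear_combination (y 2 2 * s 2) * (y 3 3 * s 3) * (D23.1 + y 2 0 * y 3 0 * hs 0 + y 2 1 * y 3 1 * hs 1 + y 2 4 * y 3 4 * hs 4 + y 2 5 * y 3 5 * hs 5)
  have n05 := hXX 0 5
  have n15 := hXX 1 5
  have n24 := hXX 2 4
  have n34 := hXX 3 4
  rw [v05] at n05
  rw [v15] at n15
  rw [v24, w02, w12] at n24
  rw [v34, w03, w13] at n34
  simp only [v04, v05, v14, v15, v24, v25, v34, v35, w01, w02, w03, w12, w13, w23] at q01 q02 q03 q12 q13 q23
  clear_value X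
  -- Six signs remain free, and none of the 64 assignments satisfies the equations.
  rcases int_sign (hXX 0 1) with a | a <;> rcases int_sign (hXX 0 2) with b | b <;>
    rcases int_sign (hXX 0 3) with c | c <;> rcases int_sign (hXX 1 2) with d | d <;>
    rcases int_sign (hXX 1 3) with f | f <;> rcases int_sign (hXX 2 3) with g | g <;>
    simp [a, b, c, d, f, g] at q01 q02 q03 q12 q13 q23 n05 n15 n24 n34


/-! ### Label patterns as bit masks, the tests on them, and the search -/

/-- Conjunction, evaluating the first argument only if it is false. -/
def andFast (a b : Bool) : Bool := Bool.rec false b a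

/-- Disjunction, evaluating the first argument only if it is true. -/
def orFast (a b : Bool) : Bool := Bool.rec b true a

/-- Negation. -/
def notFast (a : Bool) : Bool := Bool.rec true false a

/-- Case distinction. -/
def condFast {α : Type} (c : Bool) (x y : α) : α := Bool.rec y x c

infixl:35 " ⋏ " => andFast
infixl:30 " ⋎ " => orFast

/-- All members of a list satisfy `p`. -/
def allFast (l : List ℕ) (p : ℕ → Bool) : Bool := List.rec true (fun a _ ih => p a ⋏ ih) l

/-- Some member of a list satisfies `p`. -/
def anyFast (l : List ℕ) (p : ℕ → Bool) : Bool := List.rec false (fun a _ ih => p a ⋎ ih) l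

/-- The members of a list that satisfy `p`. -/
def filterFast (l : List ℕ) (p : ℕ → Bool) : List ℕ :=
  List.rec [] (fun a _ ih => condFast (p a) (a :: ih) ih) l

/-- The number of ones among the six binary digits of `m < 64`, read off from a table of octal digits. -/
def bitCount (m : ℕ) : ℕ :=
  Nat.land (Nat.shiftRight 0xd6cb23b238dab238da8da691b238da8da6918da691691448 (Nat.mul 3 m)) 7

/-- The positions of the real entries of a row encoded by `m`. -/
def realMask (m : ℕ) : ℕ := Nat.land m 63

/-- The positions of the imaginary entries of a row encoded by `m`. -/
def imagMask (m : ℕ) : ℕ := Nat.shiftRight m 6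

/-- The positions of the entries neither real nor imaginary of a row encoded by `m`. -/
def genericMask (m : ℕ) : ℕ := Nat.xor 63 (Nat.lor (realMask m) (imagMask m))

/-- The positions of the non-real entries of a row encoded by `m`. -/
def nonrealMask (m : ℕ) : ℕ := Nat.xor 63 (realMask m)

/-- Positions where the product of two rows is known to be real. -/
def realProd (a b : ℕ) : ℕ := 
  Nat.lor (Nat.land (realMask a) (realMask b)) (Nat.land (imagMask a) (imagMask b))

/-- Positions where the product of two rows is known to be imaginary. -/
def imagProd (a b : ℕ) : ℕ := 
  Nat.lor (Nat.land (realMask a) (imagMask b)) (Nat.land (imagMask a) (realMask b))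

/-- Positions where nothing is known about the product of two rows. -/
def unknownProd (a b : ℕ) : ℕ := Nat.land (genericMask a) (genericMask b)

/-- Positions where the product of two rows is known to be neither real nor imaginary. -/
def genericProd (a b : ℕ) : ℕ := 
  Nat.xor 63 (Nat.lor (Nat.lor (realProd a b) (imagProd a b)) (unknownProd a b))

/-- A table of the triples of numbers of known real, known imaginary and unknown products that may occur
for orthogonal rows. -/
def pairTable : ℕ :=
  0x7ffdfff7ffffff7cfdf3f7efdfff7ffdfff7ffdf3f7cfdf3f7ffdfff7fffffffefdf3ffffffff7ffdfffff

/-- A necessary condition for the orthogonality of two rows. -/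
def pairOk (a b : ℕ) : Bool :=
  Nat.beq (Nat.land (Nat.shiftRight pairTable (Nat.add (Nat.mul 49 (bitCount (realProd a b)))
    (Nat.add (Nat.mul 7 (bitCount (imagProd a b))) (bitCount (unknownProd a b))))) 1) 1

/-- Some ratio of entries of the product of two rows in the positions `h` is known to be real. -/
def hasRealRatio (h a b : ℕ) : Bool :=
  Nat.ble 2 (bitCount (Nat.land h (realProd a b))) ⋎ Nat.ble 2 (bitCount (Nat.land h (imagProd a b)))

/-- The ratio of the entries of the product of two rows in the two positions `h` may be imaginary. -/
def mayBeImaginary (h a b : ℕ) : Bool :=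
  notFast (hasRealRatio h a b) ⋏
    notFast (Nat.beq (bitCount (Nat.land h (genericProd a b))) 1 ⋏ Nat.beq (Nat.land h (unknownProd a b)) 0)

/-- Two parallel real rows admit a split of the positions into halves, compatible with the other rows. -/
def halvesOk (a : ℕ) (others : List ℕ) : Bool :=
  anyFast (List.range 64) fun h => Nat.beq (bitCount h) 3 ⋏
    allFast others fun c => notFast (hasRealRatio h a c) ⋏ notFast (hasRealRatio (Nat.xor 63 h) a c)

/-- The split `h`, `k` of the real positions of a product is compatible with a row `c`. -/
def splitCompatible (zi : Bool) (h k a c : ℕ) : Bool :=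
  (notFast (hasRealRatio h a c) ⋎ (zi ⋏ mayBeImaginary k a c)) ⋏
    (notFast (hasRealRatio k a c) ⋎ (zi ⋏ mayBeImaginary h a c))

/-- The four real positions `R` of a product of two rows admit a split compatible with the other rows. -/
def fourOk (R a b : ℕ) (others : List ℕ) : Bool :=
  Nat.beq (bitCount R) 4 ⋏ anyFast (List.range 64) fun h => Nat.beq (bitCount h) 2 ⋏ Nat.beq (Nat.land h R) h ⋏
    allFast others fun c =>
      splitCompatible (Nat.beq (Nat.land (Nat.xor 63 R) (genericProd a b)) 0) h (Nat.xor R h) a c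

/-- Positions where the product of two orthogonal rows has to be real. -/
def forcedReal (a b : ℕ) : ℕ :=
  condFast (Nat.beq (bitCount (realProd a b)) 3 ⋏ Nat.beq (bitCount (unknownProd a b)) 1)
    (Nat.lor (realProd a b) (unknownProd a b)) (realProd a b)

/-- A necessary condition for two orthogonal rows to be orthogonal to the other rows. -/
def splitOk (a b : ℕ) (others : List ℕ) : Bool :=
  Nat.ble (bitCount (forcedReal a b)) 3 ⋎
    (Nat.beq (Nat.land (Nat.xor 63 (forcedReal a b)) (unknownProd a b)) (Nat.xor 63 (forcedReal a b)) ⋏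
      halvesOk a others) ⋎
    fourOk (forcedReal a b) a b others

/-- The entry with index `i` of a list of codes. -/
def entry (r : List ℕ) (i : ℕ) : ℕ := 
  List.rec (motive := fun _ => ℕ → ℕ) (fun _ => 0) (fun a _ ih i => Nat.rec a (fun k _ => ih k) i) r i

/-- The split conditions for all pairs in a list of rows. -/
def splitsOk (r : List ℕ) : Bool :=
  allFast (List.range r.length) fun i => allFast (List.range r.length) fun j => Nat.ble j i ⋎
    splitOk (entry r i) (entry r j)
      ((filterFast (List.range r.length) fun k => notFast (Nat.beq k i) ⋏ notFast (Nat.beq k j)).map (entry r))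

/-- The pair conditions for all pairs in a list of rows. -/
def pairsOk (r : List ℕ) : Bool := List.rec true (fun a r ih => allFast r (pairOk a) ⋏ ih) r

/-- The three rows contain a triangle of generic entries with real pairwise products. -/
def triangle (r : List ℕ) : Bool :=
  anyFast r fun a => notFast (Nat.beq (genericMask a) 0) ⋏ anyFast r fun b => Nat.ble 3 (bitCount (realProd a b)) ⋏
    notFast (Nat.beq (Nat.land (realMask a) (nonrealMask b)) 0) ⋏ anyFast r fun c =>
    notFast (Nat.beq (Nat.land (Nat.land (genericMask a) (realMask b)) (realMask c)) 0) ⋏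
    notFast (Nat.beq (Nat.land (Nat.land (realMask a) (nonrealMask b)) (realMask c)) 0) ⋏
    notFast (Nat.beq (Nat.land (Nat.land (realMask a) (realMask b)) (nonrealMask c)) 0) ⋏
    Nat.ble 3 (bitCount (realProd b c)) ⋏ Nat.ble 3 (bitCount (realProd a c))

/-- There is a rectangle, real on its complement in two rows, with exactly one known non-real product on its
complement in two columns. -/
def rectangle (r c : List ℕ) : Bool :=
  anyFast (List.range 6) fun a => anyFast (List.range 6) fun b => Nat.ble (a + 1) b ⋏
    Nat.ble 4 (bitCount (realProd (entry r a) (entry r b))) ⋏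
    anyFast (List.range 6) fun p => anyFast (List.range 6) fun q => Nat.ble (p + 1) q ⋏
      Nat.beq (Nat.lor (realProd (entry r a) (entry r b)) (Nat.lor (Nat.shiftLeft 1 p) (Nat.shiftLeft 1 q))) 63 ⋏
      Nat.beq (bitCount (Nat.land (realProd (entry c p) (entry c q))
        (Nat.xor 63 (Nat.lor (Nat.shiftLeft 1 a) (Nat.shiftLeft 1 b))))) 3 ⋏
      Nat.beq (bitCount (Nat.land (Nat.lor (imagProd (entry c p) (entry c q)) (genericProd (entry c p) (entry c q)))
        (Nat.xor 63 (Nat.lor (Nat.shiftLeft 1 a) (Nat.shiftLeft 1 b))))) 1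

/-- Three rows with two non-real entries each form a path whose middle row is generic and whose ends have related
entries. -/
def path (r c : List ℕ) : Bool :=
  anyFast (List.range 6) fun a => Nat.beq (bitCount (nonrealMask (entry r a))) 2 ⋏
    Nat.beq (genericMask (entry r a)) (nonrealMask (entry r a)) ⋏
    anyFast (List.range 6) fun b => Nat.beq (bitCount (nonrealMask (entry r b))) 2 ⋏
    Nat.beq (bitCount (Nat.land (nonrealMask (entry r a)) (nonrealMask (entry r b)))) 1 ⋏
    anyFast (List.range 6) fun g => Nat.beq (Nat.land (nonrealMask (entry r b)) (nonrealMask (entry r g))) 0 ⋏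
    anyFast (List.range 6) fun t => (nonrealMask (entry r a)).testBit t ⋏
    anyFast (List.range 6) fun w => notFast ((nonrealMask (entry r a)).testBit w) ⋏
      Nat.beq (nonrealMask (entry r g)) (Nat.lor (Nat.shiftLeft 1 t) (Nat.shiftLeft 1 w)) ⋏
      (unknownProd (entry c t) (entry c w)).testBit g ⋏
      Nat.ble 3 (bitCount (realProd (entry c t) (entry c w))) ⋏
      Nat.ble 2 (bitCount (Nat.lor (imagProd (entry c t) (entry c w)) (genericProd (entry c t) (entry c w))))

/-- The positions of the entries of rows whose only non-real entry is imaginary. -/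
def singleMask (r : List ℕ) : ℕ :=
  List.rec 0 (fun m _ acc => condFast (Nat.beq (bitCount (nonrealMask m)) 1 ⋏ Nat.beq (genericMask m) 0)
    (Nat.lor (nonrealMask m) acc) acc) r

/-- There are four rows with one imaginary entry each, and a row with three imaginary entries meeting two of them. -/
def fourImaginary (r : List ℕ) : Bool :=
  Nat.ble 4 (bitCount (singleMask r)) ⋏ anyFast r fun e => Nat.beq (bitCount (nonrealMask e)) 3 ⋏
    Nat.beq (genericMask e) 0 ⋏ Nat.beq (bitCount (Nat.land (nonrealMask e) (singleMask r))) 2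

/-- The twelve digits of a row code, moved to positions six apart, those belonging to a column together. -/
def spread (m : ℕ) : ℕ :=
  (List.range 6).foldr (fun j acc => Nat.lor (Nat.lor (Nat.shiftLeft (Nat.land (Nat.shiftRight m j) 1) (Nat.mul 12 j))
    (Nat.shiftLeft (Nat.land (Nat.shiftRight m (Nat.add j 6)) 1) (Nat.add (Nat.mul 12 j) 6))) acc) 0

/-- The codes of all columns of a matrix with the rows `r`. -/
def packedColumns (r : List ℕ) : ℕ :=
  List.rec 0 (fun m _ acc => Nat.lor (spread m) (Nat.shiftLeft acc 1)) r

/-- The code of the column with index `j` of a matrix with the rows `r`. -/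
def columnCode (r : List ℕ) (j : ℕ) : ℕ := Nat.land (Nat.shiftRight (packedColumns r) (Nat.mul 12 j)) 4095

/-- The codes of the columns of a matrix with the rows `r`. -/
def columnCodes (r : List ℕ) : List ℕ := (List.range 6).map (columnCode r)

/-- The matrix with the given rows and columns is excluded. -/
def excluded (r c : List ℕ) : Bool :=
  notFast (pairsOk c) ⋎ notFast (splitsOk c) ⋎ notFast (splitsOk r) ⋎ triangle r ⋎ triangle c ⋎ rectangle r c ⋎
    rectangle c r ⋎ path r c ⋎ path c r ⋎ fourImaginary r ⋎ fourImaginary c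

/-- The digits of `m < 64` in base two, read in base three. -/
def ternary (m : ℕ) : ℕ :=
  (m &&& 1) * 243 + (m >>> 1 &&& 1) * 81 + (m >>> 2 &&& 1) * 27 + (m >>> 3 &&& 1) * 9 + (m >>> 4 &&& 1) * 3 +
    (m >>> 5 &&& 1)

/-- The rows are ordered by the number of non-real entries, then the number of imaginary entries, then
lexicographically. -/
def rowKey (m : ℕ) : ℕ :=
  7290 * bitCount (nonrealMask m) + 729 * bitCount (imagMask m) + 2 * ternary (realMask m) + ternary (imagMask m)

/-- Positions where the label of an entry is that of its right neighbour. -/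
def equalNext (m : ℕ) : ℕ :=
  Nat.lor (Nat.lor (Nat.land (realMask m) (Nat.shiftRight (realMask m) 1))
    (Nat.land (imagMask m) (Nat.shiftRight (imagMask m) 1)))
    (Nat.land (genericMask m) (Nat.shiftRight (genericMask m) 1))

/-- Positions where the label of an entry exceeds that of its right neighbour. -/
def greaterNext (m : ℕ) : ℕ :=
  Nat.lor (Nat.land (realMask m) (Nat.shiftRight (nonrealMask m) 1))
    (Nat.land (imagMask m) (Nat.shiftRight (genericMask m) 1))

/-- The codes of all rows. -/
def allRows : List ℕ := filterFast (List.range 4096) fun m => Nat.beq (Nat.land (realMask m) (imagMask m)) 0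

/-- The row `c` may follow after a choice of rows with `s` non-real entries and last row `m`, if `n` rows are
missing. -/
def mayFollow (N n s e m c : ℕ) : Bool :=
  Nat.ble (rowKey m) (rowKey c) ⋏
  condFast (Nat.beq n 1)
    (Nat.beq (Nat.add s (bitCount (nonrealMask c))) N ⋏ Nat.beq (Nat.land e (greaterNext c)) 0)
    (Nat.ble (Nat.add (Nat.add s (Nat.mul (bitCount (nonrealMask m)) (Nat.pred n))) (bitCount (nonrealMask c))) N) ⋏
  pairOk m c

/-- Search for matrices with `N` non-real entries; the rows `r` have been chosen, in reverse order, `s` is their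
number of non-real entries and `e` marks the pairs of neighbouring columns that agree so far.
The value is `true` if no completion by `n` rows in `cands` is possible. -/
def search (N n : ℕ) : ℕ → ℕ → List ℕ → List ℕ → Bool :=
  Nat.rec (fun _ _ r _ => excluded r (columnCodes r)) (fun n ih s e r cands => allFast cands fun m =>
      notFast (Nat.ble (Nat.add s (Nat.mul (bitCount (nonrealMask m)) (Nat.succ n))) N) ⋎
      notFast (Nat.beq (Nat.land e (greaterNext m)) 0) ⋎
      (Nat.ble 1 n ⋏ Nat.ble n 3 ⋏ notFast (splitsOk (m :: r))) ⋎
      ih (Nat.add s (bitCount (nonrealMask m))) (Nat.land e (equalNext m)) (m :: r)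
        (condFast (Nat.beq n 0) [] (filterFast cands
          (mayFollow N n (Nat.add s (bitCount (nonrealMask m))) (Nat.land e (equalNext m)) m)))) n


/-! ### Meaning of the Boolean operations and of the masks -/

theorem andFast_eq (a b : Bool) : (a ⋏ b) = (a && b) := by cases a <;> rfl

theorem orFast_eq (a b : Bool) : (a ⋎ b) = (a || b) := by cases a <;> rfl

theorem notFast_eq (a : Bool) : notFast a = !a := by cases a <;> rfl

theorem condFast_eq {α : Type} (c : Bool) (x y : α) : condFast c x y = if c then x else y := by
  cases c <;> rfl

theorem allFast_eq (l : List ℕ) (p : ℕ → Bool) : allFast l p = l.all p := by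
  induction l with
  | nil => rfl
  | cons a l ih => rw [List.all_cons, ← ih, ← andFast_eq]; rfl

theorem anyFast_eq (l : List ℕ) (p : ℕ → Bool) : anyFast l p = l.any p := by
  induction l with
  | nil => rfl
  | cons a l ih => rw [List.any_cons, ← ih, ← orFast_eq]; rfl

theorem filterFast_eq (l : List ℕ) (p : ℕ → Bool) : filterFast l p = l.filter p := by
  induction l with
  | nil => rfl
  | cons a l ih => rw [List.filter_cons, ← ih, ← condFast_eq]; rfl

theorem entry_eq (r : List ℕ) (i : ℕ) : entry r i = r.getD i 0 := by
  induction r generalizing i with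
  | nil => rfl
  | cons a r ih =>
    cases i with
    | zero => rfl
    | succ i => rw [List.getD_cons_succ, ← ih]; rfl

/-- The set of positions encoded by the last six binary digits of `m`. -/
def bits (m : ℕ) : Finset (Fin 6) := Finset.univ.filter fun k => m.testBit k

theorem mem_bits {m : ℕ} {k : Fin 6} : k ∈ bits m ↔ m.testBit k := by simp [bits]

theorem bits_land (a b : ℕ) : bits (Nat.land a b) = bits a ∩ bits b := by
  ext k
  rw [Finset.mem_inter, mem_bits, mem_bits, mem_bits, ← Bool.and_eq_true, ← Nat.testBit_and]; rfl

theorem bits_lor (a b : ℕ) : bits (Nat.lor a b) = bits a ∪ bits b := by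
  ext k
  rw [Finset.mem_union, mem_bits, mem_bits, mem_bits, ← Bool.or_eq_true, ← Nat.testBit_or]; rfl

theorem testBit_sixty_three (k : Fin 6) : (63).testBit k = true := by revert k; decide

theorem bits_xor (a : ℕ) : bits (Nat.xor 63 a) = (bits a)ᶜ := by
  ext k
  rw [Finset.mem_compl, mem_bits, mem_bits]
  change (63 ^^^ a).testBit k = true ↔ _
  rw [Nat.testBit_xor, testBit_sixty_three]
  simp

theorem bits_shiftLeft_one (p : Fin 6) : bits (Nat.shiftLeft 1 p) = {p} := by revert p; decide

theorem land_lt {a b : ℕ} (h : b < 64) : Nat.land a b < 64 := Nat.and_lt_two_pow a (n := 6) h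

theorem land_lt_left {a b : ℕ} (h : a < 64) : Nat.land a b < 64 :=
  lt_of_le_of_lt (Nat.and_le_left) h

theorem lor_lt {a b : ℕ} (h : a < 64) (h' : b < 64) : Nat.lor a b < 64 := Nat.or_lt_two_pow (n := 6) h h'

theorem xor_lt {a b : ℕ} (h : a < 64) (h' : b < 64) : Nat.xor a b < 64 := Nat.xor_lt_two_pow (n := 6) h h'

set_option maxRecDepth 10000 in
theorem bitCount_eq {m : ℕ} (hm : m < 64) : bitCount m = (bits m).card := by
  revert m
  decide +kernel

theorem bits_injective {a b : ℕ} (ha : a < 64) (hb : b < 64) (h : bits a = bits b) : a = b := by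
  apply Nat.eq_of_testBit_eq
  intro i
  by_cases hi : i < 6
  · have := congrArg ((⟨i, hi⟩ : Fin 6) ∈ ·) h
    simp only [mem_bits, eq_iff_iff] at this
    exact Bool.eq_iff_iff.mpr this
  · rw [Nat.testBit_lt_two_pow (lt_of_lt_of_le ha (Nat.pow_le_pow_right (by norm_num) (not_lt.mp hi) : 2 ^ 6 ≤ _)),
      Nat.testBit_lt_two_pow (lt_of_lt_of_le hb (Nat.pow_le_pow_right (by norm_num) (not_lt.mp hi) : 2 ^ 6 ≤ _))]

theorem exists_bits_eq (s : Finset (Fin 6)) : ∃ m < 64, bits m = s := by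
  revert s
  decide +kernel

/-- The number `m` encodes the positions of the real and of the imaginary entries of `v`. -/
structure Encodes (v : Fin 6 → ℂ) (m : ℕ) : Prop where
  lt : m < 4096
  real : ∀ k, k ∈ bits (realMask m) ↔ (v k).im = 0
  imag : ∀ k, k ∈ bits (imagMask m) ↔ (v k).re = 0

theorem exists_encodes (v : Fin 6 → ℂ) : ∃ m, Encodes v m := by
  classical
  obtain ⟨a, ha, ha'⟩ := exists_bits_eq (Finset.univ.filter fun k => (v k).im = 0)
  obtain ⟨b, hb, hb'⟩ := exists_bits_eq (Finset.univ.filter fun k => (v k).re = 0)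
  refine ⟨a + 64 * b, by omega, fun k => ?_, fun k => ?_⟩
  · have : realMask (a + 64 * b) = a := by
      change (a + 64 * b) &&& (2 ^ 6 - 1) = a
      rw [Nat.and_two_pow_sub_one_eq_mod]; omega
    rw [this, ha']; simp
  · have : imagMask (a + 64 * b) = b := by
      change (a + 64 * b) >>> 6 = b
      rw [Nat.shiftRight_eq_div_pow]; omega
    rw [this, hb']; simp

theorem realMask_lt (m : ℕ) : realMask m < 64 := land_lt (by norm_num)

theorem imagMask_lt {m : ℕ} (hm : m < 4096) : imagMask m < 64 := by
  change m >>> 6 < 64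
  rw [Nat.shiftRight_eq_div_pow]; omega

theorem genericMask_lt {m : ℕ} (hm : m < 4096) : genericMask m < 64 :=
  xor_lt (by norm_num) (lor_lt (realMask_lt m) (imagMask_lt hm))

theorem nonrealMask_lt (m : ℕ) : nonrealMask m < 64 := xor_lt (by norm_num) (realMask_lt m)

theorem realProd_lt {a b : ℕ} (hb : b < 4096) : realProd a b < 64 :=
  lor_lt (land_lt (realMask_lt b)) (land_lt (imagMask_lt hb))

theorem imagProd_lt {a b : ℕ} (hb : b < 4096) : imagProd a b < 64 :=
  lor_lt (land_lt (imagMask_lt hb)) (land_lt (realMask_lt b))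

theorem unknownProd_lt {a b : ℕ} (hb : b < 4096) : unknownProd a b < 64 := land_lt (genericMask_lt hb)

theorem genericProd_lt {a b : ℕ} (hb : b < 4096) : genericProd a b < 64 :=
  xor_lt (by norm_num) (lor_lt (lor_lt (realProd_lt hb) (imagProd_lt hb)) (unknownProd_lt hb))

namespace Encodes

variable {v w : Fin 6 → ℂ} {a b : ℕ}

theorem mem_genericMask (ha : Encodes v a) (k : Fin 6) :
    k ∈ bits (genericMask a) ↔ (v k).im ≠ 0 ∧ (v k).re ≠ 0 := by
  rw [genericMask, bits_xor, bits_lor, Finset.mem_compl, Finset.mem_union, ha.real, ha.imag, not_or]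

theorem bits_nonrealMask (ha : Encodes v a) : bits (nonrealMask a) = nonrealSet v := by
  ext k
  rw [nonrealMask, bits_xor, Finset.mem_compl, ha.real, mem_nonrealSet]

theorem bitCount_nonrealMask (ha : Encodes v a) : bitCount (nonrealMask a) = nonrealCount v := by
  rw [bitCount_eq (nonrealMask_lt a), ha.bits_nonrealMask, card_nonrealSet]

theorem im_conjMul (ha : Encodes v a) (hb : Encodes w b) {k : Fin 6} (h : k ∈ bits (realProd a b)) :
    (conjMul v w k).im = 0 := by
  rw [realProd, bits_lor, bits_land, bits_land, Finset.mem_union, Finset.mem_inter, Finset.mem_inter,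
    ha.real, ha.imag, hb.real, hb.imag] at h
  rcases h with ⟨h1, h2⟩ | ⟨h1, h2⟩ <;> simp [conjMul, h1, h2]

theorem re_conjMul (ha : Encodes v a) (hb : Encodes w b) {k : Fin 6} (h : k ∈ bits (imagProd a b)) :
    (conjMul v w k).re = 0 := by
  rw [imagProd, bits_lor, bits_land, bits_land, Finset.mem_union, Finset.mem_inter, Finset.mem_inter,
    ha.real, ha.imag, hb.real, hb.imag] at h
  rcases h with ⟨h1, h2⟩ | ⟨h1, h2⟩ <;> simp [conjMul, h1, h2]

theorem mem_unknownProd (ha : Encodes v a) (hb : Encodes w b) {k : Fin 6} : k ∈ bits (unknownProd a b) ↔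
    ((v k).im ≠ 0 ∧ (v k).re ≠ 0) ∧ (w k).im ≠ 0 ∧ (w k).re ≠ 0 := by
  rw [unknownProd, bits_land, Finset.mem_inter, ha.mem_genericMask, hb.mem_genericMask]

theorem mem_genericProd {k : Fin 6} : k ∈ bits (genericProd a b) ↔
    k ∉ bits (realProd a b) ∧ k ∉ bits (imagProd a b) ∧ k ∉ bits (unknownProd a b) := by
  rw [genericProd, bits_xor, Finset.mem_compl, bits_lor, bits_lor, Finset.mem_union, Finset.mem_union]
  tauto

/-- At such a position exactly one factor is generic; the other is `±1` or `±i` and cannot move it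
onto an axis. -/
theorem ne_zero_of_mem_genericProd (ha : Encodes v a) (hb : Encodes w b) (hv : ∀ k, ‖v k‖ = 1)
    (hw : ∀ k, ‖w k‖ = 1) {k : Fin 6} (h : k ∈ bits (genericProd a b)) :
    (conjMul v w k).im ≠ 0 ∧ (conjMul v w k).re ≠ 0 := by
  rw [mem_genericProd, ha.mem_unknownProd hb, realProd, imagProd, bits_lor, bits_lor, bits_land, bits_land,
    bits_land, bits_land] at h
  simp only [Finset.mem_union, Finset.mem_inter, ha.real, ha.imag, hb.real, hb.imag] at h
  have h1 := unit_re_im (hv k)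
  have h2 := unit_re_im (hw k)
  simp only [conjMul, Complex.mul_im, Complex.mul_re, Complex.conj_re, Complex.conj_im]
  by_cases a1 : (v k).im = 0
  · have a2 : (v k).re ≠ 0 := by intro h; rw [h, a1] at h1; norm_num at h1
    have b1 : (w k).im ≠ 0 := by tauto
    have b2 : (w k).re ≠ 0 := by tauto
    simp [a1, a2, b1, b2]
  · by_cases a2 : (v k).re = 0
    · have b1 : (w k).im ≠ 0 := by tauto
      have b2 : (w k).re ≠ 0 := by tauto
      simp [a1, a2, b1, b2]
    · by_cases b1 : (w k).im = 0
      · have b2 : (w k).re ≠ 0 := by intro h; rw [h, b1] at h2; norm_num at h2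
        simp [a1, a2, b1, b2]
      · have b2 : (w k).re = 0 := by tauto
        simp [a1, a2, b1, b2]

theorem not_real_and_imag {z : ℂ} (hz : ‖z‖ = 1) (h1 : z.im = 0) (h2 : z.re = 0) : False := by
  have := unit_re_im hz
  rw [h1, h2] at this
  norm_num at this

/-- The numbers of real and of imaginary products are the known ones plus those from unknown positions. -/
theorem exists_counts (ha : Encodes v a) (hb : Encodes w b) (hv : ∀ k, ‖v k‖ = 1) (hw : ∀ k, ‖w k‖ = 1) :
    ∃ s t, s + t ≤ bitCount (unknownProd a b) ∧
      nonrealCount (conjMul v w) + (bitCount (realProd a b) + s) = 6 ∧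
      nonrealCount (fun k => I * conjMul v w k) + (bitCount (imagProd a b) + t) = 6 := by
  classical
  have hr : ∀ k, (conjMul v w k).im = 0 → k ∉ bits (unknownProd a b) → k ∈ bits (realProd a b) := by
    intro k h hu
    by_contra hk
    have hi : k ∉ bits (imagProd a b) := fun hi =>
      not_real_and_imag (norm_conjMul hv hw k) h (ha.re_conjMul hb hi)
    exact (ha.ne_zero_of_mem_genericProd hb hv hw (mem_genericProd.mpr ⟨hk, hi, hu⟩)).1 h
  have hi : ∀ k, (conjMul v w k).re = 0 → k ∉ bits (unknownProd a b) → k ∈ bits (imagProd a b) := by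
    intro k h hu
    by_contra hk
    have hi : k ∉ bits (realProd a b) := fun hi =>
      not_real_and_imag (norm_conjMul hv hw k) (ha.im_conjMul hb hi) h
    exact (ha.ne_zero_of_mem_genericProd hb hv hw (mem_genericProd.mpr ⟨hi, hk, hu⟩)).2 h
  have hdu : ∀ k, k ∈ bits (unknownProd a b) → k ∉ bits (realProd a b) ∧ k ∉ bits (imagProd a b) := by
    intro k hk
    rw [ha.mem_unknownProd hb] at hk
    rw [realProd, imagProd, bits_lor, bits_lor, bits_land, bits_land, bits_land, bits_land]
    simp only [Finset.mem_union, Finset.mem_inter, ha.real, ha.imag, hb.real, hb.imag]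
    tauto
  rw [bitCount_eq (realProd_lt hb.lt), bitCount_eq (imagProd_lt hb.lt), bitCount_eq (unknownProd_lt hb.lt)]
  refine ⟨((bits (unknownProd a b)).filter fun k => (conjMul v w k).im = 0).card,
    ((bits (unknownProd a b)).filter fun k => (conjMul v w k).re = 0).card, ?_, ?_, ?_⟩
  · rw [← Finset.card_union_of_disjoint]
    · exact Finset.card_le_card (Finset.union_subset (Finset.filter_subset _ _) (Finset.filter_subset _ _))
    · rw [Finset.disjoint_left]
      intro k h1 h2
      exact not_real_and_imag (norm_conjMul hv hw k) (Finset.mem_filter.mp h1).2 (Finset.mem_filter.mp h2).2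
  · rw [← Finset.card_union_of_disjoint, nonrealCount]
    · have : bits (realProd a b) ∪ (bits (unknownProd a b)).filter (fun k => (conjMul v w k).im = 0)
          = (nonrealSet (conjMul v w))ᶜ := by
        ext k
        rw [Finset.mem_union, Finset.mem_filter, Finset.mem_compl, mem_nonrealSet, not_not]
        constructor
        · rintro (h | h)
          exacts [ha.im_conjMul hb h, h.2]
        · intro h
          by_cases hu : k ∈ bits (unknownProd a b)
          exacts [Or.inr ⟨hu, h⟩, Or.inl (hr k h hu)]
      rw [this, Finset.card_add_card_compl, Fintype.card_fin]
    · rw [Finset.disjoint_left]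
      intro k h1 h2
      exact (hdu k (Finset.mem_filter.mp h2).1).1 h1
  · rw [← Finset.card_union_of_disjoint, nonrealCount]
    · have : bits (imagProd a b) ∪ (bits (unknownProd a b)).filter (fun k => (conjMul v w k).re = 0)
          = (nonrealSet fun k => I * conjMul v w k)ᶜ := by
        ext k
        rw [Finset.mem_union, Finset.mem_filter, Finset.mem_compl, mem_nonrealSet, not_not, Complex.I_mul_im]
        constructor
        · rintro (h | h)
          exacts [ha.re_conjMul hb h, h.2]
        · intro h
          by_cases hu : k ∈ bits (unknownProd a b)
          exacts [Or.inr ⟨hu, h⟩, Or.inl (hi k h hu)]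
      rw [this, Finset.card_add_card_compl, Fintype.card_fin]
    · rw [Finset.disjoint_left]
      intro k h1 h2
      exact (hdu k (Finset.mem_filter.mp h2).1).2 h1

end Encodes


/-! ### Soundness of the pair and split tests -/

theorem norm_I_mul {v : Fin 6 → ℂ} (hv : ∀ k, ‖v k‖ = 1) (k : Fin 6) : ‖I * v k‖ = 1 := by simp [hv]

theorem sum_I_mul {v : Fin 6 → ℂ} (h0 : ∑ k, v k = 0) : ∑ k, I * v k = 0 := by
  rw [← Finset.mul_sum, h0, mul_zero]

/-- The two non-real terms are opposite, so both or neither of them are imaginary; exactly one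
imaginary term is impossible. -/
theorem nonrealCount_I_mul_ne_five {v : Fin 6 → ℂ} (hv : ∀ k, ‖v k‖ = 1) (h0 : ∑ k, v k = 0)
    (h : nonrealCount v = 2) : nonrealCount (fun k => I * v k) ≠ 5 := by
  intro h5
  obtain ⟨p, q, hpq, hs⟩ := Finset.card_eq_two.mp h
  have hvpq := eq_neg_of_nonrealSet (by decide) hv h0 hpq hs
  obtain ⟨x, hx⟩ : ∃ x, (nonrealSet fun k => I * v k)ᶜ = {x} := by
    rw [← Finset.card_eq_one, Finset.card_compl, card_nonrealSet, h5]; rfl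
  have hmem : ∀ k, k = x ↔ (v k).re = 0 := fun k => by
    rw [← Finset.mem_singleton, ← hx, Finset.mem_compl, mem_nonrealSet, not_not, Complex.I_mul_im]
  have hx0 := (hmem x).mp rfl
  have hxs : x ∈ nonrealSet v := mem_nonrealSet.mpr fun h => Encodes.not_real_and_imag (hv x) h hx0
  rw [hs, Finset.mem_insert, Finset.mem_singleton] at hxs
  have hre : (v p).re = 0 ↔ (v q).re = 0 := by rw [hvpq]; simp
  rw [← hmem, ← hmem] at hre
  rcases hxs with rfl | rfl
  · exact hpq (hre.mp rfl).symm
  · exact hpq (hre.mpr rfl)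

/-- Here `s` and `t` are the numbers of unknown products that turn out real and imaginary.
Multiplication by `i` exchanges the two kinds, so each number of real products, and each number of
imaginary ones, avoids 3 and 5; the last two conditions are `nonrealCount_I_mul_ne_five`. Soundness
needs only that admissible triples are marked. -/
theorem pairTable_spec (z i u s t : Fin 7) : (s.1 + t.1 ≤ u.1 ∧ (z.1 + s.1 ≠ 3 ∧ z.1 + s.1 ≠ 5) ∧
    (i.1 + t.1 ≠ 3 ∧ i.1 + t.1 ≠ 5) ∧ ¬(z.1 + s.1 = 4 ∧ i.1 + t.1 = 1) ∧ ¬(i.1 + t.1 = 4 ∧ z.1 + s.1 = 1)) →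
    Nat.beq (Nat.land (Nat.shiftRight pairTable
      (Nat.add (Nat.mul 49 z.1) (Nat.add (Nat.mul 7 i.1) u.1))) 1) 1 = true := by
  revert z i u s t
  decide +kernel

theorem bitCount_le_six {m : ℕ} (hm : m < 64) : bitCount m ≤ 6 := by
  rw [bitCount_eq hm]
  exact (Finset.card_le_univ _).trans (by simp)

theorem Encodes.pairOk {v w : Fin 6 → ℂ} {a b : ℕ} (ha : Encodes v a) (hb : Encodes w b)
    (hv : ∀ k, ‖v k‖ = 1) (hw : ∀ k, ‖w k‖ = 1) (h0 : ∑ k, conjMul v w k = 0) : pairOk a b = true := by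
  obtain ⟨s, t, hst, h1, h2⟩ := ha.exists_counts hb hv hw
  have hn : ∀ k, ‖conjMul v w k‖ = 1 := norm_conjMul hv hw
  have hni := norm_I_mul hn
  have hsi := sum_I_mul h0
  have c1 := nonrealCount_ne_one h0
  have c3 := nonrealCount_six_ne_three hn h0
  have d1 := nonrealCount_ne_one hsi
  have d3 := nonrealCount_six_ne_three hni hsi
  have c2 := nonrealCount_I_mul_ne_five hn h0
  have d2 := nonrealCount_I_mul_ne_five hni hsi
  have hneg : nonrealCount (fun k => I * (I * conjMul v w k)) = nonrealCount (conjMul v w) := by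
    unfold nonrealCount
    congr 1
    ext k
    rw [mem_nonrealSet, mem_nonrealSet]
    simp
  rw [hneg] at d2
  have hz := bitCount_le_six (realProd_lt (a := a) hb.lt)
  have hi := bitCount_le_six (imagProd_lt (a := a) hb.lt)
  have hu := bitCount_le_six (unknownProd_lt (a := a) hb.lt)
  exact pairTable_spec ⟨bitCount (realProd a b), by omega⟩ ⟨bitCount (imagProd a b), by omega⟩
    ⟨bitCount (unknownProd a b), by omega⟩ ⟨s, by omega⟩ ⟨t, by omega⟩
    ⟨hst, by dsimp only; omega, by dsimp only; omega,
      by dsimp only; omega, by dsimp only; omega⟩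

theorem Encodes.realRatio {v w : Fin 6 → ℂ} {a b h : ℕ} (ha : Encodes v a) (hb : Encodes w b)
    (hh : hasRealRatio h a b = true) : RealRatio (conjMul v w) (bits h) := by
  rw [hasRealRatio, orFast_eq, Bool.or_eq_true, Nat.ble_eq, Nat.ble_eq, bitCount_eq (land_lt (realProd_lt hb.lt)),
    bitCount_eq (land_lt (imagProd_lt hb.lt)), bits_land, bits_land] at hh
  rcases hh with hh | hh
  · obtain ⟨i, hi, j, hj, hij⟩ := Finset.one_lt_card.mp hh
    rw [Finset.mem_inter] at hi hj
    exact ⟨i, hi.1, j, hj.1, hij, im_conj_mul_eq_zero (ha.im_conjMul hb hi.2) (ha.im_conjMul hb hj.2)⟩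
  · obtain ⟨i, hi, j, hj, hij⟩ := Finset.one_lt_card.mp hh
    rw [Finset.mem_inter] at hi hj
    refine ⟨i, hi.1, j, hj.1, hij, ?_⟩
    rw [Complex.mul_im, Complex.conj_re, Complex.conj_im, ha.re_conjMul hb hi.2, ha.re_conjMul hb hj.2]
    ring

/-- The test fails only if the pair has a known real ratio, or one entry off both axes and the other
on an axis; in neither case is the ratio imaginary. -/
theorem Encodes.mayBeImaginary {v w : Fin 6 → ℂ} {a b h : ℕ} (ha : Encodes v a) (hb : Encodes w b)
    (hv : ∀ k, ‖v k‖ = 1) (hw : ∀ k, ‖w k‖ = 1) (hh : h < 64) (h2 : (bits h).card = 2)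
    (hI : ∀ i ∈ bits h, ∀ j ∈ bits h, i ≠ j → (conj (conjMul v w i) * conjMul v w j).re = 0) :
    mayBeImaginary h a b = true := by
  have hn : ∀ k, ‖conjMul v w k‖ = 1 := norm_conjMul hv hw
  rw [_root_.mayBeImaginary, andFast_eq, notFast_eq, notFast_eq, andFast_eq, Bool.and_eq_true,
    Bool.not_eq_true', Bool.not_eq_true', Bool.eq_false_iff, Bool.eq_false_iff]
  constructor
  · intro hr
    obtain ⟨i, hi, j, hj, hij, hr⟩ := ha.realRatio hb hr
    exact not_real_and_imag (norm_conj_mul (hn i) (hn j)) hr (hI i hi j hj hij)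
  · intro hx
    rw [Bool.and_eq_true, Nat.beq_eq, Nat.beq_eq, bitCount_eq (land_lt_left hh), bits_land] at hx
    obtain ⟨i, hi⟩ := Finset.card_eq_one.mp hx.1
    have hi' : i ∈ bits h ∩ bits (genericProd a b) := by rw [hi]; simp
    rw [Finset.mem_inter] at hi'
    obtain ⟨j, hj, hji⟩ := Finset.exists_mem_ne (by omega : 1 < (bits h).card) i
    have hjx : j ∉ bits (genericProd a b) := by
      intro hx
      have : j ∈ bits h ∩ bits (genericProd a b) := Finset.mem_inter.mpr ⟨hj, hx⟩
      rw [hi, Finset.mem_singleton] at this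
      exact hji this
    have hju : j ∉ bits (unknownProd a b) := by
      intro hu
      have : j ∈ bits (Nat.land h (unknownProd a b)) := by rw [bits_land]; exact Finset.mem_inter.mpr ⟨hj, hu⟩
      rw [hx.2] at this
      simp [mem_bits] at this
    have hx' := ha.ne_zero_of_mem_genericProd hb hv hw hi'.2
    have h0 := hI i hi'.1 j hj hji.symm
    rw [Complex.mul_re, Complex.conj_re, Complex.conj_im] at h0
    rw [mem_genericProd] at hjx
    by_cases hz : j ∈ bits (realProd a b)
    · have him := ha.im_conjMul hb hz
      rw [him] at h0
      have hre : (conjMul v w j).re ≠ 0 := fun h => not_real_and_imag (hn j) him h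
      have : (conjMul v w i).re * (conjMul v w j).re = 0 := by linarith
      rcases mul_eq_zero.mp this with h | h
      exacts [hx'.2 h, hre h]
    · have hre := ha.re_conjMul hb (by tauto : j ∈ bits (imagProd a b))
      rw [hre] at h0
      have him : (conjMul v w j).im ≠ 0 := fun h => not_real_and_imag (hn j) h hre
      have : (conjMul v w i).im * (conjMul v w j).im = 0 := by linarith
      rcases mul_eq_zero.mp this with h | h
      exacts [hx'.1 h, him h]

/-- With three known real products and one unknown, a non-real unknown would leave exactly three
non-real terms. -/
theorem Encodes.forcedReal {v w : Fin 6 → ℂ} {a b : ℕ} (ha : Encodes v a) (hb : Encodes w b)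
    (hv : ∀ k, ‖v k‖ = 1) (hw : ∀ k, ‖w k‖ = 1) (h0 : ∑ k, conjMul v w k = 0) {k : Fin 6}
    (hk : k ∈ bits (forcedReal a b)) : (conjMul v w k).im = 0 := by
  rw [_root_.forcedReal, condFast_eq, andFast_eq] at hk
  split_ifs at hk with h
  · rw [bits_lor, Finset.mem_union] at hk
    rcases hk with hk | hk
    · exact ha.im_conjMul hb hk
    · by_contra hne
      rw [Bool.and_eq_true, Nat.beq_eq, Nat.beq_eq] at h
      have h3 := nonrealCount_six_ne_three (norm_conjMul hv hw) h0
      rw [bitCount_eq (realProd_lt hb.lt), bitCount_eq (unknownProd_lt hb.lt)] at h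
      obtain ⟨x, hx⟩ := Finset.card_eq_one.mp h.2
      have hset : nonrealSet (conjMul v w) = (bits (realProd a b))ᶜ := by
        ext j
        rw [mem_nonrealSet, Finset.mem_compl]
        constructor
        · exact fun hj hz => hj (ha.im_conjMul hb hz)
        · intro hz
          by_cases hu : j ∈ bits (unknownProd a b)
          · rw [hx, Finset.mem_singleton] at hu hk
            rw [hu, ← hk]; exact hne
          · by_cases hi : j ∈ bits (imagProd a b)
            · exact fun h => not_real_and_imag (norm_conjMul hv hw j) h (ha.re_conjMul hb hi)
            · exact (ha.ne_zero_of_mem_genericProd hb hv hw (mem_genericProd.mpr ⟨hz, hi, hu⟩)).1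
      apply h3
      rw [nonrealCount, hset, Finset.card_compl, h.1]; rfl
  · exact ha.im_conjMul hb hk

theorem forcedReal_lt {a b : ℕ} (hb : b < 4096) : forcedReal a b < 64 := by
  rw [forcedReal, condFast_eq]
  split_ifs
  exacts [lor_lt (realProd_lt hb) (unknownProd_lt hb), realProd_lt hb]

theorem anyFast_range {n : ℕ} {p : ℕ → Bool} : anyFast (List.range n) p = true ↔ ∃ h < n, p h = true := by
  rw [anyFast_eq, List.any_eq_true]
  simp

/-- Once four products are forced to be real, at most two are non-real, and one is impossible. No
non-real product leads to `exists_halves`; two lead to `exists_split`, and then the forced positions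
are exactly the real ones. -/
theorem IsComplexHadamard.splitOk {H : Matrix (Fin 6) (Fin 6) ℂ} (hH : IsComplexHadamard H)
    {code : Fin 6 → ℕ} (hc : ∀ i, Encodes (H i) (code i)) {i j : Fin 6} (hij : i ≠ j) {others : List ℕ}
    (ho : ∀ m ∈ others, ∃ k, k ≠ i ∧ k ≠ j ∧ code k = m) : splitOk (code i) (code j) others = true := by
  set v := conjMul (H i) (H j) with hv
  set R := forcedReal (code i) (code j) with hR
  have hR64 : R < 64 := forcedReal_lt (hc j).lt
  have hRre : ∀ k ∈ bits R, (v k).im = 0 := fun k hk =>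
    (hc i).forcedReal (hc j) (hH.2 i) (hH.2 j) (hH.sum_conjMul hij) hk
  have hvn : ∀ k, ‖v k‖ = 1 := hH.norm_conjMul i j
  have hsub : nonrealSet v ⊆ (bits R)ᶜ := fun k hk => by
    rw [Finset.mem_compl]; exact fun h => mem_nonrealSet.mp hk (hRre k h)
  rw [_root_.splitOk, ← hR, orFast_eq, orFast_eq, andFast_eq, Bool.or_eq_true, Bool.or_eq_true, Bool.and_eq_true,
    Nat.ble_eq, Nat.beq_eq, bitCount_eq hR64]
  by_cases h3 : (bits R).card ≤ 3
  · exact Or.inl (Or.inl h3)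
  have hle := Finset.card_le_card hsub
  rw [Finset.card_compl, Fintype.card_fin, card_nonrealSet] at hle
  have hne1 := nonrealCount_ne_one (hH.sum_conjMul hij)
  rw [← hv] at hne1
  rcases Nat.eq_zero_or_pos (nonrealCount v) with h0 | hpos
  · have hreal : ∀ k, (v k).im = 0 := fun k => by
      by_contra hk
      exact (Finset.eq_empty_iff_forall_notMem.mp (Finset.card_eq_zero.mp h0) k) (mem_nonrealSet.mpr hk)
    refine Or.inl (Or.inr ⟨?_, ?_⟩)
    · apply bits_injective (land_lt (unknownProd_lt (hc j).lt)) (xor_lt (by norm_num) hR64)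
      rw [bits_land, bits_xor, Finset.inter_eq_left]
      intro k hk
      by_contra hu
      rw [Finset.mem_compl] at hk
      have hz : k ∉ bits (realProd (code i) (code j)) := fun hz => hk (by
        rw [hR, forcedReal, condFast_eq]
        split_ifs
        · rw [bits_lor]; exact Finset.mem_union_left _ hz
        · exact hz)
      have hi : k ∉ bits (imagProd (code i) (code j)) := fun hi =>
        Encodes.not_real_and_imag (hvn k) (hreal k) ((hc i).re_conjMul (hc j) hi)
      exact ((hc i).ne_zero_of_mem_genericProd (hc j) (hH.2 i) (hH.2 j)
        (Encodes.mem_genericProd.mpr ⟨hz, hi, hu⟩)).1 (hreal k)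
    · obtain ⟨t, ht, -, hs⟩ := hH.exists_halves hij hreal
      obtain ⟨h, hh, rfl⟩ := exists_bits_eq t
      rw [halvesOk, anyFast_range]
      refine ⟨h, hh, ?_⟩
      rw [andFast_eq, Bool.and_eq_true, Nat.beq_eq, bitCount_eq hh, allFast_eq, List.all_eq_true]
      refine ⟨ht, fun m hm => ?_⟩
      obtain ⟨k, hki, hkj, rfl⟩ := ho m hm
      rw [andFast_eq, notFast_eq, notFast_eq, Bool.and_eq_true, Bool.not_eq_true', Bool.not_eq_true',
        Bool.eq_false_iff, Bool.eq_false_iff]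
      refine ⟨fun hr => (hs k hki hkj).1 ((hc i).realRatio (hc k) hr), fun hr => (hs k hki hkj).2 ?_⟩
      rw [← bits_xor]
      exact (hc i).realRatio (hc k) hr
  · have h2 : nonrealCount v = 2 := by omega
    have hRc : (bits R).card = 4 := by omega
    refine Or.inr ?_
    have hRset : (nonrealSet v)ᶜ = bits R := by
      rw [Finset.eq_of_subset_of_card_le hsub (by rw [Finset.card_compl, hRc, card_nonrealSet, h2]; rfl), compl_compl]
    obtain ⟨t, u, ht, hu, htu, hcup, -, -, hs⟩ := hH.exists_split hij h2
    rw [← hv, hRset] at hcup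
    obtain ⟨h, hh, rfl⟩ := exists_bits_eq t
    have hhR : h &&& R = h := by
      apply bits_injective (land_lt hR64) hh
      rw [bits_land, Finset.inter_eq_left, hcup]
      exact Finset.subset_union_left
    have hbu : bits (Nat.xor R h) = u := by
      ext k
      have hk : k ∈ bits R ↔ k ∈ bits h ∨ k ∈ u := by rw [hcup, Finset.mem_union]
      have hd : k ∈ bits h → k ∉ u := fun h1 h2 => Finset.disjoint_left.mp htu h1 h2
      rw [mem_bits]
      change (R ^^^ h).testBit k = true ↔ _
      rw [Nat.testBit_xor]
      rw [mem_bits, mem_bits] at hk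
      rw [mem_bits] at hd
      cases hb : R.testBit k <;> cases hb' : h.testBit k <;> simp [hb, hb'] at hk hd ⊢ <;> assumption
    rw [fourOk, andFast_eq, Bool.and_eq_true, Nat.beq_eq, bitCount_eq hR64, anyFast_range]
    refine ⟨hRc, h, hh, ?_⟩
    rw [andFast_eq, andFast_eq, Bool.and_eq_true, Bool.and_eq_true, Nat.beq_eq, Nat.beq_eq, bitCount_eq hh,
      allFast_eq, List.all_eq_true]
    refine ⟨⟨ht, hhR⟩, fun m hm => ?_⟩
    obtain ⟨k, hki, hkj, rfl⟩ := ho m hm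
    have key : ∀ {x y : ℕ}, y < 64 → (bits y).card = 2 →
        (RealRatio (conjMul (H i) (H k)) (bits x) → (∀ r ∈ bits y, ∀ s ∈ bits y, r ≠ s →
          (conj (conjMul (H i) (H k) r) * conjMul (H i) (H k) s).re = 0) ∧
          ∀ p ∈ nonrealSet v, (v p).re = 0) →
        (notFast (hasRealRatio x (code i) (code k)) ⋎
          (Nat.beq (Nat.land (Nat.xor 63 R) (genericProd (code i) (code j))) 0 ⋏
            mayBeImaginary y (code i) (code k))) = true := by
      intro x y hy hy2 hxy
      rw [orFast_eq, notFast_eq, andFast_eq, Bool.or_eq_true, Bool.and_eq_true, Bool.not_eq_true', Bool.eq_false_iff]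
      by_cases hx : hasRealRatio x (code i) (code k) = true
      · obtain ⟨h1, h2⟩ := hxy ((hc i).realRatio (hc k) hx)
        refine Or.inr ⟨?_, (hc i).mayBeImaginary (hc k) (hH.2 i) (hH.2 k) hy hy2 h1⟩
        rw [Nat.beq_eq]
        apply bits_injective (land_lt (genericProd_lt (hc j).lt)) (by norm_num)
        rw [bits_land, bits_xor, ← hRset, compl_compl]
        ext p
        rw [Finset.mem_inter, mem_bits (m := 0)]
        simp only [Nat.zero_testBit, Bool.false_eq_true, iff_false, not_and]
        intro hp hg
        exact ((hc i).ne_zero_of_mem_genericProd (hc j) (hH.2 i) (hH.2 j) hg).2 (h2 p hp)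
      · exact Or.inl hx
    rw [splitCompatible, andFast_eq, Bool.and_eq_true]
    constructor
    · exact key (xor_lt hR64 hh) (by rw [hbu, hu]) (by rw [hbu]; exact (hs k hki hkj).1)
    · exact key hh ht (by rw [hbu]; exact (hs k hki hkj).2)


/-! ### Soundness of the tests on whole matrices -/

theorem anyFast_iff {l : List ℕ} {p : ℕ → Bool} : anyFast l p = true ↔ ∃ a ∈ l, p a = true := by
  rw [anyFast_eq, List.any_eq_true]

theorem entry_map {l : List (Fin 6)} (code : Fin 6 → ℕ) {k : ℕ} (hk : k < l.length) :
    entry (l.map code) k = code l[k] := by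
  rw [entry_eq, List.getD_eq_getElem _ _ (by simpa using hk), List.getElem_map]

theorem IsComplexHadamard.splitsOk {H : Matrix (Fin 6) (Fin 6) ℂ} (hH : IsComplexHadamard H)
    {code : Fin 6 → ℕ} (hc : ∀ i, Encodes (H i) (code i)) {l : List (Fin 6)} (hl : l.Nodup) :
    splitsOk (l.map code) = true := by
  have hne : ∀ {i j : ℕ} (hi : i < l.length) (hj : j < l.length), i ≠ j → l[i] ≠ l[j] :=
    fun hi hj hij h => hij ((hl.getElem_inj_iff).mp h)
  rw [_root_.splitsOk, allFast_eq, List.all_eq_true]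
  intro i hi
  rw [List.mem_range, List.length_map] at hi
  rw [allFast_eq, List.all_eq_true]
  intro j hj
  rw [List.mem_range, List.length_map] at hj
  rw [orFast_eq, Bool.or_eq_true, Nat.ble_eq]
  by_cases hij : j ≤ i
  · exact Or.inl hij
  · rw [entry_map code hi, entry_map code hj]
    refine Or.inr (hH.splitOk hc (hne hi hj (by omega)) fun m hm => ?_)
    rw [filterFast_eq, List.mem_map] at hm
    obtain ⟨k, hk, rfl⟩ := hm
    rw [List.mem_filter, List.mem_range, List.length_map, andFast_eq, notFast_eq, notFast_eq, Bool.and_eq_true,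
      Bool.not_eq_true', Bool.not_eq_true', Bool.eq_false_iff, Bool.eq_false_iff, Ne, Ne, Nat.beq_eq, Nat.beq_eq] at hk
    exact ⟨l[k]'hk.1, hne hk.1 hi hk.2.1, hne hk.1 hj hk.2.2, (entry_map code hk.1).symm⟩

theorem pairsOk_cons (a : ℕ) (r : List ℕ) : pairsOk (a :: r) = (r.all (pairOk a) && pairsOk r) := by
  rw [← andFast_eq, ← allFast_eq]; rfl

theorem IsComplexHadamard.pairOk {H : Matrix (Fin 6) (Fin 6) ℂ} (hH : IsComplexHadamard H)
    {code : Fin 6 → ℕ} (hc : ∀ i, Encodes (H i) (code i)) {i j : Fin 6} (hij : i ≠ j) :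
    pairOk (code i) (code j) = true :=
  (hc i).pairOk (hc j) (hH.2 i) (hH.2 j) (hH.sum_conjMul hij)

theorem IsComplexHadamard.pairsOk {H : Matrix (Fin 6) (Fin 6) ℂ} (hH : IsComplexHadamard H)
    {code : Fin 6 → ℕ} (hc : ∀ i, Encodes (H i) (code i)) {l : List (Fin 6)} (hl : l.Nodup) :
    pairsOk (l.map code) = true := by
  induction l with
  | nil => rfl
  | cons a l ih =>
    rw [List.nodup_cons] at hl
    rw [List.map_cons, pairsOk_cons, Bool.and_eq_true, List.all_eq_true]
    refine ⟨fun m hm => ?_, ih hl.2⟩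
    obtain ⟨k, hk, rfl⟩ := List.mem_map.mp hm
    exact hH.pairOk hc fun h => hl.1 (h ▸ hk)

namespace Encodes

variable {v w : Fin 6 → ℂ} {a b : ℕ}

theorem nonrealCount_add_le (ha : Encodes v a) (hb : Encodes w b) :
    nonrealCount (conjMul v w) + bitCount (realProd a b) ≤ 6 := by
  rw [bitCount_eq (realProd_lt hb.lt), nonrealCount, ← Finset.card_union_of_disjoint]
  · exact (Finset.card_le_univ _).trans (by simp)
  · rw [Finset.disjoint_left]
    exact fun k hk hk' => mem_nonrealSet.mp hk (ha.im_conjMul hb hk')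

theorem im_ne_zero (ha : Encodes v a) (hb : Encodes w b) (hv : ∀ k, ‖v k‖ = 1) (hw : ∀ k, ‖w k‖ = 1)
    {k : Fin 6} (h : k ∈ bits (imagProd a b) ∪ bits (genericProd a b)) : (conjMul v w k).im ≠ 0 := by
  rcases Finset.mem_union.mp h with h | h
  · exact fun him => not_real_and_imag (norm_conjMul hv hw k) him (ha.re_conjMul hb h)
  · exact (ha.ne_zero_of_mem_genericProd hb hv hw h).1

end Encodes

theorem exists_mem_bits {m : ℕ} (hm : m < 64) (h : m ≠ 0) : ∃ k, k ∈ bits m := by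
  by_contra hc
  push Not at hc
  apply h
  apply bits_injective hm (by norm_num)
  ext k
  simp [hc k, mem_bits (m := 0)]

namespace IsComplexHadamard

variable {H : Matrix (Fin 6) (Fin 6) ℂ} {code ccode : Fin 6 → ℕ}

theorem triangle (hH : IsComplexHadamard H) (hc : ∀ i, Encodes (H i) (code i)) (l : List (Fin 6)) :
    triangle (l.map code) = false := by
  rw [Bool.eq_false_iff]
  intro h
  rw [_root_.triangle, anyFast_iff] at h
  obtain ⟨_, ha, h⟩ := h
  obtain ⟨i, -, rfl⟩ := List.mem_map.mp ha
  rw [andFast_eq, Bool.and_eq_true, anyFast_iff] at h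
  obtain ⟨-, _, ha, h⟩ := h
  obtain ⟨j, -, rfl⟩ := List.mem_map.mp ha
  rw [andFast_eq, andFast_eq, Bool.and_eq_true, Bool.and_eq_true, anyFast_iff] at h
  obtain ⟨⟨hij3, -⟩, _, ha, h⟩ := h
  obtain ⟨k, -, rfl⟩ := List.mem_map.mp ha
  simp only [andFast_eq, notFast_eq, Bool.and_eq_true, Bool.not_eq_true', Bool.eq_false_iff, ne_eq, Nat.beq_eq,
    Nat.ble_eq] at h hij3
  obtain ⟨⟨⟨⟨h1, h2⟩, h3⟩, hjk3⟩, hik3⟩ := h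
  obtain ⟨p, hp⟩ := exists_mem_bits (land_lt (realMask_lt _)) h1
  obtain ⟨q, hq⟩ := exists_mem_bits (land_lt (realMask_lt _)) h2
  obtain ⟨s, hs⟩ := exists_mem_bits (land_lt (nonrealMask_lt _)) h3
  simp only [bits_land, Finset.mem_inter, (hc _).mem_genericMask, (hc _).real, (hc _).bits_nonrealMask,
    mem_nonrealSet] at hp hq hs
  obtain ⟨⟨⟨hpi, hpi'⟩, hpj⟩, hpk⟩ := hp
  obtain ⟨⟨hqi, hqj⟩, hqk⟩ := hq
  obtain ⟨⟨hsi, hsj⟩, hsk⟩ := hs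
  have hij : i ≠ j := by rintro rfl; exact hpi hpj
  have hik : i ≠ k := by rintro rfl; exact hpi hpk
  have hjk : j ≠ k := by rintro rfl; exact hqj hqk
  have hpq : p ≠ q := by rintro rfl; exact hpi hqi
  have hps : p ≠ s := by rintro rfl; exact hpi hsi
  have hqs : q ≠ s := by rintro rfl; exact hqj hsj
  have e1 := (hc i).nonrealCount_add_le (hc j)
  have e2 := (hc j).nonrealCount_add_le (hc k)
  have e3 := (hc i).nonrealCount_add_le (hc k)
  refine hH.false_of_triangle hpi hpi' (hH.im_mul_eq_zero hij hpq (by omega) hpi hpj hqi hqj)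
    (hH.im_mul_eq_zero hjk hqs (by omega) hqj hqk hsj hsk) ?_
  rw [mul_comm]
  exact hH.im_mul_eq_zero hik hps (by omega) hpi hpk hsi hsk

theorem entry_finRange (code : Fin 6 → ℕ) (i : ℕ) (hi : i < 6) :
    entry ((List.finRange 6).map code) i = code ⟨i, hi⟩ := by
  rw [entry_map code (by simpa using hi)]
  congr 1
  exact Fin.ext (by simp)

theorem rectangle (hH : IsComplexHadamard H) (hc : ∀ i, Encodes (H i) (code i))
    (hcc : ∀ j, Encodes (H.transpose j) (ccode j)) :
    rectangle ((List.finRange 6).map code) ((List.finRange 6).map ccode) = false := by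
  rw [Bool.eq_false_iff]
  intro h
  simp only [_root_.rectangle, anyFast_range, andFast_eq, Bool.and_eq_true, Nat.ble_eq, Nat.beq_eq] at h
  obtain ⟨a, ha, b, hb, ⟨hab, -⟩, p, hp, q, hq, ⟨⟨hpq, h1⟩, h2⟩, h3⟩ := h
  rw [entry_finRange _ _ ha, entry_finRange _ _ hb] at h1
  rw [entry_finRange _ _ hp, entry_finRange _ _ hq] at h2 h3
  have hab' : (⟨a, ha⟩ : Fin 6) ≠ ⟨b, hb⟩ := by rw [Ne, Fin.ext_iff]; dsimp only; omega
  have hpq' : (⟨p, hp⟩ : Fin 6) ≠ ⟨q, hq⟩ := by rw [Ne, Fin.ext_iff]; dsimp only; omega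
  have e1 : ∀ x (hx : x < 6), bits (Nat.shiftLeft 1 x) = {⟨x, hx⟩} := fun x hx => bits_shiftLeft_one ⟨x, hx⟩
  have s1 : ∀ x, x < 6 → Nat.shiftLeft 1 x < 64 := by decide
  generalize hP : ccode ⟨p, hp⟩ = cp at h2 h3
  generalize hQ : ccode ⟨q, hq⟩ = cq at h2 h3
  have cP : Encodes (H.transpose ⟨p, hp⟩) cp := hP ▸ hcc _
  have cQ : Encodes (H.transpose ⟨q, hq⟩) cq := hQ ▸ hcc _
  rw [bitCount_eq (land_lt_left (realProd_lt cQ.lt)), bits_land, bits_xor, bits_lor, e1 a ha, e1 b hb] at h2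
  rw [bitCount_eq (land_lt_left (lor_lt (imagProd_lt cQ.lt) (genericProd_lt cQ.lt))), bits_land, bits_lor, bits_xor,
    bits_lor, e1 a ha, e1 b hb] at h3
  have hu := congrArg bits h1
  rw [bits_lor, bits_lor, e1 p hp, e1 q hq] at hu
  obtain ⟨i, hi⟩ := Finset.card_eq_one.mp h3
  have hi' : i ∈ (bits (imagProd cp cq) ∪ bits (genericProd cp cq)) ∩ ({⟨a, ha⟩} ∪ {⟨b, hb⟩})ᶜ := by rw [hi]; simp
  rw [Finset.mem_inter, Finset.mem_compl, Finset.mem_union (s := {_}), Finset.mem_singleton, Finset.mem_singleton,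
    not_or] at hi'
  have him := cP.im_ne_zero cQ (hH.transpose.2 _) (hH.transpose.2 _) hi'.1
  refine hH.false_of_rectangle hab' hpq' ?_ hi'.2.1 hi'.2.2 him ?_
  · intro k hkp hkq
    apply (hc _).im_conjMul (hc _)
    have : k ∈ bits 63 := by rw [mem_bits]; exact testBit_sixty_three k
    rw [← hu] at this
    simpa [hkp, hkq] using this
  · intro k hki hka hkb
    -- Outside rows `a` and `b` there are four positions: the three known real ones and `i`. So
    -- every other one is real.
    have hsub : insert i (bits (realProd cp cq) ∩ ({⟨a, ha⟩} ∪ {⟨b, hb⟩})ᶜ) ⊆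
        ({⟨a, ha⟩} ∪ {⟨b, hb⟩} : Finset (Fin 6))ᶜ := by
      apply Finset.insert_subset
      · simp [hi'.2.1, hi'.2.2]
      · exact Finset.inter_subset_right
    have hcard : (({⟨a, ha⟩} ∪ {⟨b, hb⟩} : Finset (Fin 6))ᶜ).card = 4 := by
      rw [Finset.card_compl, Finset.card_union_of_disjoint (by simpa using hab')]; rfl
    have hins : i ∉ bits (realProd cp cq) ∩ ({⟨a, ha⟩} ∪ {⟨b, hb⟩})ᶜ := fun h =>
      him (cP.im_conjMul cQ (Finset.mem_inter.mp h).1)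
    have heq := Finset.eq_of_subset_of_card_le hsub (by rw [hcard, Finset.card_insert_of_notMem hins, h2])
    have hk : k ∈ ({⟨a, ha⟩} ∪ {⟨b, hb⟩} : Finset (Fin 6))ᶜ := by simp [hka, hkb]
    rw [← heq, Finset.mem_insert] at hk
    exact cP.im_conjMul cQ (Finset.mem_inter.mp (hk.resolve_left hki)).1

end IsComplexHadamard


theorem bits_zero : bits 0 = ∅ := by decide

theorem exists_eq_pair_of_mem {s : Finset (Fin 6)} (hs : s.card = 2) {x : Fin 6} (hx : x ∈ s) :
    ∃ y, y ≠ x ∧ s = {x, y} := by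
  obtain ⟨y, hy⟩ : ∃ y, s.erase x = {y} := by
    rw [← Finset.card_eq_one, Finset.card_erase_of_mem hx, hs]
  have h := Finset.insert_erase hx
  rw [hy] at h
  refine ⟨y, ?_, h.symm⟩
  have : y ∈ s.erase x := by rw [hy]; simp
  exact (Finset.mem_erase.mp this).1

namespace IsComplexHadamard

variable {H : Matrix (Fin 6) (Fin 6) ℂ} {code ccode : Fin 6 → ℕ}

theorem path (hH : IsComplexHadamard H) (hc : ∀ i, Encodes (H i) (code i))
    (hcc : ∀ j, Encodes (H.transpose j) (ccode j)) :
    path ((List.finRange 6).map code) ((List.finRange 6).map ccode) = false := by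
  rw [Bool.eq_false_iff]
  intro h
  simp only [_root_.path, anyFast_range, andFast_eq, notFast_eq, Bool.and_eq_true, Nat.ble_eq, Nat.beq_eq,
    Bool.not_eq_true'] at h
  obtain ⟨a, ha, ⟨hA, hX⟩, b, hb, ⟨hB, hAB⟩, g, hg, hBG, t, ht, htA, w, hw, ⟨⟨⟨hwA, hG⟩, hun⟩, h3⟩, h2⟩ := h
  rw [entry_finRange _ _ ha] at hA hX hAB htA hwA
  rw [entry_finRange _ _ hb] at hB hBG hAB
  rw [entry_finRange _ _ hg] at hBG hG
  rw [entry_finRange _ _ ht, entry_finRange _ _ hw] at hun h3 h2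
  have cA := hc ⟨a, ha⟩
  have cB := hc ⟨b, hb⟩
  have cG := hc ⟨g, hg⟩
  have cT := hcc ⟨t, ht⟩
  have cW := hcc ⟨w, hw⟩
  rw [cA.bitCount_nonrealMask] at hA
  rw [cB.bitCount_nonrealMask] at hB
  rw [bitCount_eq (land_lt (nonrealMask_lt _)), bits_land, cA.bits_nonrealMask, cB.bits_nonrealMask] at hAB
  have hBG' := congrArg bits hBG
  rw [bits_land, cB.bits_nonrealMask, cG.bits_nonrealMask, bits_zero] at hBG'
  have hG' := congrArg bits hG
  rw [cG.bits_nonrealMask, bits_lor, bits_shiftLeft_one ⟨t, ht⟩, bits_shiftLeft_one ⟨w, hw⟩] at hG'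
  have hX' := congrArg bits hX
  rw [cA.bits_nonrealMask] at hX'
  have htA' : (⟨t, ht⟩ : Fin 6) ∈ nonrealSet (H ⟨a, ha⟩) := by rw [← cA.bits_nonrealMask, mem_bits]; exact htA
  have hwA' : (⟨w, hw⟩ : Fin 6) ∉ nonrealSet (H ⟨a, ha⟩) := by
    rw [← cA.bits_nonrealMask, mem_bits, Bool.not_eq_true]; exact hwA
  have hun' : (⟨g, hg⟩ : Fin 6) ∈ bits (unknownProd (ccode ⟨t, ht⟩) (ccode ⟨w, hw⟩)) := by rw [mem_bits]; exact hun
  rw [bitCount_eq (lor_lt (imagProd_lt cW.lt) (genericProd_lt cW.lt)), bits_lor] at h2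
  have hcount := cT.nonrealCount_add_le cW
  generalize (⟨a, ha⟩ : Fin 6) = a at *
  generalize (⟨b, hb⟩ : Fin 6) = b at *
  generalize (⟨g, hg⟩ : Fin 6) = g at *
  generalize (⟨t, ht⟩ : Fin 6) = t at *
  generalize (⟨w, hw⟩ : Fin 6) = w at *
  obtain ⟨s, hs⟩ := Finset.card_eq_one.mp hAB
  have hsAB : s ∈ nonrealSet (H a) ∩ nonrealSet (H b) := by rw [hs]; simp
  rw [Finset.mem_inter] at hsAB
  have htG : t ∈ nonrealSet (H g) := by rw [hG']; simp
  have hwG : w ∈ nonrealSet (H g) := by rw [hG']; simp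
  have hdisj : ∀ k, k ∈ nonrealSet (H b) → k ∉ nonrealSet (H g) := fun k h1 h2 => by
    have : k ∈ nonrealSet (H b) ∩ nonrealSet (H g) := Finset.mem_inter.mpr ⟨h1, h2⟩
    rw [hBG'] at this
    simp at this
  have htB : t ∉ nonrealSet (H b) := fun h => hdisj t h htG
  have hwB : w ∉ nonrealSet (H b) := fun h => hdisj w h hwG
  obtain ⟨u, hus, hBset⟩ := exists_eq_pair_of_mem hB hsAB.2
  obtain ⟨t', hts, hAset⟩ := exists_eq_pair_of_mem hA hsAB.1
  have hst : s ≠ t := by rintro rfl; exact htB hsAB.2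
  have htt : t' = t := by
    rw [hAset, Finset.mem_insert, Finset.mem_singleton] at htA'
    rcases htA' with h | h
    exacts [absurd h.symm hst, h.symm]
  subst htt
  have huB : u ∈ nonrealSet (H b) := by rw [hBset]; simp
  have huA : u ∉ nonrealSet (H a) := fun h => by
    have : u ∈ nonrealSet (H a) ∩ nonrealSet (H b) := Finset.mem_inter.mpr ⟨h, huB⟩
    rw [hs, Finset.mem_singleton] at this
    exact hus this
  have hut : u ≠ t' := by rintro rfl; exact htB huB
  have hsw : s ≠ w := by rintro rfl; exact hwA' hsAB.1
  have huw : u ≠ w := by rintro rfl; exact hwB huB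
  have htw : t' ≠ w := by rintro rfl; exact hwA' htA'
  have hab : a ≠ b := by rintro rfl; exact huA huB
  have hag : a ≠ g := by rintro rfl; exact hwA' hwG
  have hbg : b ≠ g := by rintro rfl; exact htB htG
  have hS4 : ({s, u, t', w} : Finset (Fin 6)).card = 4 := by
    rw [Finset.card_insert_of_notMem (by simp [hus.symm, hst, hsw]),
      Finset.card_insert_of_notMem (by simp [hut, huw]), Finset.card_pair htw]
  obtain ⟨p, q, hpq, hpqs⟩ := Finset.card_eq_two.mp
    (show ({s, u, t', w} : Finset (Fin 6))ᶜ.card = 2 by rw [Finset.card_compl, hS4]; rfl)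
  have hp : p ∈ ({s, u, t', w} : Finset (Fin 6))ᶜ := by rw [hpqs]; simp
  have hq : q ∈ ({s, u, t', w} : Finset (Fin 6))ᶜ := by rw [hpqs]; simp
  simp only [Finset.mem_compl, Finset.mem_insert, Finset.mem_singleton, not_or] at hp hq
  have hsum : ∀ f : Fin 6 → ℂ, ∑ k, f k = f s + f u + f t' + f w + f p + f q := by
    intro f
    rw [← Finset.sum_add_sum_compl {s, u, t', w}, hpqs, Finset.sum_pair hpq,
      Finset.sum_insert (by simp [hus.symm, hst, hsw]), Finset.sum_insert (by simp [hut, huw]), Finset.sum_pair htw]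
    ring
  have hre : ∀ k ∈ nonrealSet (H a), (H a k).re ≠ 0 := fun k hk => by
    rw [← hX'] at hk
    exact ((cA.mem_genericMask k).mp hk).2
  obtain ⟨x, hx, y, hy, hxy⟩ := Finset.one_lt_card.mp h2
  have hgne : ∀ z ∈ bits (imagProd (ccode t') (ccode w)) ∪ bits (genericProd (ccode t') (ccode w)), g ≠ z := by
    rintro z hz rfl
    rw [Finset.mem_union, Encodes.mem_genericProd] at hz
    rcases hz with hz | hz
    · rw [cT.mem_unknownProd cW] at hun'
      rw [imagProd, bits_lor, bits_land, bits_land] at hz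
      simp only [Finset.mem_union, Finset.mem_inter, cT.real, cT.imag, cW.real, cW.imag] at hz
      tauto
    · exact hz.2.2 hun'
  -- Columns `t'` and `w` have at least three real products and two known non-real ones away from
  -- `g`, so their product in row `g` is real although the labels leave it open.
  have hgw : (conj (H g t') * H g w).im = 0 :=
    hH.transpose.im_conjMul_eq_zero htw hxy (by omega) (cT.im_ne_zero cW (hH.transpose.2 _) (hH.transpose.2 _) hx)
      (cT.im_ne_zero cW (hH.transpose.2 _) (hH.transpose.2 _) hy) (hgne x hx) (hgne y hy)
  have hle : ∀ {i j : Fin 6} {S : Finset (Fin 6)}, S.card ≤ 3 → nonrealSet (H i) ⊆ S → nonrealSet (H j) ⊆ S →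
      nonrealCount (conjMul (H i) (H j)) ≤ 3 := by
    intro i j S hS hi hj
    refine (Finset.card_le_card fun k hk => ?_).trans hS
    by_contra hkS
    refine mem_nonrealSet.mp hk (im_conj_mul_eq_zero ?_ ?_)
    · by_contra h; exact hkS (hi (mem_nonrealSet.mpr h))
    · by_contra h; exact hkS (hj (mem_nonrealSet.mpr h))
  exact hH.false_of_path hab hag hbg hsum hst hut hsw hpq hAset hBset hG' hus.symm huw htw hp.1 hp.2.1 hp.2.2.1
    hp.2.2.2 hq.1 hq.2.1 hq.2.2.1 hq.2.2.2 (hre s hsAB.1) (hre t' htA') hgw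
    (hle (S := {s, u, t'}) Finset.card_le_three (by rw [hAset]; intro k; simp; tauto)
      (by rw [hBset]; intro k; simp; tauto))
    (hle (S := {s, t', w}) Finset.card_le_three (by rw [hAset]; intro k; simp; tauto)
      (by rw [hG']; intro k; simp; tauto))

end IsComplexHadamard

theorem mem_singleMask {code : Fin 6 → ℕ} {l : List (Fin 6)} {k : Fin 6} (h : k ∈ bits (singleMask (l.map code))) :
    ∃ i, bitCount (nonrealMask (code i)) = 1 ∧ genericMask (code i) = 0 ∧ k ∈ bits (nonrealMask (code i)) := by
  induction l with
  | nil => exact absurd h (by change k ∉ bits 0; simp [bits_zero])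
  | cons a l ih =>
    change k ∈ bits (condFast (Nat.beq (bitCount (nonrealMask (code a))) 1 ⋏ Nat.beq (genericMask (code a)) 0)
      (Nat.lor (nonrealMask (code a)) (singleMask (l.map code))) (singleMask (l.map code))) at h
    rw [condFast_eq, andFast_eq] at h
    split_ifs at h with h1
    · rw [bits_lor, Finset.mem_union] at h
      rw [Bool.and_eq_true, Nat.beq_eq, Nat.beq_eq] at h1
      rcases h with h | h
      exacts [⟨a, h1.1, h1.2, h⟩, ih h]
    · exact ih h

theorem singleMask_lt (r : List ℕ) : singleMask r < 64 := by
  induction r with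
  | nil => change 0 < 64; norm_num
  | cons a r ih =>
    change condFast (Nat.beq (bitCount (nonrealMask a)) 1 ⋏ Nat.beq (genericMask a) 0)
      (Nat.lor (nonrealMask a) (singleMask r)) (singleMask r) < 64
    rw [condFast_eq]
    split_ifs
    exacts [lor_lt (nonrealMask_lt a) ih, ih]

theorem re_eq_zero_of_genericMask {v : Fin 6 → ℂ} {a : ℕ} (ha : Encodes v a) (h : genericMask a = 0) {k : Fin 6}
    (hk : (v k).im ≠ 0) : (v k).re = 0 := by
  by_contra hre
  have := (ha.mem_genericMask k).mpr ⟨hk, hre⟩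
  rw [h, bits_zero] at this
  simp at this

theorem IsComplexHadamard.fourImaginary {H : Matrix (Fin 6) (Fin 6) ℂ} {code : Fin 6 → ℕ} (hH : IsComplexHadamard H) (hc : ∀ i, Encodes (H i) (code i)) (l : List (Fin 6)) :
    fourImaginary (l.map code) = false := by
  rw [Bool.eq_false_iff]
  intro h
  simp only [_root_.fourImaginary, andFast_eq, anyFast_iff, Bool.and_eq_true, Nat.ble_eq, Nat.beq_eq] at h
  obtain ⟨h4, _, he, ⟨he3, heX⟩, he2⟩ := h
  obtain ⟨e, -, rfl⟩ := List.mem_map.mp he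
  rw [bitCount_eq (singleMask_lt _)] at h4
  rw [bitCount_eq (land_lt (singleMask_lt _)), bits_land] at he2
  rw [bitCount_eq (nonrealMask_lt _)] at he3
  rw [(hc e).bits_nonrealMask] at he2 he3
  set S := bits (singleMask (l.map code)) with hS
  set E := nonrealSet (H e) with hE
  have hSE := Finset.card_sdiff_add_card_inter S E
  have hES := Finset.card_sdiff_add_card_inter E S
  rw [Finset.inter_comm, he2] at hSE
  rw [he2] at hES
  obtain ⟨c0, c1, h01, hI⟩ := Finset.card_eq_two.mp he2
  obtain ⟨c4, hE4⟩ := Finset.card_eq_one.mp (show (E \ S).card = 1 by omega)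
  obtain ⟨c2, hc2, c3, hc3, h23⟩ := Finset.one_lt_card.mp (show 1 < (S \ E).card by omega)
  have m0 : c0 ∈ E ∩ S := by rw [hI]; simp
  have m1 : c1 ∈ E ∩ S := by rw [hI]; simp
  have m4 : c4 ∈ E \ S := by rw [hE4]; simp
  rw [Finset.mem_inter] at m0 m1
  rw [Finset.mem_sdiff] at m4 hc2 hc3
  have hEset : ∀ k, k ∈ E ↔ k = c0 ∨ k = c1 ∨ k = c4 := fun k => by
    rw [← Finset.sdiff_union_inter E S, hI, hE4]; simp; tauto
  have h5 : ({c0, c1, c2, c3, c4} : Finset (Fin 6)).card < (Finset.univ : Finset (Fin 6)).card :=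
    lt_of_le_of_lt Finset.card_le_five (by simp)
  obtain ⟨c5, -, hc5⟩ := Finset.exists_mem_notMem_of_card_lt_card h5
  simp only [Finset.mem_insert, Finset.mem_singleton, not_or] at hc5
  have n02 : c0 ≠ c2 := by rintro rfl; exact hc2.2 m0.1
  have n03 : c0 ≠ c3 := by rintro rfl; exact hc3.2 m0.1
  have n04 : c0 ≠ c4 := by rintro rfl; exact m4.2 m0.2
  have n12 : c1 ≠ c2 := by rintro rfl; exact hc2.2 m1.1
  have n13 : c1 ≠ c3 := by rintro rfl; exact hc3.2 m1.1
  have n14 : c1 ≠ c4 := by rintro rfl; exact m4.2 m1.2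
  have n24 : c2 ≠ c4 := by rintro rfl; exact hc2.2 m4.1
  have n34 : c3 ≠ c4 := by rintro rfl; exact hc3.2 m4.1
  obtain ⟨n50, n51, n52, n53, n54⟩ := hc5
  -- Renumbering the columns: `c0, c1` are common to row `e` and the single entries, `c4` belongs to
  -- `e` only, `c2, c3` to single entries only, and `c5` is left over.
  have hinj : Function.Injective ![c0, c1, c2, c3, c4, c5] := by
    intro i j hij
    fin_cases i <;> fin_cases j <;> simp at hij ⊢ <;> first | exact absurd hij ‹_› | exact absurd hij.symm ‹_›
  have hbij := Finite.injective_iff_bijective.mp hinj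
  set c := ![c0, c1, c2, c3, c4, c5] with hcdef
  have hmemS : ∀ j : Fin 4, c (Fin.castLE (by decide) j) ∈ S := by
    intro j
    fin_cases j
    exacts [m0.2, m1.2, hc2.1, hc3.1]
  choose i hi1 hi2 hi3 using fun j => mem_singleMask (hmemS j)
  have hsingle : ∀ j k, (H (i j) k).im ≠ 0 ↔ k = c (Fin.castLE (by decide) j) := by
    intro j k
    have h1 := hi1 j
    rw [(hc _).bitCount_nonrealMask] at h1
    obtain ⟨x, hx⟩ := Finset.card_eq_one.mp h1
    have h3 := hi3 j
    rw [(hc _).bits_nonrealMask, hx, Finset.mem_singleton] at h3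
    rw [← mem_nonrealSet, hx, Finset.mem_singleton, h3]
  have hij : ∀ j k, j ≠ k → i j ≠ i k := by
    intro j k hjk hik
    have h1 := (hsingle j (c (Fin.castLE (by decide) j))).mpr rfl
    rw [hik, hsingle] at h1
    exact hjk (Fin.castLE_injective _ (hinj h1))
  have hie : ∀ j, i j ≠ e := by
    intro j h
    have h1 := hi1 j
    rw [h, (hc e).bitCount_nonrealMask] at h1
    rw [hE, card_nonrealSet] at he3
    omega
  have hcE : ∀ k : Fin 6, c k ∈ E ↔ k = 0 ∨ k = 1 ∨ k = 4 := by
    intro k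
    rw [hEset]
    constructor
    · rintro (h | h | h)
      · exact Or.inl (hinj (a₂ := 0) h)
      · exact Or.inr (Or.inl (hinj (a₂ := 1) h))
      · exact Or.inr (Or.inr (hinj (a₂ := 4) h))
    · rintro (rfl | rfl | rfl)
      exacts [Or.inl rfl, Or.inr (Or.inl rfl), Or.inr (Or.inr rfl)]
  refine false_of_four_imaginary (e := fun k => H e (c k)) (r := fun j k => H (i j) (c k)) (fun k => hH.2 _ _)
    (fun j k => hH.2 _ _) ?_ ?_ ?_ ?_ ?_ ?_
  · intro k hk
    exact re_eq_zero_of_genericMask (hc e) heX (mem_nonrealSet.mp ((hcE k).mpr hk))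
  · intro k hk
    by_contra him
    exact hk ((hcE k).mp (mem_nonrealSet.mpr him))
  · intro j k hk
    exact re_eq_zero_of_genericMask (hc _) (hi2 j) ((hsingle j _).mpr (by rw [hk]))
  · intro j k hk
    by_contra him
    exact hk (hinj ((hsingle j _).mp him))
  · intro j
    rw [hbij.sum_comp fun k => conj (H (i j) k) * H e k]
    exact hH.row_orth (hie j)
  · intro j k hjk
    rw [hbij.sum_comp fun x => conj (H (i j) x) * H (i k) x]
    exact hH.row_orth (hij j k hjk)


/-! ### Codes of the columns -/

theorem testBit_moveBit (m i k q : ℕ) : (Nat.shiftLeft (Nat.land (Nat.shiftRight m i) 1) k).testBit q =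
    (decide (q = k) && m.testBit i) := by
  change (((m >>> i) &&& 1) <<< k).testBit q = _
  rw [Nat.testBit_shiftLeft, Nat.testBit_and, Nat.testBit_shiftRight]
  by_cases h : q = k
  · subst h; simp
  · by_cases h' : q ≥ k
    · rw [Nat.testBit_one_eq_true_iff_self_eq_zero.not.mpr (by omega : q - k ≠ 0) |> Bool.eq_false_iff.mpr]
      simp [h]
    · simp [h, h']

theorem testBit_spread (m q : ℕ) : (spread m).testBit q =
    (List.range 6).any fun j => (decide (q = 12 * j) && m.testBit j) || (decide (q = 12 * j + 6) && m.testBit (j + 6)) := by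
  have h : ∀ l : List ℕ, (l.foldr (fun j acc => Nat.lor (Nat.lor
      (Nat.shiftLeft (Nat.land (Nat.shiftRight m j) 1) (Nat.mul 12 j))
      (Nat.shiftLeft (Nat.land (Nat.shiftRight m (Nat.add j 6)) 1) (Nat.add (Nat.mul 12 j) 6))) acc) 0).testBit q =
      l.any fun j => (decide (q = 12 * j) && m.testBit j) || (decide (q = 12 * j + 6) && m.testBit (j + 6)) := by
    intro l
    induction l with
    | nil => simp
    | cons j l ih =>
      rw [List.foldr_cons, List.any_cons, ← ih]
      change Nat.testBit (_ ||| _ ||| _) q = _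
      rw [Nat.testBit_or, Nat.testBit_or, testBit_moveBit, testBit_moveBit]
      rfl
  exact h _

/-- Digits of one row lie six apart and each later row is shifted by one, so at most six rows
interleave without collision. -/
theorem testBit_packedColumns (r : List ℕ) (a i : ℕ) (hi : i < 6) (hr : r.length ≤ 6) :
    (packedColumns r).testBit (6 * a + i) = (decide (i < r.length) && (spread (r.getD i 0)).testBit (6 * a)) := by
  induction r generalizing a i with
  | nil => change (0).testBit _ = _; simp
  | cons m r ih =>
    change (spread m ||| packedColumns r <<< 1).testBit (6 * a + i) = _
    rw [List.length_cons] at hr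
    rw [Nat.testBit_or, Nat.testBit_shiftLeft]
    rcases Nat.eq_zero_or_pos i with rfl | hpos
    · have h : (decide (6 * a + 0 ≥ 1) && (packedColumns r).testBit (6 * a + 0 - 1)) = false := by
        rcases Nat.eq_zero_or_pos a with rfl | ha
        · simp
        -- The shifted tail would need a sixth row to reach this place, but it has at most five.
        · rw [show 6 * a + 0 - 1 = 6 * (a - 1) + 5 by omega, ih _ _ (by norm_num) (by omega)]
          simp; omega
      rw [h]; simp
    · have h : (spread m).testBit (6 * a + i) = false := by
        rw [testBit_spread, List.any_eq_false]
        intro j _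
        simp
        constructor <;> intro h <;> omega
      rw [h, show 6 * a + i - 1 = 6 * a + (i - 1) by omega, ih _ _ (by omega) (by omega)]
      obtain ⟨k, rfl⟩ : ∃ k, i = k + 1 := ⟨i - 1, by omega⟩
      simp
      intro _ _; omega

theorem testBit_spread_real (m j : ℕ) (hj : j < 6) : (spread m).testBit (6 * (2 * j)) = m.testBit j := by
  rw [testBit_spread]
  interval_cases j <;> simp [List.range_succ]

theorem testBit_spread_imag (m j : ℕ) (hj : j < 6) :
    (spread m).testBit (6 * (2 * j + 1)) = m.testBit (j + 6) := by
  rw [testBit_spread]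
  interval_cases j <;> simp [List.range_succ]

theorem Encodes.testBit_real {v : Fin 6 → ℂ} {m : ℕ} (h : Encodes v m) (k : Fin 6) :
    m.testBit k = true ↔ (v k).im = 0 := by
  rw [← h.real, mem_bits]
  change _ ↔ (m &&& 63).testBit k = true
  rw [Nat.testBit_and, testBit_sixty_three, Bool.and_true]

theorem Encodes.testBit_imag {v : Fin 6 → ℂ} {m : ℕ} (h : Encodes v m) (k : Fin 6) :
    m.testBit (k + 6) = true ↔ (v k).re = 0 := by
  rw [← h.imag, mem_bits]
  change _ ↔ (m >>> 6).testBit k = true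
  rw [Nat.testBit_shiftRight, add_comm]

theorem encodes_of_testBit {v : Fin 6 → ℂ} {m : ℕ} (hm : m < 4096) (h1 : ∀ k : Fin 6, m.testBit k = true ↔ (v k).im = 0)
    (h2 : ∀ k : Fin 6, m.testBit (k + 6) = true ↔ (v k).re = 0) : Encodes v m := by
  refine ⟨hm, fun k => ?_, fun k => ?_⟩
  · rw [← h1, mem_bits]
    change (m &&& 63).testBit k = true ↔ _
    rw [Nat.testBit_and, testBit_sixty_three, Bool.and_true]
  · rw [← h2, mem_bits]
    change (m >>> 6).testBit k = true ↔ _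
    rw [Nat.testBit_shiftRight, add_comm]

theorem encodes_columnCode {H : Matrix (Fin 6) (Fin 6) ℂ} {code : Fin 6 → ℕ} (hc : ∀ i, Encodes (H i) (code i))
    (j : Fin 6) : Encodes (H.transpose j) (columnCode ((List.finRange 6).map code) j) := by
  have hlen : ((List.finRange 6).map code).length = 6 := by simp
  have hget : ∀ i : Fin 6, ((List.finRange 6).map code).getD i 0 = code i := fun i => by
    rw [← entry_eq, entry_map code (by simp)]
    congr 1
    exact Fin.ext (by simp)
  have hbit : ∀ q, q < 12 → (columnCode ((List.finRange 6).map code) j).testBit q =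
      (packedColumns ((List.finRange 6).map code)).testBit (12 * j + q) := by
    intro q hq
    change (_ >>> (12 * j.1) &&& (2 ^ 12 - 1)).testBit q = _
    rw [Nat.testBit_and, Nat.testBit_shiftRight, Nat.testBit_two_pow_sub_one]
    simp [hq]
  refine encodes_of_testBit (Nat.and_lt_two_pow (n := 12) _ (by norm_num)) (fun k => ?_) fun k => ?_
  · rw [hbit k (by omega), show 12 * j.1 + k.1 = 6 * (2 * j) + k by ring,
      testBit_packedColumns _ _ _ k.2 hlen.le, hget, hlen, testBit_spread_real _ _ j.2]
    simp only [k.2, decide_true, Bool.true_and, (hc k).testBit_real]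
    rfl
  · rw [hbit _ (by omega), show 12 * j.1 + (k.1 + 6) = 6 * (2 * j + 1) + k by ring,
      testBit_packedColumns _ _ _ k.2 hlen.le, hget, hlen, testBit_spread_imag _ _ j.2]
    simp only [k.2, decide_true, Bool.true_and, (hc k).testBit_imag]
    rfl

theorem columnCodes_eq (r : List ℕ) : columnCodes r = (List.finRange 6).map fun j : Fin 6 => columnCode r j := rfl

theorem IsComplexHadamard.excluded {H : Matrix (Fin 6) (Fin 6) ℂ} (hH : IsComplexHadamard H) {code : Fin 6 → ℕ}
    (hc : ∀ i, Encodes (H i) (code i)) :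
    excluded ((List.finRange 6).map code) (columnCodes ((List.finRange 6).map code)) = false := by
  have hcc := encodes_columnCode hc
  have hT := hH.transpose
  have nd := List.nodup_finRange 6
  rw [columnCodes_eq]
  simp only [_root_.excluded, orFast_eq, notFast_eq, hT.pairsOk hcc nd, hT.splitsOk hcc nd, hH.splitsOk hc nd,
    hH.triangle hc, hT.triangle hcc, hH.rectangle hc hcc, hT.rectangle hcc (fun j => hc j), hH.path hc hcc,
    hT.path hcc (fun j => hc j), hH.fourImaginary hc, hT.fourImaginary hcc, Bool.not_true, Bool.or_false]


/-! ### Soundness of the search -/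

theorem search_succ (N n s e : ℕ) (r cands : List ℕ) : search N (n + 1) s e r cands = cands.all fun m =>
    (!(Nat.ble (Nat.add s (Nat.mul (bitCount (nonrealMask m)) (n + 1))) N) ||
      !(Nat.beq (Nat.land e (greaterNext m)) 0) ||
      (Nat.ble 1 n && Nat.ble n 3 && !(splitsOk (m :: r))) ||
      search N n (Nat.add s (bitCount (nonrealMask m))) (Nat.land e (equalNext m)) (m :: r)
        (if Nat.beq n 0 then [] else cands.filter
          (mayFollow N n (Nat.add s (bitCount (nonrealMask m))) (Nat.land e (equalNext m)) m))) := by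
  rw [← allFast_eq]
  change allFast cands _ = allFast cands _
  refine congrArg _ (funext fun m => ?_)
  rw [← orFast_eq, ← orFast_eq, ← orFast_eq, ← notFast_eq, ← notFast_eq, ← notFast_eq, ← andFast_eq, ← andFast_eq,
    ← filterFast_eq, ← condFast_eq]
  rfl

/-- The search does not refute an ordered sequence of rows satisfying all conditions. -/
theorem search_eq_false {N : ℕ} {c S E : ℕ → ℕ} {r : ℕ → List ℕ}
    (hS0 : S 0 = 0) (hS : ∀ d, S (d + 1) = S d + bitCount (nonrealMask (c d)))
    (hE : ∀ d, E (d + 1) = Nat.land (E d) (equalNext (c d))) (hr : ∀ d, r (d + 1) = c d :: r d)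
    (hw : ∀ i j, i < j → j < 6 → bitCount (nonrealMask (c i)) ≤ bitCount (nonrealMask (c j)))
    (hkey : ∀ i j, i < j → j < 6 → rowKey (c i) ≤ rowKey (c j))
    (hpair : ∀ i j, i < j → j < 6 → pairOk (c i) (c j) = true)
    (hN : S 6 = N) (hcol : ∀ d < 6, Nat.land (E d) (greaterNext (c d)) = 0)
    (hsplit : ∀ d ≤ 6, splitsOk (r d) = true) (hex : excluded (r 6) (columnCodes (r 6)) = false) :
    ∀ n ≤ 6, ∀ cands : List ℕ, (∀ i, 6 - n ≤ i → i < 6 → c i ∈ cands) →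
      search N n (S (6 - n)) (E (6 - n)) (r (6 - n)) cands = false := by
  have hsum : ∀ d ≤ 6, S d + ∑ k ∈ Finset.Ico d 6, bitCount (nonrealMask (c k)) = N := by
    intro d hd
    have h1 : ∀ d, S d = ∑ k ∈ Finset.range d, bitCount (nonrealMask (c k)) := by
      intro d
      induction d with
      | zero => simpa using hS0
      | succ d ih => rw [hS, Finset.sum_range_succ, ih]
    rw [h1, Finset.sum_range_add_sum_Ico _ hd, ← h1, hN]
  have hbound : ∀ d s, s ⊆ Finset.Ico d 6 →
      s.card * bitCount (nonrealMask (c d)) ≤ ∑ k ∈ s, bitCount (nonrealMask (c k)) := by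
    intro d s hs
    rw [← smul_eq_mul]
    refine Finset.card_nsmul_le_sum s _ _ fun k hk => ?_
    have := Finset.mem_Ico.mp (hs hk)
    rcases Nat.eq_or_lt_of_le this.1 with rfl | h
    exacts [le_rfl, hw _ _ h this.2]
  intro n
  induction n with
  | zero => intro _ cands _; exact hex
  | succ n ih =>
    intro hn cands hc
    obtain ⟨d, hd⟩ : ∃ d, d + (n + 1) = 6 := ⟨6 - (n + 1), by omega⟩
    have e1 : 6 - (n + 1) = d := by omega
    have e2 : 6 - n = d + 1 := by omega
    rw [e1] at hc ⊢
    rw [e2] at ih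
    have h1 := hsum d (by omega)
    have h2 := hbound d _ (Finset.Subset.refl _)
    rw [Nat.card_Ico, show 6 - d = n + 1 by omega, mul_comm] at h2
    rw [search_succ, List.all_eq_false]
    refine ⟨c d, hc d le_rfl (by omega), ?_⟩
    rw [Bool.not_eq_true]
    -- The rows come with increasing numbers of non-real entries, so each of the `n + 1` missing
    -- rows has at least as many as the current one.
    have f1 : Nat.ble (Nat.add (S d) (Nat.mul (bitCount (nonrealMask (c d))) (n + 1))) N = true := by
      rw [Nat.ble_eq]
      change S d + bitCount (nonrealMask (c d)) * (n + 1) ≤ N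
      omega
    have f2 : Nat.beq (Nat.land (E d) (greaterNext (c d))) 0 = true := by rw [Nat.beq_eq]; exact hcol d (by omega)
    have f3 : splitsOk (c d :: r d) = true := by rw [← hr]; exact hsplit _ (by omega)
    rw [f1, f2, f3, ← hr, ← hE]
    simp only [Bool.not_true, Bool.and_false, Bool.or_false, Bool.false_or]
    have hadd : Nat.add (S d) (bitCount (nonrealMask (c d))) = S (d + 1) := (hS d).symm
    rw [hadd]
    apply ih (by omega)
    intro i hi1 hi2
    have hn0 : Nat.beq n 0 = false := by rw [Bool.eq_false_iff, Ne, Nat.beq_eq]; omega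
    rw [hn0]
    simp only [Bool.false_eq_true, if_false, List.mem_filter]
    refine ⟨hc i (by omega) hi2, ?_⟩
    rw [mayFollow, andFast_eq, andFast_eq, andFast_eq, Bool.and_eq_true, Bool.and_eq_true, Nat.ble_eq, condFast_eq]
    refine ⟨⟨hkey d i (by omega) hi2, ?_⟩, hpair d i (by omega) hi2⟩
    have h3 := hsum (d + 1) (by omega)
    have hmem : i ∈ Finset.Ico (d + 1) 6 := Finset.mem_Ico.mpr ⟨hi1, hi2⟩
    rw [← Finset.add_sum_erase _ _ hmem] at h3
    -- A single missing row must reach the total exactly. Otherwise the missing rows besides `c i`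
    -- contribute at least as much each as `c d`.
    split_ifs with hn1
    · rw [Nat.beq_eq] at hn1
      have hi : i = d + 1 := by omega
      rw [Bool.and_eq_true, Nat.beq_eq, Nat.beq_eq, hi]
      refine ⟨?_, hcol _ (by omega)⟩
      have hempty : (Finset.Ico (d + 1) 6).erase i = ∅ := by
        rw [← Finset.card_eq_zero, Finset.card_erase_of_mem hmem, Nat.card_Ico]; omega
      rw [hempty, Finset.sum_empty, hi] at h3
      exact h3
    · rw [Nat.ble_eq]
      change S (d + 1) + bitCount (nonrealMask (c d)) * (n - 1) + bitCount (nonrealMask (c i)) ≤ N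
      have h4 := hbound d ((Finset.Ico (d + 1) 6).erase i)
        ((Finset.erase_subset _ _).trans (Finset.Ico_subset_Ico_left (by omega)))
      rw [Finset.card_erase_of_mem hmem, Nat.card_Ico, show 6 - (d + 1) - 1 = n - 1 by omega, mul_comm] at h4
      omega

/-! ### Sorting rows and columns -/

/-- The label of an entry: `2` if it is real, `1` if it is imaginary, `0` otherwise. -/
noncomputable def label (z : ℂ) : ℕ := if z.im = 0 then 2 else if z.re = 0 then 1 else 0

/-- The weight of a label in the first two criteria of the order of the rows. -/
def labelWeight (d : ℕ) : ℕ := if d = 2 then 0 else if d = 1 then 8019 else 7290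

/-- The sort key of a sequence of labels. -/
def labelKey (d : Fin 6 → ℕ) : ℕ := ∑ k, labelWeight (d k) + ∑ k, d k * 3 ^ (5 - k.1)

theorem bitCount_eq_sum {m : ℕ} (hm : m < 64) : bitCount m = ∑ k : Fin 6, if m.testBit k then 1 else 0 := by
  revert m
  decide +kernel

theorem ternary_eq_sum {m : ℕ} (hm : m < 64) : ternary m = ∑ k : Fin 6, if m.testBit k then 3 ^ (5 - k.1) else 0 := by
  revert m
  decide +kernel

theorem Encodes.rowKey_eq {v : Fin 6 → ℂ} {m : ℕ} (h : Encodes v m) (hv : ∀ k, ‖v k‖ = 1) :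
    rowKey m = labelKey fun k => label (v k) := by
  rw [rowKey, bitCount_eq_sum (nonrealMask_lt m), bitCount_eq_sum (imagMask_lt h.lt), ternary_eq_sum (realMask_lt m),
    ternary_eq_sum (imagMask_lt h.lt), labelKey, Finset.mul_sum, Finset.mul_sum, Finset.mul_sum,
    ← Finset.sum_add_distrib, ← Finset.sum_add_distrib, ← Finset.sum_add_distrib, ← Finset.sum_add_distrib]
  refine Finset.sum_congr rfl fun k _ => ?_
  have hn : (nonrealMask m).testBit k = true ↔ ¬ (v k).im = 0 := by
    rw [← mem_bits, h.bits_nonrealMask, mem_nonrealSet]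
  have hr := h.real k
  have hi := h.imag k
  rw [mem_bits] at hr hi
  simp only [hn, hr, hi, label, labelWeight]
  by_cases h1 : (v k).im = 0
  · have h2 : ¬ (v k).re = 0 := fun h2 => Encodes.not_real_and_imag (hv k) h1 h2
    simp [h1, h2]
  · by_cases h2 : (v k).re = 0 <;> simp [h1, h2]

/-- The weights do not depend on positions, and moving the smaller digit to the more significant
place lowers the base three number. -/
theorem labelKey_swap_lt (d : Fin 6 → ℕ) (j : Fin 5) (h : d j.succ < d j.castSucc) :
    labelKey (d ∘ Equiv.swap j.castSucc j.succ) < labelKey d := by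
  unfold labelKey
  rw [show ∑ k, labelWeight ((d ∘ Equiv.swap j.castSucc j.succ) k) = ∑ k, labelWeight (d k) from
    Equiv.sum_comp (Equiv.swap j.castSucc j.succ) fun k => labelWeight (d k)]
  apply Nat.add_lt_add_left
  have hk : ∀ k, d (Equiv.swap j.castSucc j.succ k) =
      if k = j.castSucc then d j.succ else if k = j.succ then d j.castSucc else d k := fun k => by
    rw [Equiv.swap_apply_def]; split_ifs <;> rfl
  simp only [Function.comp_apply, hk, Fin.sum_univ_six]
  fin_cases j <;> simp [Fin.ext_iff] at h ⊢ <;> omega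

theorem labelKey_swap_eq (d : Fin 6 → ℕ) (j : Fin 5) (h : d j.castSucc = d j.succ) :
    labelKey (d ∘ Equiv.swap j.castSucc j.succ) = labelKey d := by
  congr 1
  funext k
  rw [Function.comp_apply, Equiv.swap_apply_def]
  split_ifs with h1 h2
  · rw [h1, h]
  · rw [h2, h]
  · rfl

/-- The rows of a matrix are sorted by their keys, and its columns are sorted by their labels. -/
structure LabelSorted (H : Matrix (Fin 6) (Fin 6) ℂ) : Prop where
  rows : ∀ i j, i < j → labelKey (fun k => label (H i k)) ≤ labelKey fun k => label (H j k)
  columns : ∀ (j : Fin 5) (i : Fin 6), (∀ i' < i, label (H i' j.castSucc) = label (H i' j.succ)) →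
    label (H i j.castSucc) ≤ label (H i j.succ)

/-- A pair of permutations is chosen for which the sequence of row keys is lexicographically
minimal. Neither a swap of rows nor one of neighbouring columns can lower it. A column swap leaves
the keys of the earlier rows unchanged when their labels agree there, so the first disagreement has
to be increasing. -/
theorem exists_labelSorted (H : Matrix (Fin 6) (Fin 6) ℂ) :
    ∃ s t : Equiv.Perm (Fin 6), LabelSorted (H.submatrix s t) := by
  obtain ⟨⟨s, t⟩, hst⟩ := Finite.exists_min fun x : Equiv.Perm (Fin 6) × Equiv.Perm (Fin 6) =>
    toLex fun i : Fin 6 => labelKey fun k => label (H (x.1 i) (x.2 k))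
  have key : ∀ (x : Equiv.Perm (Fin 6) × Equiv.Perm (Fin 6)) (i : Fin 6),
      (∀ i' < i, labelKey (fun k => label (H (x.1 i') (x.2 k))) = labelKey fun k => label (H (s i') (t k))) →
      ¬ labelKey (fun k => label (H (x.1 i) (x.2 k))) < labelKey fun k => label (H (s i) (t k)) := by
    intro x i h1 h2
    exact absurd (hst x) (not_le.mpr ⟨i, h1, h2⟩)
  refine ⟨s, t, ⟨fun i j hij => ?_, fun j i h => ?_⟩⟩
  · have := key (Equiv.swap i j |>.trans s, t) i (fun i' hi' => by
      simp only [Equiv.trans_apply, Equiv.swap_apply_of_ne_of_ne hi'.ne (hi'.trans hij).ne])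
    simpa using this
  · by_contra hlt
    rw [not_le] at hlt
    refine key (s, (Equiv.swap j.castSucc j.succ).trans t) i (fun i' hi' => ?_) ?_
    · exact labelKey_swap_eq (fun k => label (H (s i') (t k))) j (h i' hi')
    · exact labelKey_swap_lt (fun k => label (H (s i) (t k))) j hlt

theorem mem_bits_shiftRight {m : ℕ} {k : Fin 6} : k ∈ bits (Nat.shiftRight m 1) ↔ m.testBit (k + 1) = true := by
  rw [mem_bits]
  change (m >>> 1).testBit k = true ↔ _
  rw [Nat.testBit_shiftRight, add_comm]

theorem Encodes.label_lt_of_greaterNext {v : Fin 6 → ℂ} {m : ℕ} (h : Encodes v m) (j : Fin 5)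
    (hj : j.castSucc ∈ bits (greaterNext m)) : label (v j.succ) < label (v j.castSucc) := by
  have e : ∀ x : ℕ, x.testBit (j.castSucc + 1) = true ↔ j.succ ∈ bits x := fun x => by rw [mem_bits]; rfl
  rw [greaterNext, bits_lor, bits_land, bits_land, Finset.mem_union, Finset.mem_inter, Finset.mem_inter,
    mem_bits_shiftRight, mem_bits_shiftRight, e, e, h.real, h.imag, h.bits_nonrealMask, h.mem_genericMask,
    mem_nonrealSet] at hj
  unfold label
  rcases hj with ⟨h1, h2⟩ | ⟨h1, h2, h3⟩
  · simp only [h1, h2, if_true, if_false]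
    split_ifs <;> norm_num
  · simp only [h1, h2, h3, if_true, if_false]
    split_ifs <;> norm_num

theorem Encodes.label_eq_of_equalNext {v : Fin 6 → ℂ} {m : ℕ} (h : Encodes v m) (hv : ∀ k, ‖v k‖ = 1) (j : Fin 5)
    (hj : j.castSucc ∈ bits (equalNext m)) : label (v j.castSucc) = label (v j.succ) := by
  have e : ∀ x : ℕ, x.testBit (j.castSucc + 1) = true ↔ j.succ ∈ bits x := fun x => by rw [mem_bits]; rfl
  rw [equalNext, bits_lor, bits_lor, bits_land, bits_land, bits_land, Finset.mem_union, Finset.mem_union,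
    Finset.mem_inter, Finset.mem_inter, Finset.mem_inter, mem_bits_shiftRight, mem_bits_shiftRight,
    mem_bits_shiftRight, e, e, e, h.real, h.imag, h.mem_genericMask, h.real, h.imag, h.mem_genericMask] at hj
  unfold label
  rcases hj with (⟨h1, h2⟩ | ⟨h1, h2⟩) | ⟨h1, h2⟩
  · simp [h1, h2]
  · have h3 : ¬ (v j.castSucc).im = 0 := fun h => Encodes.not_real_and_imag (hv _) h h1
    have h4 : ¬ (v j.succ).im = 0 := fun h => Encodes.not_real_and_imag (hv _) h h2
    simp [h1, h2, h3, h4]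
  · simp [h1.1, h1.2, h2.1, h2.2]

theorem mem_allRows {v : Fin 6 → ℂ} {m : ℕ} (h : Encodes v m) (hv : ∀ k, ‖v k‖ = 1) : m ∈ allRows := by
  rw [allRows, filterFast_eq, List.mem_filter, List.mem_range, Nat.beq_eq]
  refine ⟨h.lt, bits_injective (land_lt (imagMask_lt h.lt)) (by norm_num) ?_⟩
  ext k
  rw [bits_land, Finset.mem_inter, h.real, h.imag, bits_zero]
  simp only [Finset.notMem_empty, iff_false, not_and]
  exact fun h1 h2 => Encodes.not_real_and_imag (hv k) h1 h2

theorem greaterNext_lt {m : ℕ} (hm : m < 4096) : greaterNext m < 64 :=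
  lor_lt (land_lt_left (realMask_lt m)) (land_lt_left (imagMask_lt hm))


theorem ternary_le {m : ℕ} (hm : m < 64) : ternary m ≤ 364 := by
  revert m
  decide +kernel

theorem exists_castSucc_of_mem_bits : ∀ k ∈ bits 31, ∃ j : Fin 5, k = j.castSucc := by decide

/-- The codes of the rows of the matrix itself form a branch of the search that no test prunes. The
initial mask 31 stands for the five pairs of neighbouring columns. -/
theorem LabelSorted.search_eq_false {H : Matrix (Fin 6) (Fin 6) ℂ} (hs : LabelSorted H) (hH : IsComplexHadamard H) :
    search (∑ i, nonrealCount (H i)) 6 0 31 [] allRows = false := by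
  choose code hc using fun i => exists_encodes (H i)
  set c : ℕ → ℕ := fun d => if h : d < 6 then code ⟨d, h⟩ else 0 with hcdef
  have hcode : ∀ i : Fin 6, c i = code i := fun i => by simp [hcdef]
  have hrow : ∀ d (hd : d < 6), c d = code ⟨d, hd⟩ := fun d hd => by simp [hcdef, hd]
  set S : ℕ → ℕ := fun d => Nat.rec 0 (fun d s => s + bitCount (nonrealMask (c d))) d with hS
  set E : ℕ → ℕ := fun d => Nat.rec 31 (fun d e => Nat.land e (equalNext (c d))) d with hE
  set r : ℕ → List ℕ := fun d => Nat.rec [] (fun d r => c d :: r) d with hr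
  have hEbits : ∀ d ≤ 6, ∀ k ∈ bits (E d), k ∈ bits 31 ∧ ∀ i < d, k ∈ bits (equalNext (c i)) := by
    intro d hd
    induction d with
    | zero => exact fun k hk => ⟨hk, fun i hi => absurd hi (by omega)⟩
    | succ d ih =>
      intro k hk
      change k ∈ bits (Nat.land (E d) (equalNext (c d))) at hk
      rw [bits_land, Finset.mem_inter] at hk
      obtain ⟨h1, h2⟩ := ih (by omega) k hk.1
      refine ⟨h1, fun i hi => ?_⟩
      rcases Nat.lt_succ_iff_lt_or_eq.mp hi with hi | rfl
      exacts [h2 i hi, hk.2]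
  have hkey : ∀ i j, i < j → j < 6 → rowKey (c i) ≤ rowKey (c j) := by
    intro i j hij hj
    rw [hrow i (by omega), hrow j hj, (hc _).rowKey_eq (hH.2 _), (hc _).rowKey_eq (hH.2 _)]
    exact hs.rows _ _ hij
  have hrlist : ∀ d ≤ 6, ∃ l : List (Fin 6), l.Nodup ∧ (∀ x ∈ l, x.1 < d) ∧ r d = l.map code := by
    intro d hd
    induction d with
    | zero => exact ⟨[], List.nodup_nil, by simp, rfl⟩
    | succ d ih =>
      obtain ⟨l, h1, h2, h3⟩ := ih (by omega)
      refine ⟨⟨d, by omega⟩ :: l, List.nodup_cons.mpr ⟨fun h => absurd (h2 _ h) (by simp), h1⟩, ?_, ?_⟩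
      · intro x hx
        rcases List.mem_cons.mp hx with rfl | hx
        · exact Nat.lt_succ_self _
        · exact (h2 x hx).trans (Nat.lt_succ_self _)
      · rw [List.map_cons, ← h3, ← hrow d (by omega)]
  refine _root_.search_eq_false (c := c) (S := S) (E := E) (r := r) rfl (fun _ => rfl) (fun _ => rfl) (fun _ => rfl)
    ?_ hkey ?_ ?_ ?_ ?_ ?_ 6 le_rfl allRows ?_
  · intro i j hij hj
    have h := hkey i j hij hj
    -- The remaining terms of the key amount to at most `6 * 729 + 3 * 364 < 7290`, so the number of
    -- non-real entries dominates.
    have hb : ∀ m, m < 4096 → rowKey m < 7290 * bitCount (nonrealMask m) + 7290 ∧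
        7290 * bitCount (nonrealMask m) ≤ rowKey m := by
      intro m hm
      have h1 := bitCount_le_six (imagMask_lt hm)
      have h2 := ternary_le (realMask_lt m)
      have h3 := ternary_le (imagMask_lt hm)
      unfold rowKey
      omega
    have hi' := hb (c i) (by rw [hrow i (by omega)]; exact (hc _).lt)
    have hj' := hb (c j) (by rw [hrow j hj]; exact (hc _).lt)
    omega
  · intro i j hij hj
    rw [hrow i (by omega), hrow j hj]
    exact hH.pairOk hc (by rw [Ne, Fin.ext_iff]; dsimp only; omega)
  · rw [Fin.sum_univ_six]
    simp only [← fun i => (hc i).bitCount_nonrealMask, ← hcode]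
    change 0 + _ + _ + _ + _ + _ + _ = _
    rw [zero_add]
    rfl
  · intro d hd
    apply bits_injective (land_lt (greaterNext_lt (by rw [hrow d hd]; exact (hc _).lt))) (by norm_num)
    rw [bits_land, bits_zero, Finset.eq_empty_iff_forall_notMem]
    intro k hk
    rw [Finset.mem_inter] at hk
    obtain ⟨h1, h2⟩ := hEbits d hd.le k hk.1
    obtain ⟨j, rfl⟩ := exists_castSucc_of_mem_bits k h1
    have h3 := (hc ⟨d, hd⟩).label_lt_of_greaterNext j (by rw [← hrow d hd]; exact hk.2)
    refine absurd (hs.columns j ⟨d, hd⟩ fun i hi => ?_) (not_le.mpr h3)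
    refine (hc i).label_eq_of_equalNext (hH.2 i) j ?_
    rw [← hcode]
    exact h2 i hi
  · intro d hd
    obtain ⟨l, h1, -, h3⟩ := hrlist d hd
    rw [h3]
    exact hH.splitsOk hc h1
  -- The search accumulates rows in reverse, so the final test is applied to the matrix with its
  -- rows reversed, which is again Hadamard.
  · have h : r 6 = (List.finRange 6).map fun i => code i.rev := by
      have h1 : r 6 = [c 5, c 4, c 3, c 2, c 1, c 0] := rfl
      rw [h1]
      simp only [hcdef]
      rfl
    rw [h]
    exact (hH.submatrix Fin.revPerm (Equiv.refl _)).excluded fun i => hc i.rev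
  · intro i _ hi
    rw [hrow i hi]
    exact mem_allRows (hc _) (hH.2 _)

theorem nonrealCount_comp_perm {n : ℕ} (v : Fin n → ℂ) (t : Equiv.Perm (Fin n)) :
    nonrealCount (fun k => v (t k)) = nonrealCount v := by
  unfold nonrealCount nonrealSet
  refine Finset.card_bij (fun k _ => t k) (by simp) (by simp) fun k hk => ⟨t.symm k, ?_, by simp⟩
  simpa using hk

theorem IsComplexHadamard.search_eq_false {H : Matrix (Fin 6) (Fin 6) ℂ} (hH : IsComplexHadamard H) :
    search (∑ i, nonrealCount (H i)) 6 0 31 [] allRows = false := by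
  obtain ⟨s, t, h⟩ := exists_labelSorted H
  have hsum : ∑ i, nonrealCount (H.submatrix s t i) = ∑ i, nonrealCount (H i) :=
    (Finset.sum_congr rfl fun i _ => nonrealCount_comp_perm (H (s i)) t).trans
      (Equiv.sum_comp s fun i => nonrealCount (H i))
  exact (congrArg (fun N => search N 6 0 31 [] allRows) hsum).symm.trans (h.search_eq_false (hH.submatrix s t))

/-! ### The computation and the conclusion -/

theorem search_thirteen : search 13 6 0 31 [] allRows = true := by decide +kernel

/-- Six is absent because `C + i I` attains it; with 13 these are the numbers `36 - m` for the
values `m ≤ 36` to be excluded. -/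
theorem search_small : ∀ N ∈ [0, 1, 2, 3, 4, 5, 7, 8, 9], search N 6 0 31 [] allRows = true := by decide +kernel

theorem realEntryCounts_six : realEntryCounts 6 = Set.Icc 0 22 ∪ {24, 25, 26, 30} := by
  ext m
  simp only [Set.mem_union, Set.mem_Icc, Set.mem_insert_iff, Set.mem_singleton_iff]
  constructor
  · rintro ⟨H, hH, rfl⟩
    have h1 := numRealEntries_add_sum_nonrealCount H
    have h2 := hH.search_eq_false
    have h3 : ∑ i, nonrealCount (H i) ∉ [0, 1, 2, 3, 4, 5, 7, 8, 9] := fun h => by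
      rw [search_small _ h] at h2; exact absurd h2 (by decide)
    have h4 : ∑ i, nonrealCount (H i) ≠ 13 := fun h => by
      rw [h, search_thirteen] at h2; exact absurd h2 (by decide)
    simp only [List.mem_cons, List.not_mem_nil, or_false, not_or] at h3
    omega
  · intro h
    exact mem_realEntryCounts_six (by omega)

theorem mainTheorem1 :
    (∀ n : ℕ, 0 < n → Set.Icc 0 n ⊆ realEntryCounts n) ∧
    (∀ n : ℕ, Odd n → Set.Icc (n + 1) (2 * n - 1) ⊆ realEntryCounts n) ∧
    realEntryCounts 3 = Set.Icc 0 6 ∧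
    realEntryCounts 4 = Set.Icc 0 10 ∪ {12, 16} ∧
    realEntryCounts 6 = Set.Icc 0 22 ∪ {24, 25, 26, 30} := by
  refine ⟨fun n hn => Icc_subset_realEntryCounts hn, fun n h => Icc_subset_realEntryCounts_of_odd h,
    realEntryCounts_three, realEntryCounts_four, realEntryCounts_six⟩
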